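/- Let $(X,d)$ be a geodesic metric space and let $G$ be a group acting geometrically on $X$, i.e. by isometries, properly discontinuously and cocompactly. Suppose that $G$ is not virtually cyclic, and that some $\varphi\in G$ acts on $X$ as a strongly contracting isometry, in the following sense. For $A\subseteq X$ and $x\in X$ let $\pi_A(x)=\{p\in A: d(x,p)=d(x,A)\}$. An isometry $\phi$ of $X$ is called strongly contracting if there are $x_0\in X$ and $K>0$ such that $i\mapsto \phi^i x_0$ $(i\in\mathbb Z)$ is a $K$-quasi-geodesic, that is, $$\tfrac1K|i-j|-K\le d(\phi^i x_0,\phi^j x_0)\le K|i-j|+K \quad\text{for all } i,j\in\mathbb Z,$$ and such that the orbit $A=\{\phi^i x_0: i\in\mathbb Z\}$ is $K$-strongly contracting: for each $x\in X$ with $d(x,A)>K$, the set $\bigcup_{y\in B}\pi_A(y)$ has diameter at most $K$, where $B$ is the ball of radius $d(x,A)$ centered at $x$. Let $S$ be any finite generating set of $G$, let $\|g\|_S$ be the least length of a word in $S\cup S^{-1}$ representing $g$, let $B_S(R)=\{g\in G:\|g\|_S\le R\}$, and let $\tau_S(g)=\liminf_{n\to\infty}\frac1n\|g^n\|_S$.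 Then for each $k>0$ there exists $C>0$ such that for all $R>0$, $$\frac{\#\{g\in B_S(R): g \text{ is not strongly contracting or } \tau_S(g)\le 0.3R\}}{\#B_S(R)}\le \frac{C}{R^{k/2}}.$$ -/

import Mathlib

/-! ### Geometry of metric spaces -/

/-- A geodesic metric space: any two points are joined by an isometrically embedded segment. -/
def IsGeodesicSpace (X : Type*) [MetricSpace X] : Prop :=
  ∀ x y : X, ∃ c : ℝ → X, c 0 = x ∧ c (dist x y) = y ∧
    ∀ s ∈ Set.Icc (0 : ℝ) (dist x y), ∀ t ∈ Set.Icc (0 : ℝ) (dist x y),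
      dist (c s) (c t) = |s - t|

/-- The nearest point projection `π_A(x)`: the set of all points of `A` that realize the distance
from `x` to `A`. -/
def nearestPointProj {X : Type*} [MetricSpace X] (A : Set X) (x : X) : Set X :=
  {p | p ∈ A ∧ dist x p = Metric.infDist x A}

/-- `A` is `K`-strongly contracting: for every `x` with `d(x, A) > K`, the projection to `A` of the
ball of radius `d(x, A)` centred at `x` has diameter at most `K`. -/
def IsStronglyContractingSet {X : Type*} [MetricSpace X] (K : ℝ) (A : Set X) : Prop :=
  ∀ x : X, K < Metric.infDist x A →
    ∀ y ∈ Metric.ball x (Metric.infDist x A), ∀ z ∈ Metric.ball x (Metric.infDist x A),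
      ∀ p ∈ nearestPointProj A y, ∀ q ∈ nearestPointProj A z, dist p q ≤ K

/-- A bi-infinite sequence is a `K`-quasi-geodesic. -/
def IsQuasiGeodesic {X : Type*} [MetricSpace X] (K : ℝ) (c : ℤ → X) : Prop :=
  ∀ i j : ℤ, |(i : ℝ) - j| / K - K ≤ dist (c i) (c j) ∧
    dist (c i) (c j) ≤ K * |(i : ℝ) - j| + K

/-! ### Group actions -/

/-- The action of `G` on `X` is geometric: by isometries, properly discontinuous and cocompact. -/
structure IsGeometricAction (G X : Type*) [Group G] [MetricSpace X] [MulAction G X] : Prop where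
  isometric : IsIsometricSMul G X
  properlyDiscontinuous : ProperlyDiscontinuousSMul G X
  cocompact : ∃ C : Set X, IsCompact C ∧ ∀ x : X, ∃ g : G, ∃ c ∈ C, g • c = x

/-- The group element `g` acts on `X` as a strongly contracting isometry: for some base point `x₀`
and some `K > 0`, the orbit `(gⁱ x₀)`, `i ∈ ℤ`, is a `K`-strongly contracting `K`-quasi-geodesic. -/
def IsStronglyContracting {G : Type*} (X : Type*) [Group G] [MetricSpace X] [MulAction G X]
    (g : G) : Prop :=
  ∃ x₀ : X, ∃ K : ℝ, 0 < K ∧ IsQuasiGeodesic K (fun i : ℤ => g ^ i • x₀) ∧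
    IsStronglyContractingSet K (Set.range fun i : ℤ => g ^ i • x₀)

/-- `G` has a cyclic subgroup of finite index (in particular, finite groups are virtually
cyclic). -/
def IsVirtuallyCyclic (G : Type*) [Group G] : Prop :=
  ∃ H : Subgroup G, IsCyclic H ∧ H.FiniteIndex

/-! ### Word metrics -/

/-- The word norm `‖g‖_S`: the least length of a word in `S ∪ S⁻¹` that represents `g`
(meaningful when `S` generates `G`). -/
noncomputable def wordNorm {G : Type*} [Group G] (S : Finset G) (g : G) : ℕ :=
  sInf {n : ℕ | ∃ l : List G, l.length = n ∧ (∀ a ∈ l, a ∈ S ∨ a⁻¹ ∈ S) ∧ l.prod = g}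

/-- The ball `B_S(R)` of radius `R` around the identity in the word metric. -/
def wordBall {G : Type*} [Group G] (S : Finset G) (R : ℝ) : Set G :=
  {g | (wordNorm S g : ℝ) ≤ R}

/-- The translation length `τ_S(g) = liminf ‖gⁿ‖_S / n`. -/
noncomputable def translationLength {G : Type*} [Group G] (S : Finset G) (g : G) : ℝ :=
  Filter.liminf (fun n : ℕ => (wordNorm S (g ^ n) : ℝ) / n) Filter.atTop

/-- If `S` generates, every element is represented by a word whose length is its norm. -/
theorem exists_word_of_closure_eq_top {G : Type*} [Group G] {S : Finset G}
    (hS : Subgroup.closure (S : Set G) = ⊤) (g : G) :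
    ∃ l : List G, l.length = wordNorm S g ∧ (∀ a ∈ l, a ∈ S ∨ a⁻¹ ∈ S) ∧ l.prod = g := by
  have hg : g ∈ Submonoid.closure ((S : Set G) ∪ (S : Set G)⁻¹) := by
    rw [← Subgroup.closure_toSubmonoid, hS]
    exact Subgroup.mem_top g
  obtain ⟨l, hl, hlg⟩ := Submonoid.exists_list_of_mem_closure hg
  exact Nat.sInf_mem
    (s := {n : ℕ | ∃ l : List G, l.length = n ∧ (∀ a ∈ l, a ∈ S ∨ a⁻¹ ∈ S) ∧ l.prod = g})
    ⟨l.length, l, rfl, fun a ha => by simpa using hl a ha, hlg⟩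

/-- If `S` generates, balls are finite, so that they can be counted by `Set.ncard`. -/
theorem wordBall_finite {G : Type*} [Group G] {S : Finset G}
    (hS : Subgroup.closure (S : Set G) = ⊤) (R : ℝ) : (wordBall S R).Finite := by
  classical
  let T : Set G := {a | a ∈ S ∨ a⁻¹ ∈ S}
  have hT : T.Finite := by
    refine (S.finite_toSet.union (S.finite_toSet.image fun a => a⁻¹)).subset ?_
    rintro a (ha | ha)
    · exact Or.inl ha
    · exact Or.inr ⟨a⁻¹, ha, inv_inv a⟩
  have : Finite T := hT
  have hL : ({l : List T | l.length ≤ ⌊R⌋₊}).Finite := List.finite_length_le T _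
  refine (hL.image fun l => (l.map Subtype.val).prod).subset ?_
  intro g hg
  obtain ⟨l, hl, hm, rfl⟩ := exists_word_of_closure_eq_top hS g
  refine ⟨l.attach.map fun a => ⟨a.1, hm a.1 a.2⟩, ?_, ?_⟩
  · simpa [hl] using Nat.le_floor hg
  · simp [Function.comp_def]

/-!
Let `φ` be strongly contracting with axis the orbit of `o`, and let `f x` be the index of a nearest
point of the axis to `x`. The properties of `f` that the argument uses are collected in
`ContractingAxis`; the essential one is that a geodesic whose endpoints have different values of
`f` passes close to the piece of the axis in between. A translate by `h` of the piece
`o, …, φ ^ M o` of the axis thus acts as a wall between the half-spaces `InLeft` and `InRight` at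
`h`. Two walls are ordered, `Precedes`, if the right half-space of the first and the left
half-space of the second cover the space.

Suppose that `g` translates a wall `α` past itself, `Precedes f M m α (g * α)`. The walls
`g ^ i * α` then form a chain. It shows that the orbit of `g` is strongly contracting: a geodesic between
points that project far apart to the orbit passes close to an orbit point in between
(`Precedes.isStronglyContracting`). It also bounds the length of `g ^ N` from below by almost `N`
times the distance from `α` to `g * α` (`Precedes.mul_le_wordNorm_pow`), because a word geodesic
that crosses the chain can be given points close to all the walls (`exists_tight_chain`). Here, and
throughout, the control of word geodesics near walls comes from `ContractingAxis.exists_progress`: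
away from the axis the coordinate `f` moves slowly, so that a word geodesic of length `n` that
crosses a wall comes `n / Λ`-close to it.

So it suffices that all but few elements `g` of length `n` have a barrier, which is a wall `α` that
separates `1` from `g` and is close to the point of a word geodesic from `1` to `g` at some time
between `n / 5` and `3 n / 10`. Indeed, the path from `g` to `g α` is then too short to cross `α`,
and if the path from `α` to `g` crosses `g α`, then `g` is nearly conjugate to a much shorter element
(`HasReturn`). There are exponentially few such `g`, because the cardinality of balls of radius `n`
lies between `exp (h n)` and a multiple of `exp (1.1 h n)` for some `h > 0` (`exists_growth_rate`).
If neither path crosses, then `α` precedes `g α` (`ContractingAxis.precedes_mul_of_barrier`).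

To count the elements without barriers, insert `k + 1` walls into a geodesic word of `g` at
arbitrary times of the window, joined by connecting elements from a finite set so that the result
crosses all the inserted walls. The lengths grow by a constant, and there are about `n ^ (k + 1)`
choices. If more than about `n * (log n) ^ k` pairs of an element and a choice of times gave the
same result, then at some stage more than about `log n` walls would be available for the next
insertion after the same previous insertions. All of them are crossed by one pair of points, hence
form a chain, and a word geodesic that crosses a chain longer than the logarithm of its length
cannot come back across it (`mem_right_of_chain`), since each wall crossed forth and back halves the
excursion. So the middle wall would be a barrier of the element
(`CrossingOrder.card_le_of_not_hasBarrier`).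
Hence at most a proportion of order `n ^ (-k)`, up to logarithms, has no barrier.
-/

/-! ### Nearest-point projections to strongly contracting sets -/

section Projection

variable {X : Type*} [MetricSpace X] {A : Set X} {K : ℝ} {p : X → X}

theorem dist_proj_le_of_dist_lt (hK : 0 < K) (hA : IsStronglyContractingSet K A)
    (hp : ∀ x, p x ∈ nearestPointProj A x) {x y : X} (hx : K < Metric.infDist x A)
    (hxy : dist x y < Metric.infDist x A) : dist (p x) (p y) ≤ K :=
  hA x hx x (Metric.mem_ball_self (hK.trans hx)) y (by rwa [Metric.mem_ball, dist_comm])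
    _ (hp x) _ (hp y)

theorem dist_proj_le_of_chain (hK : 0 < K) (hA : IsStronglyContractingSet K A)
    (hp : ∀ x, p x ∈ nearestPointProj A x) (w : ℕ → X) (N : ℕ)
    (h : ∀ i < N, K < Metric.infDist (w i) A ∧ dist (w i) (w (i + 1)) < Metric.infDist (w i) A) :
    dist (p (w 0)) (p (w N)) ≤ K * N := by
  induction N with
  | zero => simp
  | succ n ih =>
    have h1 := ih fun i hi => h i (by omega)
    have h2 := dist_proj_le_of_dist_lt hK hA hp (h n (by omega)).1 (h n (by omega)).2
    have h3 := dist_triangle (p (w 0)) (p (w n)) (p (w (n + 1)))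
    push_cast
    linarith

/-- The projection to a strongly contracting set is coarsely Lipschitz: it moves boundedly unless
both points are so close to `A` that the triangle inequality suffices. -/
theorem dist_proj_le (hK : 0 < K) (hA : IsStronglyContractingSet K A)
    (hp : ∀ x, p x ∈ nearestPointProj A x) (x y : X) :
    dist (p x) (p y) ≤ 3 * dist x y + 2 * K := by
  have hd := dist_nonneg (x := x) (y := y)
  by_cases h1 : K < Metric.infDist x A ∧ dist x y < Metric.infDist x A
  · have := dist_proj_le_of_dist_lt hK hA hp h1.1 h1.2
    linarith
  by_cases h2 : K < Metric.infDist y A ∧ dist y x < Metric.infDist y A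
  · have := dist_proj_le_of_dist_lt hK hA hp h2.1 h2.2
    rw [dist_comm]
    linarith
  have e1 : Metric.infDist x A ≤ dist x y + K := by
    by_contra hc
    exact h1 ⟨by linarith, by linarith⟩
  have e2 : Metric.infDist y A ≤ dist x y + K := by
    by_contra hc
    exact h2 ⟨by linarith, by rw [dist_comm]; linarith⟩
  have a1 := (hp x).2
  have a2 := (hp y).2
  have t1 := dist_triangle (p x) x (p y)
  have t2 := dist_triangle x y (p y)
  rw [dist_comm (p x) x] at t1
  linarith

/-- `c` restricts to an isometric embedding of the interval `[0, ℓ]`. -/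
def IsGeodesicOn {X : Type*} [MetricSpace X] (c : ℝ → X) (ℓ : ℝ) : Prop :=
  ∀ s ∈ Set.Icc (0 : ℝ) ℓ, ∀ t ∈ Set.Icc (0 : ℝ) ℓ, dist (c s) (c t) = |s - t|

theorem IsGeodesicOn.dist_eq {c : ℝ → X} {ℓ s t : ℝ} (hc : IsGeodesicOn c ℓ) (hs : 0 ≤ s)
    (hst : s ≤ t) (ht : t ≤ ℓ) : dist (c s) (c t) = t - s := by
  rw [hc s ⟨hs, hst.trans ht⟩ t ⟨hs.trans hst, ht⟩, abs_sub_comm, abs_of_nonneg (by linarith)]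

theorem IsGeodesicOn.reverse {c : ℝ → X} {ℓ : ℝ} (hc : IsGeodesicOn c ℓ) :
    IsGeodesicOn (fun t => c (ℓ - t)) ℓ := by
  intro s hs t ht
  rw [hc _ ⟨by linarith [hs.2], by linarith [hs.1]⟩ _ ⟨by linarith [ht.2], by linarith [ht.1]⟩,
    abs_sub_comm]
  congr 1
  ring

/-- Along a stretch of a geodesic that stays at distance at least `H` from `A`, the projection to
`A` moves by at most `K` in every step of length less than `H`. -/
theorem dist_proj_le_of_far (hK : 0 < K) (hA : IsStronglyContractingSet K A)
    (hp : ∀ x, p x ∈ nearestPointProj A x) {c : ℝ → X} {ℓ H a b : ℝ} (hc : IsGeodesicOn c ℓ)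
    (hH : K < H) (ha : 0 ≤ a) (hab : a ≤ b) (hb : b ≤ ℓ)
    (hfar : ∀ t, a ≤ t → t < b → H ≤ Metric.infDist (c t) A) :
    dist (p (c a)) (p (c b)) ≤ K * ((b - a) / H + 1) := by
  have hH0 : 0 < H := hK.trans hH
  set N : ℕ := ⌊(b - a) / H⌋₊ + 1 with hN
  have hN0 : (0 : ℝ) < N := by rw [hN]; positivity
  have hN1 : (b - a) / H < N := by rw [hN]; push_cast; exact Nat.lt_floor_add_one _
  have hN2 : (N : ℝ) ≤ (b - a) / H + 1 := by
    rw [hN]; push_cast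
    have := Nat.floor_le (a := (b - a) / H) (div_nonneg (by linarith) hH0.le)
    linarith
  have hstep : (b - a) / N < H := by
    rw [div_lt_iff₀ hN0]
    rw [div_lt_iff₀ hH0] at hN1
    linarith
  have hs0 : 0 ≤ (b - a) / N := div_nonneg (by linarith) hN0.le
  have hNs : (N : ℝ) * ((b - a) / N) = b - a := by field_simp
  rcases hab.eq_or_lt with rfl | hlt
  · simp; positivity
  have hspos : 0 < (b - a) / N := div_pos (by linarith) hN0
  have key := dist_proj_le_of_chain hK hA hp (fun i => c (a + i * ((b - a) / N))) N ?_
  · simp only [Nat.cast_zero, zero_mul, add_zero, hNs, add_sub_cancel] at key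
    exact key.trans (by gcongr)
  · intro i hi
    have hi' : ((i : ℝ) + 1) ≤ N := by exact_mod_cast hi
    have h1 : (i : ℝ) * ((b - a) / N) + (b - a) / N ≤ b - a := by
      have := mul_le_mul_of_nonneg_right hi' hs0
      linarith
    have h0 : 0 ≤ (i : ℝ) * ((b - a) / N) := by positivity
    have hf := hfar (a + i * ((b - a) / N)) (by linarith) (by linarith)
    refine ⟨by linarith, ?_⟩
    push_cast
    rw [hc.dist_eq (by linarith) (by nlinarith) (by linarith)]
    nlinarith

/-- A geodesic that stays far from `A` up to time `t` moves its projection essentially only after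
time `d(c 0, A)`. -/
theorem dist_proj_initial_le (hK : 0 < K) (hA : IsStronglyContractingSet K A)
    (hp : ∀ x, p x ∈ nearestPointProj A x) {c : ℝ → X} {ℓ t : ℝ} (hc : IsGeodesicOn c ℓ)
    (ht : 0 ≤ t) (htl : t ≤ ℓ)
    (hfar : ∀ s, 0 ≤ s → s < t → 20 * K ≤ Metric.infDist (c s) A) :
    dist (p (c 0)) (p (c t)) ≤ 3 * K + max (t - Metric.infDist (c 0) A) 0 / 20 := by
  set r := Metric.infDist (c 0) A with hr
  have hm := le_max_left (t - r) 0
  have hm0 := le_max_right (t - r) 0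
  rcases ht.eq_or_lt with rfl | ht0
  · rw [dist_self]
    positivity
  have hr20 : 20 * K ≤ r := hfar 0 le_rfl ht0
  rcases lt_or_ge t r with htr | htr
  · have := dist_proj_le_of_dist_lt hK hA hp (x := c 0) (y := c t) (by linarith)
      (by rw [hc.dist_eq le_rfl ht htl]; linarith)
    linarith
  · have h1 := dist_proj_le_of_dist_lt hK hA hp (x := c 0) (y := c (r - K)) (by linarith)
      (by rw [hc.dist_eq le_rfl (by linarith) (by linarith)]; linarith)
    have h2 := dist_proj_le_of_far hK hA hp (H := 20 * K) hc (by linarith)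
      (a := r - K) (b := t) (by linarith) (by linarith) htl
      (fun s hs1 hs2 => hfar s (by linarith) hs2)
    have h3 : K * ((t - (r - K)) / (20 * K) + 1) = (t - r) / 20 + K / 20 + K := by
      field_simp
      ring
    have h4 := dist_triangle (p (c 0)) (p (c (r - K))) (p (c t))
    linarith

/-- Points with distant projections to a strongly contracting set are joined efficiently through
their projections. -/
theorem dist_ge_of_dist_proj (hX : IsGeodesicSpace X) (hK : 0 < K)
    (hA : IsStronglyContractingSet K A) (hp : ∀ x, p x ∈ nearestPointProj A x) {x y : X}
    (hxy : 10 * K < dist (p x) (p y)) :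
    dist x (p x) + dist (p x) (p y) + dist (p y) y ≤ dist x y + 100 * K := by
  obtain ⟨c, hc0, hc1, hc⟩ := hX x y
  set ℓ := dist x y with hℓ
  have hc : IsGeodesicOn c ℓ := hc
  have hℓ0 : 0 ≤ ℓ := dist_nonneg
  have hr := (hp x).2
  have hs := (hp y).2
  rw [dist_comm (p y) y, hr, hs]
  set r := Metric.infDist x A
  set s := Metric.infDist y A
  have hcr : Metric.infDist (c 0) A = r := by rw [hc0]
  have hcs : Metric.infDist (c ℓ) A = s := by rw [hc1]
  have hr0 : 0 ≤ r := Metric.infDist_nonneg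
  have hs0 : 0 ≤ s := Metric.infDist_nonneg
  have hcr' := hc.reverse
  by_cases hZ : ∃ t ∈ Set.Icc (0 : ℝ) ℓ, Metric.infDist (c t) A ≤ 20 * K
  · -- the first and the last time at which the geodesic is close to `A`
    set Z := {t | t ∈ Set.Icc (0 : ℝ) ℓ ∧ Metric.infDist (c t) A ≤ 20 * K} with hZdef
    have hcont : ContinuousOn (fun t => Metric.infDist (c t) A) (Set.Icc 0 ℓ) := by
      refine (Metric.continuous_infDist_pt A).comp_continuousOn ?_
      refine Metric.continuousOn_iff.2 fun b hb ε hε => ⟨ε, hε, fun a ha hab => ?_⟩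
      rw [hc a ha b hb]
      rwa [Real.dist_eq] at hab
    have hZc : IsCompact Z := by
      have : Z = Set.Icc (0 : ℝ) ℓ ∩ (fun t => Metric.infDist (c t) A) ⁻¹' Set.Iic (20 * K) := rfl
      rw [this]
      exact isCompact_Icc.of_isClosed_subset
        (hcont.preimage_isClosed_of_isClosed isClosed_Icc isClosed_Iic) Set.inter_subset_left
    have hZn : Z.Nonempty := by
      obtain ⟨t, ht, h⟩ := hZ
      exact ⟨t, ht, h⟩
    obtain ⟨a, haZ, hamin⟩ := hZc.exists_isLeast hZn
    obtain ⟨b, hbZ, hbmax⟩ := hZc.exists_isGreatest hZn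
    have hab : a ≤ b := hamin hbZ
    have h1 := dist_proj_initial_le hK hA hp hc haZ.1.1 haZ.1.2 fun t ht0 hta => by
      by_contra hcon
      have : a ≤ t := hamin ⟨⟨ht0, hta.le.trans haZ.1.2⟩, (not_le.1 hcon).le⟩
      linarith
    have h2 := dist_proj_initial_le hK hA hp hcr' (t := ℓ - b) (by linarith [hbZ.1.2])
      (by linarith [hbZ.1.1]) fun t ht0 hta => by
      by_contra hcon
      have : ℓ - t ≤ b :=
        hbmax ⟨⟨by linarith [hbZ.1.1], by linarith⟩, (not_le.1 hcon).le⟩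
      linarith
    simp only [sub_zero, sub_sub_cancel, hc0, hc1] at h1 h2
    have hta := (hp (c a)).2
    have htb := (hp (c b)).2
    have hdab := hc.dist_eq haZ.1.1 hab hbZ.1.2
    have q1 := dist_triangle4 (p x) (p (c a)) (p (c b)) (p y)
    have q2 := dist_triangle4 (p (c a)) (c a) (c b) (p (c b))
    rw [dist_comm (p (c a)) (c a)] at q2
    rw [dist_comm (p y)] at h2
    have hra : r ≤ a + 20 * K := by
      have := Metric.infDist_le_infDist_add_dist (s := A) (x := c 0) (y := c a)
      rw [hc.dist_eq le_rfl haZ.1.1 haZ.1.2, hcr] at this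
      linarith [haZ.2]
    have hsb : s ≤ ℓ - b + 20 * K := by
      have := Metric.infDist_le_infDist_add_dist (s := A) (x := c ℓ) (y := c b)
      rw [dist_comm, hc.dist_eq hbZ.1.1 hbZ.1.2 le_rfl, hcs] at this
      linarith [hbZ.2]
    have e1 : max (a - r) 0 ≤ a - r + 20 * K := max_le (by linarith) (by linarith)
    have e2 : max (ℓ - b - s) 0 ≤ ℓ - b - s + 20 * K := max_le (by linarith) (by linarith)
    linarith [haZ.2, hbZ.2]
  · exfalso
    push Not at hZ
    have hr20 : 20 * K < r := hcr ▸ hZ 0 ⟨le_rfl, hℓ0⟩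
    have hs20 : 20 * K < s := hcs ▸ hZ ℓ ⟨hℓ0, le_rfl⟩
    rcases lt_or_ge ℓ (r + s) with hlt | hge
    · obtain ⟨t, ht1, ht2⟩ : ∃ t, max 0 (ℓ - s) < t ∧ t < min r (ℓ + K) :=
        exists_between (by
          rw [max_lt_iff, lt_min_iff, lt_min_iff]
          refine ⟨⟨by linarith, by linarith⟩, by linarith, by linarith⟩)
      rw [max_lt_iff] at ht1
      rw [lt_min_iff] at ht2
      set u := min t ℓ with hu
      have hu0 : 0 ≤ u := le_min ht1.1.le hℓ0
      have hul : u ≤ ℓ := min_le_right _ _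
      have hut : u ≤ t := min_le_left _ _
      have hus : ℓ - s < u := lt_min ht1.2 (by linarith)
      have h1 := dist_proj_le_of_dist_lt hK hA hp (x := c 0) (y := c u) (by linarith)
        (by rw [hc.dist_eq le_rfl hu0 hul]; linarith)
      have h2 := dist_proj_le_of_dist_lt hK hA hp (x := c ℓ) (y := c u) (by linarith)
        (by rw [dist_comm, hc.dist_eq hu0 hul le_rfl]; linarith)
      rw [hc0] at h1
      rw [hc1] at h2
      have := dist_triangle_right (p x) (p y) (p (c u))
      linarith
    · have h1 := dist_proj_initial_le hK hA hp hc (t := ℓ - s + K) (by linarith) (by linarith)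
        fun t ht0 hta => (hZ t ⟨ht0, by linarith⟩).le
      have h2 := dist_proj_le_of_dist_lt hK hA hp (x := c ℓ) (y := c (ℓ - s + K)) (by linarith)
        (by rw [dist_comm, hc.dist_eq (by linarith) (by linarith) le_rfl]; linarith)
      rw [hc0] at h1
      rw [hc1] at h2
      rw [max_eq_left (by linarith)] at h1
      have q1 := dist_triangle_right (p x) (p y) (p (c (ℓ - s + K)))
      have q2 := dist_triangle4 x (p x) (p y) y
      rw [hr, dist_comm (p y) y, hs] at q2
      linarith

end Projection

/-! ### The coordinate along a contracting axis -/

section QuasiGeodesic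

variable {X : Type*} [MetricSpace X] {K : ℝ} {c : ℤ → X}

theorem IsQuasiGeodesic.mono {K' : ℝ} (hK : 0 < K) (hKK : K ≤ K') (hc : IsQuasiGeodesic K c) :
    IsQuasiGeodesic K' c := by
  intro i j
  obtain ⟨h1, h2⟩ := hc i j
  have : |(i : ℝ) - j| / K' ≤ |(i : ℝ) - j| / K := by gcongr
  have : K * |(i : ℝ) - j| ≤ K' * |(i : ℝ) - j| := by gcongr
  constructor <;> linarith

theorem IsStronglyContractingSet.mono {K' : ℝ} {A : Set X} (hKK : K ≤ K')
    (hA : IsStronglyContractingSet K A) : IsStronglyContractingSet K' A :=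
  fun x hx y hy z hz q hq r hr => (hA x (hKK.trans_lt hx) y hy z hz q hq r hr).trans hKK

theorem IsQuasiGeodesic.abs_sub_le (hK : 0 < K) (hc : IsQuasiGeodesic K c) (i j : ℤ) :
    |(i : ℝ) - j| ≤ K * (dist (c i) (c j) + K) := by
  have := (hc i j).1
  have h : |(i : ℝ) - j| / K ≤ dist (c i) (c j) + K := by linarith
  rwa [div_le_iff₀ hK, mul_comm] at h

/-- Nearest points on a quasi-geodesic exist, since only finitely many of its terms lie in a given
ball. -/
theorem IsQuasiGeodesic.exists_mem_nearestPointProj (hK : 0 < K) (hc : IsQuasiGeodesic K c)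
    (x : X) : ∃ i : ℤ, c i ∈ nearestPointProj (Set.range c) x := by
  have hfin : {i : ℤ | dist x (c i) ≤ dist x (c 0)}.Finite := by
    obtain ⟨N, hN⟩ := exists_nat_gt (K * (2 * dist x (c 0) + K))
    refine (Set.finite_Icc (-(N : ℤ)) N).subset fun i hi => ?_
    have h1 := hc.abs_sub_le hK i 0
    have h2 := dist_triangle_left (c i) (c 0) x
    have h3 : |(i : ℝ)| < N := by
      simp only [Int.cast_zero, sub_zero] at h1
      refine h1.trans_lt (lt_of_le_of_lt ?_ hN)
      have : dist x (c i) ≤ dist x (c 0) := hi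
      gcongr
      linarith
    rw [abs_lt] at h3
    constructor
    · exact_mod_cast h3.1.le
    · exact_mod_cast h3.2.le
  obtain ⟨i, hi, hmin⟩ := Set.exists_min_image _ (fun i => dist x (c i)) hfin
    ⟨0, le_refl (dist x (c 0))⟩
  refine ⟨i, ⟨i, rfl⟩, le_antisymm ?_ (Metric.infDist_le_dist_of_mem ⟨i, rfl⟩)⟩
  rw [Metric.le_infDist (Set.range_nonempty c)]
  rintro _ ⟨j, rfl⟩
  by_cases hj : dist x (c j) ≤ dist x (c 0)
  · exact hmin j hj
  · exact (show dist x (c i) ≤ dist x (c 0) from hi).trans (not_le.1 hj).le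

end QuasiGeodesic

theorem exists_le_lt_succ {F : ℕ → ℤ} {N : ℕ} {i : ℤ} (h0 : F 0 ≤ i) (hN : i < F N) :
    ∃ j < N, F j ≤ i ∧ i < F (j + 1) := by
  by_contra hcon
  push Not at hcon
  have : ∀ j ≤ N, F j ≤ i := by
    intro j
    induction j with
    | zero => exact fun _ => h0
    | succ j ih => exact fun hj => hcon j (by omega) (ih (by omega))
  exact absurd hN (not_lt.2 (this N le_rfl))

/-- `f` is a coarse coordinate along the axis `{φⁱ o}`: `φ ^ f x • o` plays the role of a nearest
point of the axis to `x`, and `C` bounds all the errors. The fields are the consequences of strong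
contraction that are used in the sequel. -/
structure ContractingAxis {G X : Type*} [Group G] [MetricSpace X] [MulAction G X] (φ : G) (o : X)
    (f : X → ℤ) (C : ℝ) : Prop where
  one_le : 1 ≤ C
  lip : ∀ x y, |(f x : ℝ) - f y| ≤ C * dist x y + C
  dist_orbit_le : ∀ i j : ℤ, dist (φ ^ i • o) (φ ^ j • o) ≤ C * |(i : ℝ) - j| + C
  coord_orbit : ∀ i : ℤ, |(f (φ ^ i • o) : ℝ) - i| ≤ C
  shift : ∀ (i : ℤ) (x : X), |(f (φ ^ i • x) : ℝ) - f x - i| ≤ C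
  contract : ∀ x y, C < dist x (φ ^ f x • o) → dist x y < dist x (φ ^ f x • o) →
    |(f x : ℝ) - f y| ≤ C
  efficient : ∀ x y, C < |(f x : ℝ) - f y| →
    dist x (φ ^ f x • o) + dist (φ ^ f x • o) (φ ^ f y • o) + dist (φ ^ f y • o) y
      ≤ dist x y + C
  orbit_close : ∀ (i : ℤ) (x : X),
    dist (φ ^ i • o) (φ ^ f x • o) + dist (φ ^ f x • o) x ≤ dist (φ ^ i • o) x + C
  passes : ∀ (c : ℝ → X) (ℓ : ℝ), 0 ≤ ℓ → IsGeodesicOn c ℓ → ∀ i : ℤ,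
    (f (c 0) : ℝ) + C ≤ i → (i : ℝ) ≤ f (c ℓ) - C →
      ∃ t ∈ Set.Icc (0 : ℝ) ℓ, dist (c t) (φ ^ i • o) ≤ C

/-- The index of a nearest orbit point is a coordinate along the axis of a strongly contracting
isometry. -/
theorem exists_contractingAxis {G X : Type*} [Group G] [MetricSpace X] [MulAction G X]
    [IsIsometricSMul G X] (hX : IsGeodesicSpace X) {φ : G} (hφ : IsStronglyContracting X φ) :
    ∃ (o : X) (f : X → ℤ) (C : ℝ), ContractingAxis φ o f C := by
  obtain ⟨o, K, hK1, hq, hA⟩ : ∃ (o : X) (K : ℝ), 1 ≤ K ∧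
      IsQuasiGeodesic K (fun i : ℤ => φ ^ i • o) ∧
      IsStronglyContractingSet K (Set.range fun i : ℤ => φ ^ i • o) := by
    obtain ⟨o, K₀, hK₀, hq₀, hA₀⟩ := hφ
    exact ⟨o, max K₀ 1, le_max_right _ _, hq₀.mono hK₀ (le_max_left _ _),
      hA₀.mono (le_max_left _ _)⟩
  have hK : 0 < K := by linarith
  set A := Set.range fun i : ℤ => φ ^ i • o with hAdef
  choose f hf using hq.exists_mem_nearestPointProj hK
  have hp : ∀ x, (fun x => φ ^ f x • o) x ∈ nearestPointProj A x := hf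
  have hinf : ∀ x, dist x (φ ^ f x • o) = Metric.infDist x A := fun x => (hf x).2
  have hab : ∀ i j : ℤ, |(i : ℝ) - j| ≤ K * (dist (φ ^ i • o) (φ ^ j • o) + K) :=
    fun i j => hq.abs_sub_le hK i j
  have hlip : ∀ x y, |(f x : ℝ) - f y| ≤ K * (3 * dist x y + 3 * K) := by
    intro x y
    refine (hab _ _).trans ?_
    have := dist_proj_le hK hA hp x y
    exact mul_le_mul_of_nonneg_left (by linarith) hK.le
  have hpo : ∀ i : ℤ, φ ^ f (φ ^ i • o) • o = φ ^ i • o := by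
    intro i
    have h1 := hinf (φ ^ i • o)
    have h2 : φ ^ i • o ∈ A := ⟨i, rfl⟩
    rw [Metric.infDist_zero_of_mem h2] at h1
    exact (dist_eq_zero.1 h1).symm
  have hbgi : ∀ x y, 10 * K < dist (φ ^ f x • o) (φ ^ f y • o) →
      dist x (φ ^ f x • o) + dist (φ ^ f x • o) (φ ^ f y • o) + dist (φ ^ f y • o) y
        ≤ dist x y + 100 * K := fun x y h => dist_ge_of_dist_proj hX hK hA hp h
  have hK2 : K ≤ K ^ 2 := by nlinarith
  have hK3 : K ^ 2 ≤ K ^ 3 := by nlinarith [sq_nonneg K]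
  -- a constant that exceeds all the error bounds, which are cubic polynomials in `K ≥ 1`
  refine ⟨o, f, 1000 * K ^ 3, ⟨by linarith, ?_, ?_, ?_, ?_, ?_, ?_, ?_, ?_⟩⟩
  · intro x y
    refine (hlip x y).trans ?_
    have hd := dist_nonneg (x := x) (y := y)
    have : K * dist x y ≤ K ^ 3 * dist x y := by
      gcongr
      linarith
    have : 0 ≤ K ^ 3 * dist x y := by positivity
    nlinarith
  · intro i j
    refine (hq i j).2.trans ?_
    have : K * |(i : ℝ) - j| ≤ (1000 * K ^ 3) * |(i : ℝ) - j| := by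
      gcongr
      linarith
    linarith
  · intro i
    refine (hab _ _).trans ?_
    rw [hpo, dist_self]
    nlinarith
  · intro i x
    have hmem : φ ^ (i + f x) • o ∈ nearestPointProj A (φ ^ i • x) := by
      refine ⟨⟨_, rfl⟩, ?_⟩
      rw [zpow_add, mul_smul, dist_smul, hinf]
      have : A = (fun y => φ ^ i • y) '' A := by
        ext y
        constructor
        · rintro ⟨j, rfl⟩
          exact ⟨φ ^ (j - i) • o, ⟨j - i, rfl⟩, by simp [smul_smul, ← zpow_add]⟩
        · rintro ⟨_, ⟨j, rfl⟩, rfl⟩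
          exact ⟨i + j, by simp [smul_smul, zpow_add]⟩
      conv_rhs => rw [this]
      exact (Metric.infDist_image (isometry_smul X (φ ^ i))).symm
    have hd : dist (φ ^ f (φ ^ i • x) • o) (φ ^ (i + f x) • o) ≤ 2 * K := by
      rcases lt_or_ge K (Metric.infDist (φ ^ i • x) A) with h | h
      · have := hA _ h _ (Metric.mem_ball_self (hK.trans h)) _
          (Metric.mem_ball_self (hK.trans h)) _ (hp _) _ hmem
        linarith
      · have h1 := hinf (φ ^ i • x)
        have h2 := hmem.2
        have := dist_triangle_left (φ ^ f (φ ^ i • x) • o) (φ ^ (i + f x) • o) (φ ^ i • x)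
        linarith
    have h1 := hab (f (φ ^ i • x)) (i + f x)
    push_cast at h1
    have h2 : |(f (φ ^ i • x) : ℝ) - f x - i| = |(f (φ ^ i • x) : ℝ) - (i + f x)| := by
      congr 1
      ring
    rw [h2]
    refine h1.trans ?_
    have : K * (dist (φ ^ f (φ ^ i • x) • o) (φ ^ (i + f x) • o) + K) ≤ K * (3 * K) := by
      gcongr
      linarith
    nlinarith
  · intro x y h1 h2
    rw [hinf] at h1 h2
    have := dist_proj_le_of_dist_lt hK hA hp (lt_of_le_of_lt (by linarith) h1) h2
    refine (hab _ _).trans ?_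
    have : K * (dist (φ ^ f x • o) (φ ^ f y • o) + K) ≤ K * (2 * K) := by
      gcongr
      linarith
    nlinarith
  · intro x y h
    have h1 := h.trans_le (hab _ _)
    refine (hbgi x y ?_).trans (by linarith)
    by_contra hcon
    have : K * (dist (φ ^ f x • o) (φ ^ f y • o) + K) ≤ K * (11 * K) := by
      gcongr
      linarith
    nlinarith
  · intro i x
    rcases lt_or_ge (10 * K) (dist (φ ^ i • o) (φ ^ f x • o)) with h | h
    · have := hbgi (φ ^ i • o) x (by rwa [hpo])
      rw [hpo, dist_self] at this
      linarith
    · have h1 : dist x (φ ^ f x • o) ≤ dist x (φ ^ i • o) := by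
        rw [hinf]
        exact Metric.infDist_le_dist_of_mem ⟨i, rfl⟩
      rw [dist_comm x, dist_comm x] at h1
      linarith
  · intro c ℓ hℓ hc i hi1 hi2
    obtain ⟨N, hN⟩ := exists_nat_gt ℓ
    have hN0 : (0 : ℝ) < N := by linarith
    have hs1 : ℓ / N ≤ 1 := by
      rw [div_le_one hN0]
      exact hN.le
    have hs0 : 0 ≤ ℓ / N := by positivity
    have hNs : (N : ℝ) * (ℓ / N) = ℓ := by field_simp
    obtain ⟨j, hjN, hj1, hj2⟩ := exists_le_lt_succ (F := fun j : ℕ => f (c (j * (ℓ / N))))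
      (N := N) (i := i)
      (by
        have : (f (c 0) : ℝ) ≤ i := by nlinarith
        simpa using (by exact_mod_cast this : f (c 0) ≤ i))
      (by
        have : (i : ℝ) < f (c ℓ) := by nlinarith
        simp only [hNs]
        exact_mod_cast this)
    have hj' : ((j : ℝ) + 1) ≤ N := by exact_mod_cast hjN
    have hj0 : (0 : ℝ) ≤ j * (ℓ / N) := by positivity
    have hjl : (j : ℝ) * (ℓ / N) + ℓ / N ≤ ℓ := by
      have := mul_le_mul_of_nonneg_right hj' hs0
      linarith
    set t := (j : ℝ) * (ℓ / N) with ht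
    have hstep := hlip (c t) (c (t + ℓ / N))
    have e1 : ((j + 1 : ℕ) : ℝ) * (ℓ / N) = t + ℓ / N := by push_cast; ring
    rw [e1] at hj2
    have hj1' : (f (c t) : ℝ) ≤ i := by exact_mod_cast hj1
    have hj2' : (i : ℝ) < f (c (t + ℓ / N)) := by exact_mod_cast hj2
    rw [hc.dist_eq hj0 (by linarith) hjl] at hstep
    have hJ : K * (3 * (t + ℓ / N - t) + 3 * K) ≤ K * (6 * K) := by
      gcongr
      linarith
    have hit : |(f (c t) : ℝ) - i| ≤ 6 * K ^ 2 := by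
      rw [abs_le] at hstep ⊢
      constructor
      · nlinarith [hstep.1]
      · nlinarith
    have hx : 10 * K < dist (φ ^ f (c 0) • o) (φ ^ f (c t) • o) := by
      have h1 := hab (f (c 0)) (f (c t))
      rw [abs_le] at hit
      have h2 := neg_abs_le ((f (c 0) : ℝ) - f (c t))
      by_contra hcon
      have : K * (dist (φ ^ f (c 0) • o) (φ ^ f (c t) • o) + K) ≤ K * (11 * K) := by
        gcongr
        linarith
      nlinarith [hit.1]
    have hy : 10 * K < dist (φ ^ f (c t) • o) (φ ^ f (c ℓ) • o) := by
      have h1 := hab (f (c t)) (f (c ℓ))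
      rw [abs_le] at hit
      have h2 := neg_abs_le ((f (c t) : ℝ) - f (c ℓ))
      by_contra hcon
      have : K * (dist (φ ^ f (c t) • o) (φ ^ f (c ℓ) • o) + K) ≤ K * (11 * K) := by
        gcongr
        linarith
      nlinarith [hit.2]
    have b1 := hbgi _ _ hx
    have b2 := hbgi _ _ hy
    rw [hc.dist_eq le_rfl hj0 (by linarith)] at b1
    rw [hc.dist_eq hj0 (by linarith) le_rfl] at b2
    have b3 : ℓ ≤ dist (c 0) (φ ^ f (c 0) • o) + dist (φ ^ f (c 0) • o) (φ ^ f (c t) • o)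
        + dist (φ ^ f (c t) • o) (φ ^ f (c ℓ) • o) + dist (φ ^ f (c ℓ) • o) (c ℓ) := by
      have q0 := hc.dist_eq le_rfl hℓ le_rfl
      have q1 := dist_triangle4 (c 0) (φ ^ f (c 0) • o) (φ ^ f (c t) • o) (c ℓ)
      have q2 := dist_triangle (φ ^ f (c t) • o) (φ ^ f (c ℓ) • o) (c ℓ)
      linarith
    rw [dist_comm (φ ^ f (c t) • o) (c t)] at b1
    have b4 := (hq (f (c t)) i).2
    simp only at b4
    have b5 : K * |(f (c t) : ℝ) - i| ≤ K * (6 * K ^ 2) := by gcongr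
    have b6 := dist_triangle (c t) (φ ^ f (c t) • o) (φ ^ i • o)
    refine ⟨t, ⟨hj0, by linarith⟩, ?_⟩
    have b7 : K * (6 * K ^ 2) = 6 * K ^ 3 := by ring
    linarith

/-! ### Word metrics -/

section WordMetric

variable {G : Type*} [Group G] {S : Finset G}

/-- The word distance `d_S(x, y) = ‖x⁻¹ y‖_S`. -/
noncomputable def wordDist (S : Finset G) (x y : G) : ℕ := wordNorm S (x⁻¹ * y)

theorem wordNorm_prod_le {l : List G} (hl : ∀ a ∈ l, a ∈ S ∨ a⁻¹ ∈ S) :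
    wordNorm S l.prod ≤ l.length :=
  Nat.sInf_le ⟨l, rfl, hl, rfl⟩

theorem wordNorm_one : wordNorm S (1 : G) = 0 := by
  simpa using wordNorm_prod_le (S := S) (l := []) (by simp)

theorem wordNorm_mul_le (hS : Subgroup.closure (S : Set G) = ⊤) (g h : G) :
    wordNorm S (g * h) ≤ wordNorm S g + wordNorm S h := by
  obtain ⟨l, hl, hm, rfl⟩ := exists_word_of_closure_eq_top hS g
  obtain ⟨l', hl', hm', rfl⟩ := exists_word_of_closure_eq_top hS h
  rw [← hl, ← hl', ← List.prod_append, ← List.length_append]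
  exact wordNorm_prod_le fun a ha => (List.mem_append.1 ha).elim (hm a) (hm' a)

theorem wordNorm_inv_le (hS : Subgroup.closure (S : Set G) = ⊤) (g : G) :
    wordNorm S g⁻¹ ≤ wordNorm S g := by
  obtain ⟨l, hl, hm, rfl⟩ := exists_word_of_closure_eq_top hS g
  rw [← hl, List.prod_inv_reverse]
  refine (wordNorm_prod_le fun a ha => ?_).trans (by simp)
  simp only [List.mem_reverse, List.mem_map] at ha
  obtain ⟨b, hb, rfl⟩ := ha
  rw [inv_inv]
  exact (hm b hb).symm

theorem wordNorm_inv (hS : Subgroup.closure (S : Set G) = ⊤) (g : G) :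
    wordNorm S g⁻¹ = wordNorm S g :=
  le_antisymm (wordNorm_inv_le hS g) (by simpa using wordNorm_inv_le hS g⁻¹)

theorem wordDist_self (x : G) : wordDist S x x = 0 := by simp [wordDist, wordNorm_one]

theorem wordDist_one_left (x : G) : wordDist S 1 x = wordNorm S x := by simp [wordDist]

theorem wordDist_comm (hS : Subgroup.closure (S : Set G) = ⊤) (x y : G) :
    wordDist S x y = wordDist S y x := by
  rw [wordDist, wordDist, ← wordNorm_inv hS]
  simp

theorem wordDist_triangle (hS : Subgroup.closure (S : Set G) = ⊤) (x y z : G) :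
    wordDist S x z ≤ wordDist S x y + wordDist S y z := by
  have := wordNorm_mul_le hS (x⁻¹ * y) (y⁻¹ * z)
  simpa [wordDist, mul_assoc] using this

theorem wordDist_mul_left (g x y : G) : wordDist S (g * x) (g * y) = wordDist S x y := by
  simp [wordDist, mul_assoc]

theorem wordDist_mul_right (x y : G) : wordDist S x (x * y) = wordNorm S y := by
  simp [wordDist]

/-- `y` lies on a word geodesic from `x` to `z`. -/
def WordBetween (S : Finset G) (x y z : G) : Prop :=
  wordDist S x y + wordDist S y z = wordDist S x z

theorem WordBetween.symm (hS : Subgroup.closure (S : Set G) = ⊤) {x y z : G}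
    (h : WordBetween S x y z) : WordBetween S z y x := by
  have : wordDist S x y + wordDist S y z = wordDist S x z := h
  rw [WordBetween, wordDist_comm hS z y, wordDist_comm hS y x, wordDist_comm hS z x]
  omega

theorem wordBetween_left (x y : G) : WordBetween S x x y := by
  simp [WordBetween, wordDist_self]

/-- If `y` is between `x` and `z`, and `w` between `x` and `y`, then `y` is between `w` and `z`. -/
theorem WordBetween.tail (hS : Subgroup.closure (S : Set G) = ⊤) {x y z w : G}
    (h : WordBetween S x y z) (hw : WordBetween S x w y) : WordBetween S w y z := by
  have h1 : wordDist S x y + wordDist S y z = wordDist S x z := h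
  have h2 : wordDist S x w + wordDist S w y = wordDist S x y := hw
  have h3 := wordDist_triangle hS x w z
  have h4 := wordDist_triangle hS w y z
  rw [WordBetween]
  omega

theorem WordBetween.trans_left (hS : Subgroup.closure (S : Set G) = ⊤) {x y z w : G}
    (h : WordBetween S x y z) (hw : WordBetween S x w y) : WordBetween S x w z := by
  have h1 : wordDist S x y + wordDist S y z = wordDist S x z := h
  have h2 : wordDist S x w + wordDist S w y = wordDist S x y := hw
  have h3 : wordDist S w y + wordDist S y z = wordDist S w z := h.tail hS hw
  rw [WordBetween]
  omega

/-- Word geodesics. -/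
theorem exists_wordGeodesic (hS : Subgroup.closure (S : Set G) = ⊤) (x y : G) :
    ∃ z : ℕ → G, z 0 = x ∧ z (wordDist S x y) = y ∧
      ∀ i j, i ≤ j → j ≤ wordDist S x y → wordDist S (z i) (z j) = j - i := by
  obtain ⟨l, hl, hm, hprod⟩ := exists_word_of_closure_eq_top hS (x⁻¹ * y)
  change l.length = wordDist S x y at hl
  have hle : ∀ i j, i ≤ j →
      wordDist S (x * (l.take i).prod) (x * (l.take j).prod) ≤ j - i := by
    intro i j hij
    have h1 : (l.take j).prod = (l.take i).prod * ((l.take j).drop i).prod := by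
      conv_lhs => rw [← List.take_append_drop i (l.take j)]
      rw [List.prod_append, List.take_take, min_eq_left hij]
    rw [wordDist_mul_left, h1, wordDist_mul_right]
    refine (wordNorm_prod_le fun a ha => ?_).trans ?_
    · exact hm a (List.mem_of_mem_take (List.mem_of_mem_drop ha))
    · simp only [List.length_drop, List.length_take]
      omega
  refine ⟨fun i => x * (l.take i).prod, by simp, ?_, ?_⟩
  · simp only [← hl, List.take_length, hprod]
    simp
  · intro i j hij hj
    refine le_antisymm (hle i j hij) ?_
    simp only
    have h1 := hle 0 i (Nat.zero_le _)
    have h2 := hle j (wordDist S x y) hj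
    have h3 : wordDist S (x * (l.take 0).prod) (x * (l.take (wordDist S x y)).prod)
        = wordDist S x y := by
      rw [← hl, List.take_length, hprod, hl]
      simp
    have h4 := wordDist_triangle hS (x * (l.take 0).prod) (x * (l.take i).prod)
      (x * (l.take (wordDist S x y)).prod)
    have h5 := wordDist_triangle hS (x * (l.take i).prod) (x * (l.take j).prod)
      (x * (l.take (wordDist S x y)).prod)
    omega

/-- The cardinality of the ball of integer radius `n`. -/
noncomputable def ballCard (S : Finset G) (n : ℕ) : ℕ := (wordBall S (n : ℝ)).ncard

theorem mem_wordBall_natCast {n : ℕ} {g : G} : g ∈ wordBall S (n : ℝ) ↔ wordNorm S g ≤ n := by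
  simp [wordBall]

theorem ballCard_pos (hS : Subgroup.closure (S : Set G) = ⊤) (n : ℕ) : 0 < ballCard S n :=
  (Set.ncard_pos (wordBall_finite hS _)).2 ⟨1, by simp [wordBall, wordNorm_one]⟩

theorem ballCard_mono (hS : Subgroup.closure (S : Set G) = ⊤) {m n : ℕ} (h : m ≤ n) :
    ballCard S m ≤ ballCard S n :=
  Set.ncard_le_ncard (fun _ hg => mem_wordBall_natCast.2 ((mem_wordBall_natCast.1 hg).trans h))
    (wordBall_finite hS _)

theorem ballCard_add_le (hS : Subgroup.closure (S : Set G) = ⊤) (m n : ℕ) :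
    ballCard S (m + n) ≤ ballCard S m * ballCard S n := by
  have hsub : wordBall S ((m + n : ℕ) : ℝ) ⊆
      (fun x : G × G => x.1 * x.2) '' (wordBall S (m : ℝ) ×ˢ wordBall S (n : ℝ)) := by
    intro g hg
    rw [mem_wordBall_natCast] at hg
    obtain ⟨z, hz0, hz1, hz⟩ := exists_wordGeodesic hS 1 g
    rw [wordDist_one_left] at hz1 hz
    have h1 := hz 0 (min m (wordNorm S g)) (Nat.zero_le _) (min_le_right _ _)
    have h2 := hz (min m (wordNorm S g)) _ (min_le_right _ _) le_rfl
    rw [hz0, wordDist_one_left] at h1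
    rw [hz1] at h2
    refine ⟨(z (min m (wordNorm S g)), (z (min m (wordNorm S g)))⁻¹ * g), ⟨?_, ?_⟩, by simp⟩
    · rw [mem_wordBall_natCast]
      simp only
      omega
    · rw [mem_wordBall_natCast]
      change wordDist S _ g ≤ n
      omega
  have hfin := (wordBall_finite hS (m : ℝ)).prod (wordBall_finite hS (n : ℝ))
  refine (Set.ncard_le_ncard hsub (hfin.image _)).trans ((Set.ncard_image_le hfin).trans ?_)
  rw [Set.ncard_prod]
  exact le_rfl

end WordMetric

/-! ### Orbit maps of geometric actions are quasi-isometries -/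

section MilnorSvarc

variable {G X : Type*} [Group G] [MetricSpace X] [MulAction G X]

/-- Only finitely many translates of a compact set come `δ`-close to it, for some `δ > 0`. -/
theorem exists_finite_close [ProperlyDiscontinuousSMul G X] {C : Set X} (hC : IsCompact C) :
    ∃ δ > 0, {g : G | ∃ x ∈ C, ∃ y ∈ C, dist x (g • y) < δ}.Finite := by
  by_contra hcon
  push Not at hcon
  obtain ⟨F, hF1, hF2⟩ := exists_seq_of_forall_finset_exists
    (fun a : ℕ × G => ∃ x ∈ C, ∃ y ∈ C, dist x (a.2 • y) < 1 / ((a.1 : ℝ) + 1))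
    (fun a b => a.1 < b.1 ∧ a.2 ≠ b.2) (by
      classical
      intro s _
      set n := s.sup Prod.fst + 1 with hn
      have hinf : {g : G | ∃ x ∈ C, ∃ y ∈ C, dist x (g • y) < 1 / ((n : ℝ) + 1)}.Infinite :=
        hcon _ (by positivity)
      obtain ⟨g, hg, hgs⟩ := hinf.exists_notMem_finset (s.image Prod.snd)
      refine ⟨(n, g), hg, fun a ha => ⟨?_, fun h => hgs (Finset.mem_image.2 ⟨a, ha, h⟩)⟩⟩
      have := Finset.le_sup (f := Prod.fst) ha
      simp only
      omega)
  choose x hx y hy hd using hF1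
  have hmono : StrictMono fun n => (F n).1 := fun m n h => (hF2 m n h).1
  obtain ⟨a, ha, ψ, hψ, hlim⟩ := hC.tendsto_subseq hx
  have h0 : Filter.Tendsto (fun n => dist (x (ψ n)) ((F (ψ n)).2 • y (ψ n))) Filter.atTop
      (nhds 0) := by
    refine squeeze_zero (fun _ => dist_nonneg) (fun n => ?_)
      tendsto_one_div_add_atTop_nhds_zero_nat
    refine (hd (ψ n)).le.trans ?_
    have h1 : (n : ℝ) ≤ (F (ψ n)).1 := by
      exact_mod_cast (hψ.le_apply).trans (hmono.le_apply (x := ψ n))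
    gcongr
  have hlim2 : Filter.Tendsto (fun n => (F (ψ n)).2 • y (ψ n)) Filter.atTop (nhds a) := by
    rw [tendsto_iff_dist_tendsto_zero] at hlim ⊢
    refine squeeze_zero (fun _ => dist_nonneg) (fun n => dist_triangle_left _ _ (x (ψ n))) ?_
    simpa using h0.add hlim
  have hK := hlim2.isCompact_insert_range
  have hfin := ProperlyDiscontinuousSMul.finite_disjoint_inter_image (Γ := G) hC hK
  refine Set.infinite_of_injective_forall_mem (f := fun n => (F (ψ n)).2) ?_ (fun n => ?_) hfin
  · intro m n hmn
    by_contra hne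
    rcases lt_or_gt_of_ne hne with h | h
    · exact (hF2 _ _ (hψ h)).2 hmn
    · exact (hF2 _ _ (hψ h)).2 hmn.symm
  · exact ⟨(F (ψ n)).2 • y (ψ n), ⟨y (ψ n), hy _, rfl⟩, Set.mem_insert_of_mem _ ⟨n, rfl⟩⟩

/-- The orbit map of a geometric action is a `κ`-quasi-isometric embedding of the word metric. -/
structure OrbitQI (S : Finset G) (o : X) (κ : ℝ) : Prop where
  one_le : 1 ≤ κ
  dist_le : ∀ g h : G, dist (g • o) (h • o) ≤ κ * wordDist S g h
  wordDist_le : ∀ g h : G, (wordDist S g h : ℝ) ≤ κ * dist (g • o) (h • o) + κ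

/-- The lemma of Milnor and Švarc: subdivide a geodesic from `o` to `g o` into steps shorter than the
`δ` of `exists_finite_close`, and choose a translate of the compact set at each point. -/
theorem exists_orbitQI (hX : IsGeodesicSpace X) (hact : IsGeometricAction G X) {S : Finset G}
    (hS : Subgroup.closure (S : Set G) = ⊤) (o : X) : ∃ κ : ℝ, OrbitQI S o κ := by
  have := hact.isometric
  have := hact.properlyDiscontinuous
  obtain ⟨C₀, hC₀, hcov⟩ := hact.cocompact
  set C := insert o C₀ with hCdef
  have hC : IsCompact C := hC₀.insert o
  obtain ⟨δ, hδ, hfin⟩ := exists_finite_close (G := G) hC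
  obtain ⟨m, hm⟩ : ∃ m : ℕ, ∀ g ∈ {g : G | ∃ x ∈ C, ∃ y ∈ C, dist x (g • y) < δ},
      wordNorm S g ≤ m := by
    obtain ⟨m, hm⟩ := (hfin.image (wordNorm S)).bddAbove
    exact ⟨m, fun g hg => hm ⟨g, hg, rfl⟩⟩
  obtain ⟨κ₁, hκ₁, hκ₁'⟩ : ∃ κ₁ : ℝ, 0 ≤ κ₁ ∧ ∀ s ∈ S, dist o (s • o) ≤ κ₁ := by
    obtain ⟨κ₁, hκ₁⟩ := (S.finite_toSet.image fun s => dist o (s • o)).bddAbove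
    exact ⟨max κ₁ 0, le_max_right _ _, fun s hs => (hκ₁ ⟨s, hs, rfl⟩).trans (le_max_left _ _)⟩
  have hup : ∀ g : G, dist o (g • o) ≤ κ₁ * wordNorm S g := by
    intro g
    obtain ⟨l, hl, hm, rfl⟩ := exists_word_of_closure_eq_top hS g
    rw [← hl]
    clear hl
    induction l with
    | nil => simp
    | cons a l ih =>
      have h1 := ih fun b hb => hm b (List.mem_cons_of_mem _ hb)
      have h2 : dist o (a • o) ≤ κ₁ := by
        rcases hm a List.mem_cons_self with h | h
        · exact hκ₁' a h
        · have := hκ₁' _ h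
          rwa [← dist_smul a, smul_inv_smul, dist_comm] at this
      have h3 := dist_triangle o (a • o) (a • l.prod • o)
      rw [dist_smul] at h3
      rw [List.prod_cons, mul_smul, List.length_cons]
      push_cast
      linarith
  have hlow : ∀ g : G, (wordNorm S g : ℝ) ≤ m * (dist o (g • o) / δ + 1) := by
    intro g
    obtain ⟨c, hc0, hc1, hc⟩ := hX o (g • o)
    set ℓ := dist o (g • o)
    have hc : IsGeodesicOn c ℓ := hc
    have hℓ : 0 ≤ ℓ := dist_nonneg
    set N := ⌊ℓ / δ⌋₊ + 1 with hN
    have hN0 : (0 : ℝ) < N := by rw [hN]; positivity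
    have hN1 : ℓ / δ < N := by rw [hN]; push_cast; exact Nat.lt_floor_add_one _
    have hN2 : (N : ℝ) ≤ ℓ / δ + 1 := by
      rw [hN]; push_cast
      linarith [Nat.floor_le (a := ℓ / δ) (by positivity)]
    have hsδ : ℓ / N < δ := by
      rw [div_lt_iff₀ hN0]
      rw [div_lt_iff₀ hδ] at hN1
      linarith
    have hs0 : 0 ≤ ℓ / N := by positivity
    have hNs : (N : ℝ) * (ℓ / N) = ℓ := by field_simp
    choose t ht using hcov
    set b : ℕ → G := fun i => if i = 0 then 1 else if i = N then g else t (c (i * (ℓ / N)))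
      with hb
    have hbC : ∀ i ≤ N, ∃ y ∈ C, b i • y = c (i * (ℓ / N)) := by
      intro i hi
      simp only [hb]
      split_ifs with h1 h2
      · exact ⟨o, Set.mem_insert _ _, by simp [h1, hc0]⟩
      · exact ⟨o, Set.mem_insert _ _, by rw [h2, hNs, hc1]⟩
      · obtain ⟨y, hy, hyt⟩ := ht (c (i * (ℓ / N)))
        exact ⟨y, Set.mem_insert_of_mem _ hy, hyt⟩
    have key : ∀ i ≤ N, wordNorm S (b i) ≤ m * i := by
      intro i
      induction i with
      | zero => simp [hb, wordNorm_one]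
      | succ i ih =>
        intro hi
        obtain ⟨y, hy, hy'⟩ := hbC i (by omega)
        obtain ⟨z, hz, hz'⟩ := hbC (i + 1) hi
        have hi' : ((i : ℝ) + 1) ≤ N := by exact_mod_cast hi
        have h1 : (i : ℝ) * (ℓ / N) + ℓ / N ≤ ℓ := by
          have := mul_le_mul_of_nonneg_right hi' hs0
          linarith
        have h0 : (0 : ℝ) ≤ i * (ℓ / N) := by positivity
        have h2 : wordNorm S ((b i)⁻¹ * b (i + 1)) ≤ m := by
          refine hm _ ⟨y, hy, z, hz, ?_⟩
          rw [← dist_smul (b i), smul_smul, mul_inv_cancel_left, hy', hz',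
            hc.dist_eq h0 (by push_cast; linarith) (by push_cast; linarith)]
          push_cast
          linarith
        have h3 := wordNorm_mul_le hS (b i) ((b i)⁻¹ * b (i + 1))
        rw [mul_inv_cancel_left] at h3
        have h4 := ih (by omega)
        rw [Nat.mul_succ]
        omega
    have h1 := key N le_rfl
    have h2 : b N = g := by simp [hb, hN]
    rw [h2] at h1
    calc (wordNorm S g : ℝ) ≤ m * N := by exact_mod_cast h1
      _ ≤ _ := by gcongr
  have hred : ∀ g h : G, dist (g • o) (h • o) = dist o ((g⁻¹ * h) • o) := by
    intro g h
    rw [← dist_smul g⁻¹, inv_smul_smul, mul_smul]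
  refine ⟨κ₁ + m / δ + m + 1, ?_, ?_, ?_⟩
  · have : (0 : ℝ) ≤ m / δ := by positivity
    have : (0 : ℝ) ≤ m := by positivity
    linarith
  · intro g h
    rw [hred]
    refine (hup _).trans ?_
    change κ₁ * (wordDist S g h : ℝ) ≤ _
    gcongr
    have : (0 : ℝ) ≤ m / δ := by positivity
    have : (0 : ℝ) ≤ m := by positivity
    linarith
  · intro g h
    rw [hred]
    refine (hlow _).trans ?_
    have h0 : (0 : ℝ) ≤ m / δ := by positivity
    have h1 : (0 : ℝ) ≤ m := by positivity
    have hd := dist_nonneg (x := o) (y := (g⁻¹ * h) • o)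
    have : (m : ℝ) * (dist o ((g⁻¹ * h) • o) / δ + 1)
        = m / δ * dist o ((g⁻¹ * h) • o) + m := by ring
    rw [this]
    nlinarith [mul_nonneg hκ₁ hd, mul_nonneg h1 hd]

theorem OrbitQI.finite_dist_le {S : Finset G} {o : X} {κ : ℝ} (h : OrbitQI S o κ)
    (hS : Subgroup.closure (S : Set G) = ⊤) (r : ℝ) : {g : G | dist o (g • o) ≤ r}.Finite := by
  refine (wordBall_finite hS (κ * r + κ)).subset fun g hg => ?_
  have h1 := h.wordDist_le 1 g
  have hκ := h.one_le
  rw [wordDist_one_left, one_smul] at h1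
  have hg : dist o (g • o) ≤ r := hg
  have : κ * dist o (g • o) ≤ κ * r := by gcongr
  exact h1.trans (by linarith)

end MilnorSvarc

/-! ### Pairs of axes -/

section Axis

variable {G X : Type*} [Group G] [MetricSpace X] [MulAction G X] {φ : G} {o : X} {f : X → ℤ} {C : ℝ}

theorem ContractingAxis.abs_sub_le (hax : ContractingAxis φ o f C) (i j : ℤ) :
    |(i : ℝ) - j| ≤ C * dist (φ ^ i • o) (φ ^ j • o) + 3 * C := by
  have h1 := hax.lip (φ ^ i • o) (φ ^ j • o)
  have h2 := hax.coord_orbit i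
  have h3 := hax.coord_orbit j
  rw [abs_le] at *
  constructor <;> linarith [h1.1, h1.2, h2.1, h2.2, h3.1, h3.2]

theorem ContractingAxis.zpow_ne_one (hax : ContractingAxis φ o f C) {q : ℤ} (hq : q ≠ 0) :
    φ ^ q ≠ 1 := by
  intro h
  obtain ⟨n, hn⟩ := exists_nat_gt (3 * C)
  have h1 := hax.abs_sub_le (q * n) 0
  rw [zpow_mul, h] at h1
  simp only [one_zpow, zpow_zero, dist_self, mul_zero, zero_add, Int.cast_zero, sub_zero] at h1
  have h2 : (1 : ℝ) ≤ |(q : ℝ)| := by exact_mod_cast Int.one_le_abs hq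
  push_cast at h1
  rw [abs_mul, Nat.abs_cast] at h1
  have : (0 : ℝ) ≤ n := by positivity
  nlinarith

/-- A point on a geodesic between two points of the axis is close to the axis. -/
theorem ContractingAxis.dist_le_of_between (hax : ContractingAxis φ o f C) {i j : ℤ} {q : X}
    (h : dist (φ ^ i • o) q + dist q (φ ^ j • o) ≤ dist (φ ^ i • o) (φ ^ j • o)) :
    dist q (φ ^ f q • o) ≤ C := by
  have h1 := hax.orbit_close i q
  have h2 := hax.orbit_close j q
  have h3 := dist_triangle_right (φ ^ i • o) (φ ^ j • o) (φ ^ f q • o)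
  rw [dist_comm q (φ ^ j • o)] at h
  rw [dist_comm q]
  linarith

end Axis

section Axis

variable {G X : Type*} [Group G] [MetricSpace X] [MulAction G X] [IsIsometricSMul G X]
  {φ : G} {o : X} {f : X → ℤ} {C : ℝ}

/-- Behrstock's inequality for the axes of `φ` and of a conjugate `h φ h⁻¹`: a point cannot project
to both of them far from the projection of the other axis. -/
theorem ContractingAxis.behrstock (hax : ContractingAxis φ o f C) (h : G) (x : X) :
    |(f (h⁻¹ • x) : ℝ) - f (h⁻¹ • φ ^ f x • o)| ≤ 2 * C ^ 2 + 3 * C ∨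
      |(f x : ℝ) - f (h • φ ^ f (h⁻¹ • x) • o)| ≤ 2 * C ^ 2 + 3 * C := by
  by_contra hcon
  push Not at hcon
  obtain ⟨h1, h2⟩ := hcon
  have hC := hax.one_le
  have e1 := hax.efficient _ _ (lt_of_le_of_lt (by nlinarith) h1)
  have e2 := hax.efficient _ _ (lt_of_le_of_lt (by nlinarith) h2)
  rw [dist_smul] at e1
  have e3 : dist (h⁻¹ • x) (φ ^ f (h⁻¹ • x) • o) = dist x (h • φ ^ f (h⁻¹ • x) • o) := by
    rw [← dist_smul h, smul_inv_smul]
  have n1 := dist_nonneg (x := φ ^ f (h⁻¹ • φ ^ f x • o) • o) (y := h⁻¹ • φ ^ f x • o)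
  have n2 := dist_nonneg (x := φ ^ f x • o) (y := φ ^ f (h • φ ^ f (h⁻¹ • x) • o) • o)
  have n3 := dist_nonneg (x := φ ^ f (h • φ ^ f (h⁻¹ • x) • o) • o)
    (y := h • φ ^ f (h⁻¹ • x) • o)
  have e4 := hax.abs_sub_le (f (h⁻¹ • x)) (f (h⁻¹ • φ ^ f x • o))
  have e5 : dist (φ ^ f (h⁻¹ • x) • o) (φ ^ f (h⁻¹ • φ ^ f x • o) • o) ≤ 2 * C := by linarith
  have e6 : C * dist (φ ^ f (h⁻¹ • x) • o) (φ ^ f (h⁻¹ • φ ^ f x • o) • o) ≤ C * (2 * C) := by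
    gcongr
  nlinarith

/-- If the projection of a translated axis is unbounded, then the axes run parallel for long, and
by proper discontinuity a bounded power of `φ` is conjugated to a bounded power of `φ`. -/
theorem ContractingAxis.exists_conj_eq (hX : IsGeodesicSpace X) (hax : ContractingAxis φ o f C)
    (hfin : ∀ r : ℝ, {g : G | dist o (g • o) ≤ r}.Finite) :
    ∃ P : ℝ, 0 ≤ P ∧ ∀ u : G, (∀ c : ℝ, ∃ t : ℤ, c < |(f (u • φ ^ t • o) : ℝ)|) →
      ∃ p q : ℤ, p ≠ 0 ∧ q ≠ 0 ∧ |(p : ℝ)| ≤ P ∧ |(q : ℝ)| ≤ P ∧ u * φ ^ p = φ ^ q * u := by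
  classical
  have hC := hax.one_le
  set U := (hfin (2 * C)).toFinset with hU
  set n := U.card with hn
  refine ⟨C * (C * n + C + 4 * C) + 3 * C + n, by positivity, fun u hu => ?_⟩
  obtain ⟨a, b, hab⟩ : ∃ a b : ℤ,
      (f (u • φ ^ a • o) : ℝ) + n + 2 * C + 2 < f (u • φ ^ b • o) := by
    obtain ⟨t, ht⟩ := hu (|(f (u • φ ^ (0 : ℤ) • o) : ℝ)| + n + 2 * C + 2)
    rcases le_or_gt 0 (f (u • φ ^ t • o) : ℝ) with h | h
    · refine ⟨0, t, ?_⟩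
      rw [abs_of_nonneg h] at ht
      linarith [le_abs_self (f (u • φ ^ (0 : ℤ) • o) : ℝ)]
    · refine ⟨t, 0, ?_⟩
      rw [abs_of_neg h] at ht
      linarith [neg_abs_le (f (u • φ ^ (0 : ℤ) • o) : ℝ)]
  obtain ⟨c, hc0, hc1, hc⟩ := hX (u • φ ^ a • o) (u • φ ^ b • o)
  have hc : IsGeodesicOn c (dist (u • φ ^ a • o) (u • φ ^ b • o)) := hc
  set m := ⌈(f (u • φ ^ a • o) : ℝ) + C⌉ with hm
  have hm1 := Int.le_ceil ((f (u • φ ^ a • o) : ℝ) + C)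
  have hm2 := Int.ceil_lt_add_one ((f (u • φ ^ a • o) : ℝ) + C)
  rw [← hm] at hm1 hm2
  have hclose : ∀ j : ℕ, j ≤ n → ∃ τ : ℤ,
      dist (φ ^ (m + (j : ℤ)) • o) (u • φ ^ τ • o) ≤ 2 * C := by
    intro j hj
    have hj' : (j : ℝ) ≤ n := by exact_mod_cast hj
    have hj0 : (0 : ℝ) ≤ j := by positivity
    obtain ⟨t, ht, hd⟩ := hax.passes c _ dist_nonneg hc (m + (j : ℤ))
      (by rw [hc0]; push_cast; linarith) (by rw [hc1]; push_cast; linarith)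
    refine ⟨f (u⁻¹ • c t), ?_⟩
    have h1 : dist (u⁻¹ • c t) (φ ^ f (u⁻¹ • c t) • o) ≤ C := by
      refine hax.dist_le_of_between (i := a) (j := b) ?_
      have e1 := hc.dist_eq le_rfl ht.1 ht.2
      have e2 := hc.dist_eq ht.1 ht.2 le_rfl
      rw [hc0] at e1
      rw [hc1] at e2
      rw [← dist_smul u (φ ^ a • o), smul_inv_smul, ← dist_smul u (u⁻¹ • c t), smul_inv_smul,
        ← dist_smul u (φ ^ a • o)]
      linarith
    rw [← dist_smul u, smul_inv_smul] at h1
    have := dist_triangle_left (φ ^ (m + (j : ℤ)) • o) (u • φ ^ f (u⁻¹ • c t) • o) (c t)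
    linarith
  choose! τ hτ using hclose
  obtain ⟨j, hj, k, hk, hjk, hjk'⟩ := Finset.exists_ne_map_eq_of_card_lt_of_maps_to
    (s := Finset.range (n + 1)) (t := U)
    (f := fun j : ℕ => φ ^ (-(m + (j : ℤ))) * u * φ ^ τ j) (by simp [hn]) (by
      intro j hj
      have hj := Finset.mem_range.1 hj
      simp only [hU, Set.Finite.coe_toFinset, Set.mem_ofPred_eq]
      rw [← dist_smul (φ ^ (m + (j : ℤ))), smul_smul, ← mul_assoc, ← mul_assoc, ← zpow_add]
      simpa [mul_smul] using hτ j (by omega))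
  have hj := Finset.mem_range.1 hj
  have hk := Finset.mem_range.1 hk
  have hq0 : (k : ℤ) - j ≠ 0 := by
    intro h
    apply hjk
    omega
  have heq : u * φ ^ (τ k - τ j) = φ ^ ((k : ℤ) - j) * u := by
    have hjk' : φ ^ (-(m + (j : ℤ))) * u * φ ^ τ j = φ ^ (-(m + (k : ℤ))) * u * φ ^ τ k := hjk'
    have h1 : φ ^ ((k : ℤ) - j) = φ ^ (m + (k : ℤ)) * φ ^ (-(m + (j : ℤ))) := by
      rw [← zpow_add]
      congr 1
      ring
    have h2 : φ ^ (m + (k : ℤ)) * (φ ^ (-(m + (j : ℤ))) * u * φ ^ τ j) = u * φ ^ τ k := by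
      rw [hjk', ← mul_assoc, ← mul_assoc, ← zpow_add]
      simp
    rw [h1, zpow_sub, ← mul_assoc, ← h2]
    group
  have hkj : |((k : ℤ) : ℝ) - (j : ℤ)| ≤ n := by
    have h1 : (j : ℝ) ≤ n := by exact_mod_cast Nat.lt_succ_iff.1 hj
    have h2 : (k : ℝ) ≤ n := by exact_mod_cast Nat.lt_succ_iff.1 hk
    have h3 : (0 : ℝ) ≤ j := by positivity
    have h4 : (0 : ℝ) ≤ k := by positivity
    simp only [Int.cast_natCast]
    rw [abs_le]
    constructor <;> linarith
  refine ⟨τ k - τ j, (k : ℤ) - j, ?_, hq0, ?_, ?_, heq⟩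
  · intro h
    rw [h, zpow_zero, mul_one] at heq
    exact hax.zpow_ne_one hq0 (by simpa using heq.symm)
  · have h1 := hax.abs_sub_le (τ k) (τ j)
    have h2 := hτ j (by omega)
    have h3 := hτ k (by omega)
    have h4 := hax.dist_orbit_le (m + (k : ℤ)) (m + (j : ℤ))
    push_cast at h4 hkj ⊢
    rw [add_sub_add_left_eq_sub] at h4
    have h5 : dist (φ ^ τ k • o) (φ ^ τ j • o) ≤ C * n + C + 4 * C := by
      rw [← dist_smul u]
      have := dist_triangle4 (u • φ ^ τ k • o) (φ ^ (m + (k : ℤ)) • o) (φ ^ (m + (j : ℤ)) • o)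
        (u • φ ^ τ j • o)
      rw [dist_comm (u • φ ^ τ k • o) (φ ^ (m + (k : ℤ)) • o)] at this
      have : C * |(k : ℝ) - j| ≤ C * n := by gcongr
      linarith
    have : C * dist (φ ^ τ k • o) (φ ^ τ j • o) ≤ C * (C * n + C + 4 * C) := by gcongr
    linarith [(Nat.cast_nonneg n : (0 : ℝ) ≤ n)]
  · push_cast at hkj ⊢
    refine hkj.trans ?_
    have : 0 ≤ C * (C * n + C + 4 * C) := by positivity
    linarith

/-- If `G` is not virtually cyclic, some translate of the axis has bounded projection to the axis
and vice versa. As a consequence, no point projects far from `o` both on the axis and on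
its translate by `u⁻¹`. -/
theorem ContractingAxis.exists_independent (hX : IsGeodesicSpace X)
    (hax : ContractingAxis φ o f C) (hfin : ∀ r : ℝ, {g : G | dist o (g • o) ≤ r}.Finite)
    (hG : ¬ IsVirtuallyCyclic G) :
    ∃ (u : G) (c : ℝ), 0 ≤ c ∧ ∀ y : X, |(f y : ℝ)| ≤ c ∨ |(f (u • y) : ℝ)| ≤ c := by
  have hC := hax.one_le
  by_cases hu : ∃ (u : G) (c : ℝ), (∀ t : ℤ, |(f (u • φ ^ t • o) : ℝ)| ≤ c) ∧
      ∀ t : ℤ, |(f (u⁻¹ • φ ^ t • o) : ℝ)| ≤ c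
  · obtain ⟨u, c, h1, h2⟩ := hu
    have hc : 0 ≤ c := (abs_nonneg _).trans (h1 0)
    refine ⟨u, c + (2 * C ^ 2 + 3 * C), by positivity, fun y => ?_⟩
    rcases hax.behrstock u⁻¹ y with h | h
    · right
      rw [inv_inv] at h
      have := h1 (f y)
      rw [abs_le] at *
      constructor <;> linarith [h.1, h.2, this.1, this.2]
    · left
      rw [inv_inv] at h
      have := h2 (f (u • y))
      rw [abs_le] at *
      constructor <;> linarith [h.1, h.2, this.1, this.2]
  · exfalso
    push Not at hu
    obtain ⟨P, hP0, hP⟩ := hax.exists_conj_eq hX hfin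
    have hpq : ∀ u : G, ∃ p q : ℤ, p ≠ 0 ∧ q ≠ 0 ∧ |(p : ℝ)| ≤ P ∧ u * φ ^ p = φ ^ q * u := by
      intro u
      by_cases h : ∀ c : ℝ, ∃ t : ℤ, c < |(f (u • φ ^ t • o) : ℝ)|
      · obtain ⟨p, q, h1, h2, h3, -, h5⟩ := hP u h
        exact ⟨p, q, h1, h2, h3, h5⟩
      · push Not at h
        obtain ⟨c, hc⟩ := h
        have h' : ∀ c : ℝ, ∃ t : ℤ, c < |(f (u⁻¹ • φ ^ t • o) : ℝ)| := by
          intro c'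
          obtain ⟨t, ht⟩ := hu u (max c c') fun t => (hc t).trans (le_max_left _ _)
          exact ⟨t, (le_max_right _ _).trans_lt ht⟩
        obtain ⟨p, q, h1, h2, -, h4, h5⟩ := hP u⁻¹ h'
        refine ⟨q, p, h2, h1, h4, ?_⟩
        have := congrArg (fun g => u * g * u) h5
        simpa [mul_assoc] using this.symm
    -- every orbit point is within bounded distance of the axis
    set t₀ := ⌊2 * C⌋₊ + 1 with ht₀
    have ht₀' : 2 * C < t₀ := by rw [ht₀]; push_cast; exact Nat.lt_floor_add_one _
    have hH : ∀ u : G, dist (u • o) (φ ^ f (u • o) • o) ≤ C * (P * t₀) + C := by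
      intro u
      by_contra hcon
      push Not at hcon
      obtain ⟨p, q, hp, hq, hpP, hpq⟩ := hpq u
      have hcomm : u * φ ^ (p * t₀) = φ ^ (q * t₀) * u := by
        have h1 : u * φ ^ p * u⁻¹ = φ ^ q := by rw [hpq]; group
        rw [zpow_mul, zpow_mul, ← h1, conj_zpow]
        group
      have hd : dist (u • o) (φ ^ (q * t₀) • u • o) ≤ C * (P * t₀) + C := by
        rw [smul_smul, ← hcomm, mul_smul, dist_smul]
        have h1 := hax.dist_orbit_le 0 (p * t₀)
        rw [zpow_zero, one_smul] at h1
        push_cast at h1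
        rw [zero_sub, abs_neg, abs_mul, Nat.abs_cast] at h1
        refine h1.trans ?_
        gcongr
      have h0 : 0 ≤ C * (P * t₀) := by positivity
      have h1 := hax.contract (u • o) (φ ^ (q * t₀) • u • o) (by linarith) (hd.trans_lt hcon)
      have h2 := hax.shift (q * t₀) (u • o)
      have h3 : |((q * t₀ : ℤ) : ℝ)| ≤ 2 * C := by
        rw [abs_le] at *
        constructor <;> linarith [h1.1, h1.2, h2.1, h2.2]
      push_cast at h3
      rw [abs_mul, Nat.abs_cast] at h3
      have h4 : (1 : ℝ) ≤ |(q : ℝ)| := by exact_mod_cast Int.one_le_abs hq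
      have : (0 : ℝ) ≤ t₀ := by positivity
      nlinarith
    refine hG ⟨Subgroup.zpowers φ, inferInstance, ?_⟩
    have hW := hfin (C * (P * t₀) + C)
    have : Finite {g : G | dist o (g • o) ≤ C * (P * t₀) + C} := hW
    have hsurj : Function.Surjective
        (fun w : {g : G | dist o (g • o) ≤ C * (P * t₀) + C} =>
          (QuotientGroup.mk (w : G)⁻¹ : G ⧸ Subgroup.zpowers φ)) := by
      intro x
      obtain ⟨v, rfl⟩ := QuotientGroup.mk_surjective x
      refine ⟨⟨φ ^ (-f (v⁻¹ • o)) * v⁻¹, ?_⟩, ?_⟩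
      · have := hH v⁻¹
        simp only [Set.mem_ofPred_eq]
        rw [mul_smul, ← dist_smul (φ ^ f (v⁻¹ • o)), smul_smul, ← zpow_add, dist_comm]
        simpa using this
      · simp only
        rw [QuotientGroup.eq]
        refine ⟨-f (v⁻¹ • o), ?_⟩
        simp
    have := Finite.of_surjective _ hsurj
    exact Subgroup.finiteIndex_of_finite_quotient

/-- Connecting elements: any `a` can be multiplied by elements `s'` and `s⁻¹` of a fixed finite set
so that both end points of the resulting path project close to the origin of the axis at the
other end, and so that the result is as long as desired. The constant `c` does not depend on
the length. -/
theorem ContractingAxis.exists_connectors (hax : ContractingAxis φ o f C) {u : G} {c : ℝ}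
    (hu : ∀ y : X, |(f y : ℝ)| ≤ c ∨ |(f (u • y) : ℝ)| ≤ c) (D : ℝ) :
    ∃ E : Finset G, ∀ a : G, ∃ s' ∈ E, ∃ s ∈ E, |(f ((s' * a * s⁻¹) • o) : ℝ)| ≤ c ∧
      |(f ((s' * a * s⁻¹)⁻¹ • o) : ℝ)| ≤ c ∧ D < dist o ((s' * a * s⁻¹) • o) := by
  classical
  obtain ⟨L, hL⟩ := exists_nat_gt (2 * (c + C) + C * (2 * |D|) + 3 * C)
  set e : Fin 4 → G := fun i => u * φ ^ ((i : ℤ) * L) with he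
  refine ⟨Finset.univ.image e, fun a => ?_⟩
  by_contra hcon
  push Not at hcon
  have hcon' : ∀ i l : Fin 4, c < |(f ((e i * a * (e l)⁻¹) • o) : ℝ)| ∨
      c < |(f ((e i * a * (e l)⁻¹)⁻¹ • o) : ℝ)| ∨ dist o ((e i * a * (e l)⁻¹) • o) ≤ D := by
    intro i l
    by_contra hc
    push Not at hc
    exact absurd (hcon (e i) (Finset.mem_image_of_mem _ (Finset.mem_univ _)) (e l)
      (Finset.mem_image_of_mem _ (Finset.mem_univ _)) hc.1 hc.2.1) (not_le.2 hc.2.2)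
  have hdiff : ∀ i j : Fin 4, i ≠ j → (L : ℝ) ≤ |((i : ℕ) : ℝ) * L - ((j : ℕ) : ℝ) * L| := by
    intro i j hij
    rw [← sub_mul, abs_mul, Nat.abs_cast]
    have : (1 : ℝ) ≤ |((i : ℕ) : ℝ) - ((j : ℕ) : ℝ)| := by
      have h1 : ((i : ℕ) : ℤ) - ((j : ℕ) : ℤ) ≠ 0 := by
        intro h
        exact hij (Fin.ext (by omega))
      exact_mod_cast Int.one_le_abs h1
    nlinarith [(Nat.cast_nonneg L : (0 : ℝ) ≤ L)]
  have hC := hax.one_le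
  have hc0 : 0 ≤ c := (hu o).elim (fun h => (abs_nonneg _).trans h) fun h => (abs_nonneg _).trans h
  -- among the four candidates, at most one fails to project `y` close to the origin
  have huniq : ∀ (y : X) (i j : Fin 4), c < |(f (e i • y) : ℝ)| → c < |(f (e j • y) : ℝ)| →
      i = j := by
    intro y i j hi hj
    by_contra hij
    have key : ∀ i : Fin 4, c < |(f (e i • y) : ℝ)| → |(f y : ℝ) + ((i : ℕ) : ℝ) * L| ≤ c + C := by
      intro i hi
      have h1 := (hu (φ ^ ((i : ℤ) * L) • y)).resolve_right (by
        rw [smul_smul]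
        exact not_le.2 hi)
      have h2 := hax.shift ((i : ℤ) * L) y
      push_cast at h2
      rw [abs_le] at *
      constructor <;> linarith [h1.1, h1.2, h2.1, h2.2]
    have h1 := key i hi
    have h2 := key j hj
    have h3 := hdiff i j hij
    have h4 : |((i : ℕ) : ℝ) * L - ((j : ℕ) : ℝ) * L| ≤ 2 * (c + C) := by
      rw [abs_le] at *
      constructor <;> linarith [h1.1, h1.2, h2.1, h2.2]
    have : 0 ≤ C * (2 * |D|) := by positivity
    linarith
  -- and at most one of them moves `y` close to `o`
  have huniq' : ∀ (y : X) (i j : Fin 4), dist o (e i • y) ≤ D → dist o (e j • y) ≤ D → i = j := by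
    intro y i j hi hj
    by_contra hij
    have h1 : dist ((e i)⁻¹ • o) ((e j)⁻¹ • o) ≤ 2 * |D| := by
      have h2 : dist ((e i)⁻¹ • o) y ≤ D := by rwa [← dist_smul (e i), smul_inv_smul]
      have h3 : dist ((e j)⁻¹ • o) y ≤ D := by rwa [← dist_smul (e j), smul_inv_smul]
      have := dist_triangle_right ((e i)⁻¹ • o) ((e j)⁻¹ • o) y
      linarith [le_abs_self D]
    have h2 := hax.lip ((e i)⁻¹ • o) ((e j)⁻¹ • o)
    have key : ∀ i : Fin 4, |(f ((e i)⁻¹ • o) : ℝ) - f (u⁻¹ • o) + ((i : ℕ) : ℝ) * L| ≤ C := by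
      intro i
      have := hax.shift (-((i : ℤ) * L)) (u⁻¹ • o)
      rw [smul_smul, zpow_neg, ← mul_inv_rev] at this
      push_cast at this
      rw [sub_neg_eq_add] at this
      exact this
    have h3 := key i
    have h4 := key j
    have h5 := hdiff i j hij
    have h6 : C * dist ((e i)⁻¹ • o) ((e j)⁻¹ • o) ≤ C * (2 * |D|) := by gcongr
    have h7 : |((i : ℕ) : ℝ) * L - ((j : ℕ) : ℝ) * L| ≤ C * (2 * |D|) + 3 * C := by
      rw [abs_le] at *
      constructor <;> linarith [h2.1, h2.2, h3.1, h3.2, h4.1, h4.2]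
    linarith
  have hinj : ∀ (P : Fin 4 → Fin 4 → Prop), (∀ l i j, P i l → P j l → i = j) →
      (Finset.univ.filter fun x : Fin 4 × Fin 4 => P x.1 x.2).card ≤ 4 := by
    intro P hP
    refine (Finset.card_le_card_of_injOn Prod.snd (fun _ _ => Finset.mem_univ _) ?_).trans
      (le_of_eq (Finset.card_fin 4))
    rintro ⟨i, l⟩ hi ⟨j, l'⟩ hj (rfl : l = l')
    have hi : P i l := (Finset.mem_filter.1 hi).2
    have hj : P j l := (Finset.mem_filter.1 hj).2
    rw [hP l i j hi hj]
  have hinj' : ∀ (P : Fin 4 → Fin 4 → Prop), (∀ i l m, P i l → P i m → l = m) →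
      (Finset.univ.filter fun x : Fin 4 × Fin 4 => P x.1 x.2).card ≤ 4 := by
    intro P hP
    refine (Finset.card_le_card_of_injOn Prod.fst (fun _ _ => Finset.mem_univ _) ?_).trans
      (le_of_eq (Finset.card_fin 4))
    rintro ⟨i, l⟩ hi ⟨i', m⟩ hj (rfl : i = i')
    have hi : P i l := (Finset.mem_filter.1 hi).2
    have hj : P i m := (Finset.mem_filter.1 hj).2
    rw [hP i l m hi hj]
  -- each of the three conditions excludes at most four of the sixteen pairs of candidates
  have b1 := hinj (fun i l => c < |(f ((e i * a * (e l)⁻¹) • o) : ℝ)|) fun l i j hi hj =>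
    huniq ((a * (e l)⁻¹) • o) i j (by simpa only [smul_smul, mul_assoc] using hi)
      (by simpa only [smul_smul, mul_assoc] using hj)
  have b2 := hinj' (fun i l => c < |(f ((e i * a * (e l)⁻¹)⁻¹ • o) : ℝ)|) fun i l m hl hm =>
    huniq ((a⁻¹ * (e i)⁻¹) • o) l m
      (by simpa only [smul_smul, mul_inv_rev, inv_inv, mul_assoc] using hl)
      (by simpa only [smul_smul, mul_inv_rev, inv_inv, mul_assoc] using hm)
  have b3 := hinj (fun i l => dist o ((e i * a * (e l)⁻¹) • o) ≤ D) fun l i j hi hj =>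
    huniq' ((a * (e l)⁻¹) • o) i j (by simpa only [smul_smul, mul_assoc] using hi)
      (by simpa only [smul_smul, mul_assoc] using hj)
  have hcard : (Finset.univ : Finset (Fin 4 × Fin 4)).card ≤ 4 + 4 + 4 := by
    refine (Finset.card_le_card (t := _ ∪ _ ∪ _) fun x _ => ?_).trans
      ((Finset.card_union_le _ _).trans (Nat.add_le_add ((Finset.card_union_le _ _).trans
        (Nat.add_le_add b1 b2)) b3))
    simp only [Finset.mem_union, Finset.mem_filter, Finset.mem_univ, true_and]
    rcases hcon' x.1 x.2 with h | h | h
    · exact Or.inl (Or.inl h)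
    · exact Or.inl (Or.inr h)
    · exact Or.inr h
  simp at hcard

end Axis

/-! ### Exponential growth -/

section Growth

variable {G X : Type*} [Group G] [MetricSpace X] [MulAction G X] {φ : G} {o : X} {f : X → ℤ} {C : ℝ}

/-- The axis and an independent translate of it provide ping-pong partners, which generate a free
semigroup. -/
theorem ContractingAxis.exists_two_pow_le_ballCard (hax : ContractingAxis φ o f C) {u : G} {c : ℝ}
    (hu : ∀ y : X, |(f y : ℝ)| ≤ c ∨ |(f (u • y) : ℝ)| ≤ c) {S : Finset G}
    (hS : Subgroup.closure (S : Set G) = ⊤) :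
    ∃ r : ℕ, 0 < r ∧ ∀ m : ℕ, 2 ^ m ≤ ballCard S (r * m) := by
  classical
  have hC := hax.one_le
  have hc0 : 0 ≤ c := (hu o).elim (fun h => (abs_nonneg _).trans h) fun h => (abs_nonneg _).trans h
  obtain ⟨M, hM⟩ := exists_nat_gt (2 * c + C)
  set U : Set X := {y | c < f y} with hU
  set g : Bool → G := fun b => if b then φ ^ (M : ℤ) else φ ^ (M : ℤ) * u with hg
  have hgU : ∀ b, ∀ y ∈ U, g b • y ∈ U := by
    intro b y hy
    have hy : c < f y := hy
    change c < f (g b • y)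
    cases b
    · simp only [hg, Bool.false_eq_true, if_false, mul_smul]
      have h1 := hax.shift M (u • y)
      have h2 := (hu y).resolve_left fun h => by linarith [(abs_le.1 h).2]
      rw [abs_le] at h1 h2
      push_cast at h1
      linarith [h1.1, h2.1]
    · simp only [hg, if_true]
      have h1 := hax.shift M y
      rw [abs_le] at h1
      push_cast at h1
      linarith [h1.1]
  have hdisj : ∀ b b', b ≠ b' → ∀ y ∈ U, ∀ z ∈ U, g b • y ≠ g b' • z := by
    have key : ∀ y ∈ U, ∀ z ∈ U, g true • y ≠ g false • z := by
      intro y hy z hz h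
      simp only [hg, Bool.false_eq_true, if_false, if_true, mul_smul] at h
      have h1 : y = u • z := (MulAction.injective _) h
      have hy : c < f y := hy
      have hz : c < f z := hz
      rcases hu z with h2 | h2
      · linarith [(abs_le.1 h2).2]
      · rw [← h1] at h2
        linarith [(abs_le.1 h2).2]
    intro b b' hb y hy z hz
    cases b <;> cases b'
    · exact absurd rfl hb
    · exact (key z hz y hy).symm
    · exact key y hy z hz
    · exact absurd rfl hb
  obtain ⟨i, hi⟩ := exists_nat_gt (c + C)
  have hy₀ : φ ^ (i : ℤ) • o ∈ U := by
    have := (abs_le.1 (hax.coord_orbit i)).1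
    push_cast at this
    change c < _
    linarith
  set y₀ := φ ^ (i : ℤ) • o
  have hprodU : ∀ l : List Bool, (l.map g).prod • y₀ ∈ U := by
    intro l
    induction l with
    | nil => simpa using hy₀
    | cons b l ih =>
      rw [List.map_cons, List.prod_cons, mul_smul]
      exact hgU b _ ih
  have hinj : ∀ l l' : List Bool, l.length = l'.length → (l.map g).prod = (l'.map g).prod →
      l = l' := by
    intro l
    induction l with
    | nil => intro l' h _; exact (List.length_eq_zero_iff.1 h.symm).symm
    | cons b l ih =>
      intro l' h heq
      cases l' with
      | nil => simp at h
      | cons b' l' =>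
        simp only [List.map_cons, List.prod_cons] at heq
        have hb : b = b' := by
          by_contra hb
          refine hdisj b b' hb _ (hprodU l) _ (hprodU l') ?_
          have := congrArg (fun x : G => x • y₀) heq
          simpa only [mul_smul] using this
        subst hb
        rw [ih l' (by simpa using h) (mul_left_cancel heq)]
  set r := max (wordNorm S (g true)) (wordNorm S (g false)) + 1 with hr
  have hlen : ∀ l : List Bool, wordNorm S (l.map g).prod ≤ r * l.length := by
    intro l
    induction l with
    | nil => simp [wordNorm_one]
    | cons b l ih =>
      rw [List.map_cons, List.prod_cons, List.length_cons, Nat.mul_succ]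
      refine (wordNorm_mul_le hS _ _).trans ?_
      have : wordNorm S (g b) ≤ r := by cases b <;> omega
      omega
  refine ⟨r, by omega, fun m => ?_⟩
  set F : List.Vector Bool m → G := fun v => (v.toList.map g).prod with hF
  have hFinj : Function.Injective F := by
    intro v w h
    exact List.Vector.toList_injective (hinj _ _ (by simp) h)
  have hsub : ((Finset.univ.image F : Finset G) : Set G) ⊆ wordBall S ((r * m : ℕ) : ℝ) := by
    intro x hx
    simp only [Finset.coe_image, Finset.coe_univ, Set.image_univ] at hx
    obtain ⟨v, rfl⟩ := hx
    rw [mem_wordBall_natCast]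
    simpa using hlen v.toList
  have := Set.ncard_le_ncard hsub (wordBall_finite hS _)
  rw [Set.ncard_coe_finset, Finset.card_image_of_injective _ hFinj, Finset.card_univ,
    card_vector, Fintype.card_bool] at this
  exact this

end Growth

/-- Balls grow exponentially at a rate `h > 0`, the limit of `log (ballCard S n) / n`, which is also
its infimum. The factor `11 / 10` is an arbitrary number larger than `1`. -/
theorem exists_growth_rate {G : Type*} [Group G] {S : Finset G}
    (hS : Subgroup.closure (S : Set G) = ⊤) {r : ℕ} (hr : 0 < r)
    (hpow : ∀ m : ℕ, 2 ^ m ≤ ballCard S (r * m)) :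
    ∃ h : ℝ, 0 < h ∧ (∀ n : ℕ, Real.exp (h * n) ≤ ballCard S n) ∧
      ∃ A : ℝ, 0 < A ∧ ∀ n : ℕ, (ballCard S n : ℝ) ≤ A * Real.exp (11 / 10 * h * n) := by
  set u : ℕ → ℝ := fun n => Real.log (ballCard S n) with hu
  have hpos : ∀ n, (1 : ℝ) ≤ ballCard S n := fun n => by exact_mod_cast ballCard_pos hS n
  have hsub : Subadditive u := by
    intro m n
    rw [hu]
    simp only
    rw [← Real.log_mul (by linarith [hpos m]) (by linarith [hpos n])]
    exact Real.log_le_log (by linarith [hpos (m + n)]) (by exact_mod_cast ballCard_add_le hS m n)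
  have hbdd : BddBelow (Set.range fun n => u n / n) := by
    refine ⟨0, ?_⟩
    rintro _ ⟨n, rfl⟩
    exact div_nonneg (Real.log_nonneg (hpos n)) (by positivity)
  have hlim := hsub.tendsto_lim hbdd
  have hr' : (0 : ℝ) < r := by exact_mod_cast hr
  have hl2 := Real.log_pos (by norm_num : (1 : ℝ) < 2)
  have hh : Real.log 2 / r ≤ hsub.lim := by
    have h1 : Filter.Tendsto (fun m : ℕ => r * (m + 1)) Filter.atTop Filter.atTop :=
      Filter.tendsto_atTop_mono (fun m => by
        have := Nat.le_mul_of_pos_left (m + 1) hr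
        simp only [id]
        omega) Filter.tendsto_id
    refine ge_of_tendsto' (hlim.comp h1) fun m => ?_
    have h2 : (2 : ℝ) ^ (m + 1) ≤ ballCard S (r * (m + 1)) := by exact_mod_cast hpow (m + 1)
    have h3 := Real.log_le_log (by positivity) h2
    rw [Real.log_pow] at h3
    simp only [Function.comp_apply, hu]
    push_cast at h3 ⊢
    rw [div_le_div_iff₀ hr' (by positivity)]
    nlinarith
  have hpos' : 0 < hsub.lim := lt_of_lt_of_le (by positivity) hh
  refine ⟨hsub.lim, hpos', fun n => ?_, ?_⟩
  · rw [← Real.le_log_iff_exp_le (by linarith [hpos n])]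
    rcases Nat.eq_zero_or_pos n with rfl | hn
    · simpa using Real.log_nonneg (hpos 0)
    · have h1 := hsub.lim_le_div hbdd hn.ne'
      rwa [le_div_iff₀ (by exact_mod_cast hn)] at h1
  · have hev : ∀ᶠ n in Filter.atTop, u n / n < 11 / 10 * hsub.lim :=
      hlim.eventually_lt_const (by linarith)
    obtain ⟨N, hN⟩ := Filter.eventually_atTop.1 hev
    refine ⟨ballCard S N, by linarith [hpos N], fun n => ?_⟩
    rcases le_total n N with h | h
    · have h1 : (ballCard S n : ℝ) ≤ ballCard S N := by exact_mod_cast ballCard_mono hS h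
      have h2 : 1 ≤ Real.exp (11 / 10 * hsub.lim * n) := Real.one_le_exp (by positivity)
      nlinarith [hpos N]
    · rcases Nat.eq_zero_or_pos n with rfl | hn
      · have : N = 0 := by omega
        simp [this]
      have h1 := hN n h
      rw [div_lt_iff₀ (by exact_mod_cast hn)] at h1
      have h2 : (ballCard S n : ℝ) ≤ Real.exp (11 / 10 * hsub.lim * n) := by
        rw [← Real.log_le_iff_le_exp (by linarith [hpos n])]
        exact h1.le
      nlinarith [hpos N, Real.exp_pos (11 / 10 * hsub.lim * n)]

/-! ### Half-spaces of translated axis segments -/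

section HalfSpace

variable {G X : Type*} [Group G] [MulAction G X]

/-- The point `x` projects to the axis of `h φ h⁻¹` before the point of coordinate `m` to the right
of `h o`, the beginning of the segment `h o, …, h φ ^ M o`. -/
def InLeft (f : X → ℤ) (m : ℝ) (h : G) (x : X) : Prop := (f (h⁻¹ • x) : ℝ) ≤ m

/-- The point `x` projects to the axis of `h φ h⁻¹` after the point that lies `m` to the left of
the end of the segment `h o, …, h φ ^ M o`. -/
def InRight (f : X → ℤ) (M : ℕ) (m : ℝ) (h : G) (x : X) : Prop := (M : ℝ) - m ≤ f (h⁻¹ • x)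

/-- The segment at `h` precedes the segment at `h'`: the right half-space of `h` and the left
half-space of `h'` cover the space. -/
def Precedes (f : X → ℤ) (M : ℕ) (m : ℝ) (h h' : G) : Prop :=
  ∀ x : X, InRight f M m h x ∨ InLeft f m h' x

variable {f : X → ℤ} {M : ℕ} {m : ℝ} {h h' h'' : G} {x : X}

theorem InLeft.not_inRight (hM : 2 * m < M) (hx : InLeft f m h x) : ¬ InRight f M m h x := by
  intro hx'
  rw [InLeft] at hx
  rw [InRight] at hx'
  linarith

theorem InLeft.mono {m' : ℝ} (hm : m ≤ m') (hx : InLeft f m h x) : InLeft f m' h x :=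
  le_trans hx hm

theorem InRight.mono {m' : ℝ} (hm : m ≤ m') (hx : InRight f M m h x) : InRight f M m' h x :=
  (sub_le_sub_left hm _).trans hx

theorem Precedes.mono {m' : ℝ} (hm : m ≤ m') (hp : Precedes f M m h h') : Precedes f M m' h h' :=
  fun x => (hp x).imp (InRight.mono hm) (InLeft.mono hm)

theorem Precedes.inLeft (hM : 2 * m < M) (hp : Precedes f M m h h') (hx : InLeft f m h x) :
    InLeft f m h' x :=
  (hp x).resolve_left (hx.not_inRight hM)

theorem Precedes.inRight (hM : 2 * m < M) (hp : Precedes f M m h h') (hx : InRight f M m h' x) :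
    InRight f M m h x :=
  (hp x).resolve_right fun hl => hl.not_inRight hM hx

theorem inLeft_mul (g : G) : InLeft f m (g * h) (g • x) ↔ InLeft f m h x := by
  simp [InLeft, mul_smul]

theorem inRight_mul (g : G) : InRight f M m (g * h) (g • x) ↔ InRight f M m h x := by
  simp [InRight, mul_smul]

theorem Precedes.mul_left (hp : Precedes f M m h h') (g : G) :
    Precedes f M m (g * h) (g * h') := by
  intro x
  have := hp (g⁻¹ • x)
  rwa [← inRight_mul g, ← inLeft_mul g, smul_inv_smul] at this

end HalfSpace

section Order

variable {G X : Type*} [Group G] [MetricSpace X] [MulAction G X] [IsIsometricSMul G X]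
  {φ : G} {o : X} {f : X → ℤ} {C : ℝ}

/-- A geodesic whose end points project to the axis of `h φ h⁻¹` on different sides of `h φⁱ o` passes
close to this point. -/
theorem ContractingAxis.exists_passes (hax : ContractingAxis φ o f C) {c : ℝ → X} {ℓ a b : ℝ}
    (hc : IsGeodesicOn c ℓ) (ha : 0 ≤ a) (hab : a ≤ b) (hb : b ≤ ℓ) (h : G) {i : ℤ}
    (h1 : (f (h⁻¹ • c a) : ℝ) + C ≤ i) (h2 : (i : ℝ) ≤ f (h⁻¹ • c b) - C) :
    ∃ t, a ≤ t ∧ t ≤ b ∧ dist (c t) (h • φ ^ i • o) ≤ C := by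
  obtain ⟨t, ht, hd⟩ := hax.passes (fun t => h⁻¹ • c (a + t)) (b - a) (by linarith) (by
    intro s hs t ht
    rw [dist_smul, hc _ ⟨by linarith [hs.1], by linarith [hs.2]⟩ _
      ⟨by linarith [ht.1], by linarith [ht.2]⟩]
    congr 1
    ring) i (by simpa using h1) (by simpa using h2)
  refine ⟨a + t, by linarith [ht.1], by linarith [ht.2], ?_⟩
  rwa [← dist_smul h, smul_inv_smul] at hd

theorem ContractingAxis.dist_add_dist_le (hX : IsGeodesicSpace X) (hax : ContractingAxis φ o f C)
    (h : G) {x y : X} {i : ℤ} (h1 : (f (h⁻¹ • x) : ℝ) + C ≤ i)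
    (h2 : (i : ℝ) ≤ f (h⁻¹ • y) - C) :
    dist x (h • φ ^ i • o) + dist (h • φ ^ i • o) y ≤ dist x y + 2 * C := by
  obtain ⟨c, hc0, hc1, hc⟩ := hX x y
  have hc : IsGeodesicOn c (dist x y) := hc
  obtain ⟨t, ht0, ht1, hd⟩ := hax.exists_passes hc le_rfl dist_nonneg le_rfl h
    (by rwa [hc0]) (by rwa [hc1])
  have e1 := hc.dist_eq le_rfl ht0 ht1
  have e2 := hc.dist_eq ht0 ht1 le_rfl
  rw [hc0] at e1
  rw [hc1] at e2
  have t1 := dist_triangle x (c t) (h • φ ^ i • o)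
  have t2 := dist_triangle_left (h • φ ^ i • o) y (c t)
  linarith

/-- Two distant points `h φⁱ o` and `h' φʲ o` of two axes, each of which projects to the other axis
not on the wrong side of the other point, separate the space: no point projects both before the
first and after the second. Otherwise each of the two points would lie between this point and
the other one. -/
theorem ContractingAxis.le_or_le_of_far (hX : IsGeodesicSpace X) (hax : ContractingAxis φ o f C)
    {h h' : G} {i j : ℤ} {c : ℝ} (hc : 0 ≤ c)
    (h1 : (i : ℝ) - c ≤ f (h⁻¹ • h' • φ ^ j • o)) (h2 : (f (h'⁻¹ • h • φ ^ i • o) : ℝ) ≤ j + c)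
    (hd : 2 * C + 2 * (C * (c + C + 1) + C) < dist (h • φ ^ i • o) (h' • φ ^ j • o)) (z : X) :
    (i : ℝ) - (c + 2 * C + 1) ≤ f (h⁻¹ • z) ∨ (f (h'⁻¹ • z) : ℝ) ≤ j + (c + 2 * C + 1) := by
  by_contra hcon
  push Not at hcon
  obtain ⟨hz1, hz2⟩ := hcon
  have hC := hax.one_le
  have hn1 := Int.le_ceil (c + C)
  have hn2 := Int.ceil_lt_add_one (c + C)
  set n := ⌈c + C⌉
  have hn0 : (0 : ℝ) ≤ n := by linarith
  have near : ∀ (g : G) (k l : ℤ), |(k : ℝ) - l| = n →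
      dist (g • φ ^ k • o) (g • φ ^ l • o) ≤ C * (c + C + 1) + C := by
    intro g k l hkl
    rw [dist_smul]
    refine (hax.dist_orbit_le _ _).trans ?_
    rw [hkl]
    gcongr
  have a1 := hax.dist_add_dist_le hX h (x := z) (y := h' • φ ^ j • o) (i := i - n)
    (by push_cast; linarith) (by push_cast; linarith)
  have a2 := hax.dist_add_dist_le hX h' (x := h • φ ^ i • o) (y := z) (i := j + n)
    (by push_cast; linarith) (by push_cast; linarith)
  have b1 := near h i (i - n) (by push_cast; rw [sub_sub_cancel, abs_of_nonneg hn0])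
  have b2 := near h' j (j + n) (by push_cast; rw [sub_add_cancel_left, abs_neg, abs_of_nonneg hn0])
  have t1 := dist_triangle_right z (h • φ ^ i • o) (h • φ ^ (i - n) • o)
  have t2 := dist_triangle (h • φ ^ i • o) (h • φ ^ (i - n) • o) (h' • φ ^ j • o)
  have t3 := dist_triangle_right (h • φ ^ i • o) (h' • φ ^ j • o) (h' • φ ^ (j + n) • o)
  have t4 := dist_triangle (h' • φ ^ j • o) (h' • φ ^ (j + n) • o) z
  rw [dist_comm z] at t1 a1
  rw [dist_comm (h' • φ ^ j • o) z] at t4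
  rw [dist_comm z (h' • φ ^ j • o)] at a1 t4
  rw [dist_comm (h • φ ^ i • o) z] at a2
  rw [dist_comm (h • φ ^ (i - n) • o) z] at a1
  rw [dist_comm (h • φ ^ i • o) z] at t1
  linarith

/-- A segment precedes the next one if the two are joined by a long element whose end points
project close to the end of the first segment and to the beginning of the second one. -/
theorem ContractingAxis.precedes_mul (hX : IsGeodesicSpace X) (hax : ContractingAxis φ o f C)
    {v : G} {c : ℝ} (hc : 0 ≤ c) (h1 : |(f (v • o) : ℝ)| ≤ c) (h2 : |(f (v⁻¹ • o) : ℝ)| ≤ c)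
    (hd : 2 * C + 2 * (C * (c + C + C + 1) + C) < dist o (v • o)) (M : ℕ) (h : G) :
    Precedes f M (c + 3 * C + 1) h (h * φ ^ M * v) := by
  have hC := hax.one_le
  intro z
  have e1 : h⁻¹ • (h * φ ^ M * v) • φ ^ (0 : ℤ) • o = φ ^ (M : ℤ) • v • o := by
    simp [smul_smul, mul_assoc]
  have e2 : (h * φ ^ M * v)⁻¹ • h • φ ^ (M : ℤ) • o = v⁻¹ • o := by
    simp [smul_smul, mul_assoc]
  have e3 : dist (h • φ ^ (M : ℤ) • o) ((h * φ ^ M * v) • φ ^ (0 : ℤ) • o) = dist o (v • o) := by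
    rw [zpow_zero, one_smul, mul_smul, mul_smul, zpow_natCast, dist_smul, dist_smul]
  have key := hax.le_or_le_of_far hX (h := h) (h' := h * φ ^ M * v) (i := M) (j := 0)
    (c := c + C) (by linarith)
    (by
      rw [e1]
      have := hax.shift M (v • o)
      rw [abs_le] at this h1
      linarith [this.1, h1.1])
    (by
      rw [e2]
      push_cast
      linarith [(abs_le.1 h2).2])
    (by rwa [e3]) z
  rw [InRight, InLeft]
  push_cast at key
  refine key.imp (fun h => ?_) fun h => ?_ <;> linarith

set_option maxHeartbeats 400000 in
/-- Two segments crossed by the same pair of points `x`, `y` are ordered by their distance to `x`,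
unless they are close to each other: a geodesic from `x` to `y` passes along both of them. -/
theorem ContractingAxis.exists_precedes_of_crossing (hX : IsGeodesicSpace X)
    (hax : ContractingAxis φ o f C) {m : ℝ} (hm : 0 ≤ m) (r : ℝ) :
    ∃ m₁ : ℝ, m ≤ m₁ ∧ ∀ M : ℕ, 2 * m₁ < M → ∃ T B : ℝ, 0 < T ∧ ∀ (x y : X) (h h' : G),
      InLeft f m h x → InRight f M m h y → InLeft f m h' x → InRight f M m h' y →
      (dist x (h • o) + T < dist x (h' • o) → Precedes f M m₁ h h' ∧
        ∀ s : G, dist o (s • o) ≤ r → InRight f M m₁ h ((h' * s) • o)) ∧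
      (|dist x (h • o) - dist x (h' • o)| ≤ T → dist (h • o) (h' • o) ≤ B) := by
  have hC := hax.one_le
  obtain ⟨a, ha⟩ := exists_nat_gt (m + C)
  have ha0 : (0 : ℝ) ≤ a := by positivity
  set m₁ := a + (C ^ 2 + 4 * C + 1) + (C * (|r| + (C * a + C)) + C) with hm₁
  have hr0 : 0 ≤ C * (|r| + (C * a + C)) + C := by positivity
  have hm₁a : a + (C ^ 2 + 4 * C + 1) ≤ m₁ := by linarith
  have hm₁r : a + (C ^ 2 + 2 * C) + (C * (|r| + (C * a + C)) + C) ≤ m₁ := by rw [hm₁]; linarith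
  have hsq : 0 ≤ C ^ 2 := by positivity
  refine ⟨m₁, by linarith, fun M hM => ?_⟩
  have hM2 : (a : ℝ) ≤ M - a := by linarith
  set D := 2 * C + 2 * (C * (C ^ 2 + 2 * C + C + 1) + C) with hD
  have hD0 : 0 ≤ D := by positivity
  set b₁ := C + (C * a + C) with hb₁
  have hb₁0 : 0 ≤ b₁ := by positivity
  set T := b₁ + (C + (C * M + C)) + D + 4 * C + 1 with hT
  refine ⟨T, T + 4 * b₁, by positivity, fun x y h h' hx hy hx' hy' => ?_⟩
  rw [InLeft] at hx hx'
  rw [InRight] at hy hy'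
  obtain ⟨c, hc0, hc1, hc⟩ := hX x y
  set ℓ := dist x y
  have hℓ : 0 ≤ ℓ := dist_nonneg
  have hc : IsGeodesicOn c ℓ := hc
  have hpass : ∀ (g : G) (i : ℤ), (f (g⁻¹ • x) : ℝ) ≤ m → (M : ℝ) - m ≤ f (g⁻¹ • y) →
      (a : ℝ) ≤ i → (i : ℝ) ≤ M - a → ∃ t, 0 ≤ t ∧ t ≤ ℓ ∧ dist (c t) (g • φ ^ i • o) ≤ C := by
    intro g i h1 h2 h3 h4
    exact hax.exists_passes hc le_rfl hℓ le_rfl g (by rw [hc0]; linarith) (by rw [hc1]; linarith)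
  have horb : ∀ (g : G) (i : ℤ), 0 ≤ i → dist (g • φ ^ i • o) (g • o) ≤ C * i + C := by
    intro g i hi
    have h1 := hax.dist_orbit_le i 0
    rw [zpow_zero, one_smul, Int.cast_zero, sub_zero,
      abs_of_nonneg (by exact_mod_cast hi : (0 : ℝ) ≤ i)] at h1
    rwa [dist_smul]
  have htime : ∀ (g : G) (i : ℤ) (t : ℝ), 0 ≤ t → t ≤ ℓ → 0 ≤ i →
      dist (c t) (g • φ ^ i • o) ≤ C → |t - dist x (g • o)| ≤ C + (C * i + C) ∧
        dist (c t) (g • o) ≤ C + (C * i + C) := by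
    intro g i t ht0 ht1 hi hd
    have h1 := horb g i hi
    have h2 := dist_triangle (c t) (g • φ ^ i • o) (g • o)
    have h3 := hc.dist_eq le_rfl ht0 ht1
    rw [hc0, sub_zero] at h3
    have h4 := dist_triangle x (c t) (g • o)
    have h5 := dist_triangle_right x (c t) (g • o)
    refine ⟨?_, by linarith⟩
    rw [abs_le]
    constructor <;> linarith
  constructor
  · intro hlt
    obtain ⟨t, ht0, ht1, htd⟩ := hpass h (M - a : ℤ) hx hy (by push_cast; linarith)
      (by push_cast; linarith)
    obtain ⟨t', ht0', ht1', htd'⟩ := hpass h' (a : ℤ) hx' hy' (by push_cast; linarith)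
      (by push_cast; linarith)
    have hMa : (0 : ℤ) ≤ (M - a : ℤ) := by
      have : (a : ℝ) ≤ M := by linarith
      have : a ≤ M := by exact_mod_cast this
      omega
    have k1 := (htime h _ t ht0 ht1 hMa htd).1
    have k2 := (htime h' _ t' ht0' ht1' (by omega) htd').1
    have hgap : D + 4 * C + 1 < t' - t := by
      rw [abs_le] at k1 k2
      push_cast at k1 k2
      have : C * ((M : ℝ) - a) ≤ C * M := by
        gcongr
        linarith
      linarith [k1.2, k2.1]
    -- beyond its passage along the first segment, the geodesic does not return to it
    have p1 : (M : ℝ) - a - C ≤ f (h⁻¹ • c t') := by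
      by_contra hcon
      obtain ⟨s, hs0, hs1, hsd⟩ := hax.exists_passes hc ht0' ht1' le_rfl h (i := (M - a : ℤ))
        (by push_cast; linarith) (by rw [hc1]; push_cast; linarith)
      have e1 := hc.dist_eq ht0 (by linarith : t ≤ s) hs1
      have e2 := dist_triangle_right (c t) (c s) (h • φ ^ (M - a : ℤ) • o)
      linarith
    have p2 : (f (h'⁻¹ • c t) : ℝ) ≤ a + C := by
      by_contra hcon
      obtain ⟨s, hs0, hs1, hsd⟩ := hax.exists_passes hc le_rfl ht0 ht1 h' (i := (a : ℤ))
        (by rw [hc0]; push_cast; linarith) (by push_cast; linarith)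
      have e1 := hc.dist_eq hs0 (by linarith : s ≤ t') ht1'
      have e2 := dist_triangle_right (c s) (c t') (h' • φ ^ (a : ℤ) • o)
      linarith
    have q1 : (M : ℝ) - a - (C ^ 2 + 2 * C) ≤ f (h⁻¹ • h' • φ ^ (a : ℤ) • o) := by
      have e1 := hax.lip (h⁻¹ • c t') (h⁻¹ • h' • φ ^ (a : ℤ) • o)
      rw [dist_smul, abs_le] at e1
      have : C * dist (c t') (h' • φ ^ (a : ℤ) • o) ≤ C * C := by gcongr
      have e2 : C * C = C ^ 2 := by ring
      linarith [e1.2]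
    have q2 : (f (h'⁻¹ • h • φ ^ (M - a : ℤ) • o) : ℝ) ≤ a + (C ^ 2 + 2 * C) := by
      have e1 := hax.lip (h'⁻¹ • c t) (h'⁻¹ • h • φ ^ (M - a : ℤ) • o)
      rw [dist_smul, abs_le] at e1
      have : C * dist (c t) (h • φ ^ (M - a : ℤ) • o) ≤ C * C := by gcongr
      have e2 : C * C = C ^ 2 := by ring
      linarith [e1.1]
    constructor
    · intro z
      have hfar : D < dist (h • φ ^ (M - a : ℤ) • o) (h' • φ ^ (a : ℤ) • o) := by
        have e1 := hc.dist_eq ht0 (by linarith : t ≤ t') ht1'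
        have e2 := dist_triangle4 (c t) (h • φ ^ (M - a : ℤ) • o) (h' • φ ^ (a : ℤ) • o) (c t')
        rw [dist_comm (h' • φ ^ (a : ℤ) • o) (c t')] at e2
        linarith
      have key := hax.le_or_le_of_far hX (c := C ^ 2 + 2 * C) (by positivity)
        (by push_cast; exact q1) (by push_cast; exact q2) hfar z
      rw [InRight, InLeft]
      push_cast at key
      refine key.imp (fun h => ?_) fun h => ?_ <;> linarith
    · intro s hs
      rw [InRight]
      have e1 := hax.lip (h⁻¹ • h' • φ ^ (a : ℤ) • o) (h⁻¹ • (h' * s) • o)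
      rw [dist_smul, mul_smul, dist_smul] at e1
      have e2 : dist (φ ^ (a : ℤ) • o) (s • o) ≤ |r| + (C * a + C) := by
        have h1 := horb 1 (a : ℤ) (by omega)
        rw [one_smul, one_smul] at h1
        have h2 := dist_triangle (φ ^ (a : ℤ) • o) o (s • o)
        push_cast at h1
        linarith [le_abs_self r]
      have e3 : C * dist (φ ^ (a : ℤ) • o) (s • o) ≤ C * (|r| + (C * a + C)) := by gcongr
      rw [mul_smul]
      linarith [(abs_le.1 e1).2]
  · intro hle
    obtain ⟨t, ht0, ht1, htd⟩ := hpass h (a : ℤ) hx hy (by push_cast; linarith)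
      (by push_cast; linarith)
    obtain ⟨t', ht0', ht1', htd'⟩ := hpass h' (a : ℤ) hx' hy' (by push_cast; linarith)
      (by push_cast; linarith)
    obtain ⟨k1, k2⟩ := htime h _ t ht0 ht1 (by omega) htd
    obtain ⟨k1', k2'⟩ := htime h' _ t' ht0' ht1' (by omega) htd'
    have e1 := hc t ⟨ht0, ht1⟩ t' ⟨ht0', ht1'⟩
    have e2 := dist_triangle4 (h • o) (c t) (c t') (h' • o)
    rw [dist_comm (h • o) (c t)] at e2
    push_cast at k1 k2 k1' k2'
    have e3 : |t - t'| ≤ T + 2 * b₁ := by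
      rw [abs_le] at k1 k1' hle ⊢
      constructor <;> linarith [k1.1, k1.2, k1'.1, k1'.2, hle.1, hle.2]
    linarith

end Order

/-! ### Word geodesics that cross a segment -/

section Progress

variable {G X : Type*} [Group G] [MetricSpace X] [MulAction G X] [IsIsometricSMul G X]
  {φ : G} {o : X} {f : X → ℤ} {C κ : ℝ} {S : Finset G}

/-- A sequence that starts at most at `a` and ends at least at `b` has a stretch along which it goes
from at most `a` to at least `b` with all values in between strictly between them. -/
theorem exists_crossing_window {F : ℕ → ℤ} {n : ℕ} {a b : ℝ} (h0 : (F 0 : ℝ) ≤ a)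
    (hn : b ≤ F n) (hab : a < b) :
    ∃ i j, i < j ∧ j ≤ n ∧ (F i : ℝ) ≤ a ∧ b ≤ F j ∧
      ∀ k, i < k → k < j → a < F k ∧ (F k : ℝ) < b := by
  classical
  have hex : ∃ j, b ≤ (F j : ℝ) := ⟨n, hn⟩
  set j := Nat.find hex with hj
  have hjs : b ≤ (F j : ℝ) := Nat.find_spec hex
  have hjn : j ≤ n := Nat.find_min' hex hn
  have hlt : ∀ k < j, (F k : ℝ) < b := fun k hk => not_le.1 (Nat.find_min hex hk)
  have hj0 : 0 < j := by
    rcases Nat.eq_zero_or_pos j with h | h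
    · rw [h] at hjs
      linarith
    · exact h
  set i := Nat.findGreatest (fun k => (F k : ℝ) ≤ a) (j - 1) with hi
  have his : (F i : ℝ) ≤ a :=
    Nat.findGreatest_spec (P := fun k => (F k : ℝ) ≤ a) (Nat.zero_le (j - 1)) h0
  have hij : i ≤ j - 1 := Nat.findGreatest_le _
  refine ⟨i, j, by omega, hjn, his, hjs, fun k h1 h2 => ⟨?_, hlt k h2⟩⟩
  exact not_le.1 (Nat.findGreatest_is_greatest (P := fun k => (F k : ℝ) ≤ a) h1 (by omega))

/-- Crossing a long enough piece of an axis at height `T` takes a word of length more than `Λ T`.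
Hence a word geodesic of length `n` that crosses it comes `n / Λ`-close to it, up to
an additive constant. -/
theorem ContractingAxis.exists_progress (hax : ContractingAxis φ o f C) (hqi : OrbitQI S o κ)
    (Λ : ℕ) :
    ∃ M₀ : ℝ, 0 < M₀ ∧ ∀ B : ℝ, ∃ T₀ : ℕ, ∀ a b : ℝ, -B ≤ a → b ≤ B → a + M₀ ≤ b →
      ∀ h x y : G, (f (h⁻¹ • x • o) : ℝ) ≤ a → b ≤ f (h⁻¹ • y • o) →
        Subgroup.closure (S : Set G) = ⊤ →
        ∃ w, WordBetween S x w y ∧ a < f (h⁻¹ • w • o) ∧ (f (h⁻¹ • w • o) : ℝ) < b ∧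
          Λ * wordDist S w h ≤ wordDist S x y + T₀ := by
  have hC := hax.one_le
  have hκ := hqi.one_le
  obtain ⟨Q, hQ⟩ := exists_nat_gt (Λ * κ ^ 2)
  have hQ0 : (0 : ℝ) < Q := lt_of_le_of_lt (by positivity) hQ
  have hQ0' : 0 < Q := by exact_mod_cast hQ0
  refine ⟨C * Q + 2 * (C * κ + C) + 1, by positivity, fun B => ?_⟩
  obtain ⟨T₀, hT₀⟩ := exists_nat_gt (Λ * (κ * (κ + C + (C * |B| + C)) + κ))
  refine ⟨T₀, fun a b ha hb hab h x y hx hy hS => ?_⟩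
  obtain ⟨z, hz0, hzn, hz⟩ := exists_wordGeodesic hS x y
  set n := wordDist S x y with hn
  set F : ℕ → ℤ := fun j => f (h⁻¹ • z j • o) with hF
  have hstep : ∀ i j, i ≤ j → j ≤ n → dist (z i • o) (z j • o) ≤ κ * ((j : ℝ) - i) := by
    intro i j hij hj
    have h1 := hqi.dist_le (z i) (z j)
    rw [hz i j hij hj] at h1
    rwa [Nat.cast_sub hij] at h1
  have hF1 : ∀ i, i + 1 ≤ n → |(F i : ℝ) - F (i + 1)| ≤ C * κ + C := by
    intro i hi
    have h1 := hax.lip (h⁻¹ • z i • o) (h⁻¹ • z (i + 1) • o)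
    rw [dist_smul] at h1
    have h2 := hstep i (i + 1) (by omega) hi
    push_cast at h2
    refine h1.trans ?_
    gcongr
    linarith
  have hpos : 0 < C * Q + 2 * (C * κ + C) + 1 := by positivity
  obtain ⟨i, j, hij, hjn, hi, hj, hk⟩ := exists_crossing_window (F := F) (n := n) (a := a) (b := b)
    (by simpa [hF, hz0] using hx) (by simpa [hF, hzn] using hy) (by linarith)
  have hCκ : 0 ≤ C * κ := by positivity
  have hij2 : i + 1 < j := by
    by_contra hcon
    have : j = i + 1 := by omega
    have h1 := hF1 i (by omega)
    rw [← this] at h1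
    have : 0 ≤ C * Q := by positivity
    linarith [(abs_le.1 h1).1]
  set q := n / Q + 1 with hq
  have hQq : n ≤ Q * q := by
    rw [hq]
    have := Nat.lt_mul_div_succ n hQ0'
    exact this.le
  have hqn : (q : ℝ) ≤ n / Q + 1 := by
    rw [hq]
    push_cast
    linarith [Nat.cast_div_le (α := ℝ) (m := n) (n := Q)]
  clear hq
  clear_value q
  by_cases hclose : ∃ k, i < k ∧ k < j ∧ dist (h⁻¹ • z k • o) (φ ^ F k • o) ≤ κ * q + C
  · obtain ⟨k, hik, hkj, hd⟩ := hclose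
    refine ⟨z k, ?_, (hk k hik hkj).1, (hk k hik hkj).2, ?_⟩
    · have h1 := hz 0 k (by omega) (by omega)
      have h2 := hz k n (by omega) le_rfl
      rw [hz0] at h1
      rw [hzn] at h2
      rw [WordBetween]
      omega
    · have hFk : |(F k : ℝ)| ≤ |B| := by
        have := le_abs_self B
        rw [abs_le]
        constructor <;> linarith [(hk k hik hkj).1, (hk k hik hkj).2]
      have h1 := hax.dist_orbit_le (F k) 0
      rw [zpow_zero, one_smul, Int.cast_zero, sub_zero] at h1
      have h2 : dist (z k • o) (h • o) ≤ κ * q + C + (C * |B| + C) := by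
        rw [← dist_smul h⁻¹, inv_smul_smul]
        have h3 := dist_triangle (h⁻¹ • z k • o) (φ ^ F k • o) o
        have h4 : C * |(F k : ℝ)| ≤ C * |B| := by gcongr
        linarith
      have h3 := hqi.wordDist_le (z k) h
      have h4 : κ * q ≤ κ * (n / Q) + κ := by nlinarith
      have h5 : κ * dist (z k • o) (h • o) ≤ κ * (κ * (n / Q) + (κ + C + (C * |B| + C))) := by
        gcongr
        linarith
      have h6 : (wordDist S (z k) h : ℝ)
          ≤ κ ^ 2 * (n / Q) + (κ * (κ + C + (C * |B| + C)) + κ) := by nlinarith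
      have h7 : (Λ : ℝ) * (κ ^ 2 * (n / Q)) ≤ n := by
        have : (Λ : ℝ) * (κ ^ 2 * (n / Q)) = Λ * κ ^ 2 * n / Q := by ring
        rw [this, div_le_iff₀ hQ0]
        have : (0 : ℝ) ≤ n := by positivity
        nlinarith
      have h8 : (Λ : ℝ) * wordDist S (z k) h ≤ n + T₀ := by
        have : (Λ : ℝ) * wordDist S (z k) h
            ≤ Λ * (κ ^ 2 * (n / Q) + (κ * (κ + C + (C * |B| + C)) + κ)) := by gcongr
        nlinarith
      exact_mod_cast h8
  · -- at large height the coordinate moves by at most `C` in every `q` steps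
    exfalso
    push Not at hclose
    set v : ℕ → ℕ := fun l => min (i + 1 + l * q) (j - 1) with hv
    have hvi : ∀ l, i < v l ∧ v l < j := by
      intro l
      simp only [hv]
      constructor
      · rw [lt_min_iff]
        constructor
        · have := Nat.zero_le (l * q)
          omega
        · omega
      · exact (min_le_right _ _).trans_lt (by omega)
    have hmove : ∀ l, |(F (v l) : ℝ) - F (v (l + 1))| ≤ C := by
      intro l
      have h1 := hclose (v l) (hvi l).1 (hvi l).2
      have hmono : v l ≤ v (l + 1) := by
        simp only [hv]
        refine min_le_min_right _ ?_
        rw [Nat.succ_mul]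
        omega
      have hdiff : v (l + 1) ≤ v l + q := by
        simp only [hv, Nat.succ_mul]
        omega
      have h2 := hstep (v l) (v (l + 1)) hmono ((hvi _).2.le.trans hjn)
      have h3 : ((v (l + 1) : ℕ) : ℝ) - v l ≤ q := by
        have : ((v (l + 1) : ℕ) : ℝ) ≤ v l + q := by exact_mod_cast hdiff
        linarith
      have h4 : κ * (((v (l + 1) : ℕ) : ℝ) - v l) ≤ κ * q := by gcongr
      have h5 : 0 ≤ κ * q := by positivity
      refine hax.contract _ _ (by linarith) ?_
      rw [dist_smul]
      linarith
    have hsum : ∀ N : ℕ, (F (v N) : ℝ) - F (v 0) ≤ C * N := by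
      intro N
      induction N with
      | zero => simp
      | succ N ih =>
        have := (abs_le.1 (hmove N)).1
        push_cast
        linarith
    have h1 := hsum Q
    have hv0 : v 0 = i + 1 := by
      simp only [hv]
      omega
    have hvQ : v Q = j - 1 := by
      simp only [hv]
      refine min_eq_right ?_
      omega
    rw [hv0, hvQ] at h1
    have h2 := (abs_le.1 (hF1 i (by omega))).1
    have h3 := hF1 (j - 1) (by omega)
    rw [Nat.sub_add_cancel (by omega)] at h3
    have h4 := (abs_le.1 h3).1
    linarith

end Progress

/-! ### Backtracking of word geodesics -/

section Chain

variable {G : Type*} [Group G] {S : Finset G}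

/-- If a word geodesic from `x` through `y` to `z` returned after `y` across a long chain of
half-spaces that it crossed before `y`, then its passages near the successive walls, traversed
backwards, would be exponentially close in time, and too many walls would be near `y`. -/
theorem mem_right_of_chain (hS : Subgroup.closure (S : Set G) = ⊤) {L R : ℕ → Set G} {α : ℕ → G}
    {N T : ℕ} (hdisj : ∀ i, ∀ z ∈ L i, z ∉ R i)
    (hchain : ∀ i, i + 1 < N → ∀ z, z ∈ R i ∨ z ∈ L (i + 1))
    (hW : ∀ i < N, ∀ x ∈ L i, ∀ y ∈ R i, ∃ w, WordBetween S x w y ∧ w ∉ R i ∧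
      4 * wordDist S w (α i) ≤ wordDist S x y + T)
    (hinj : ∀ i < N, ∀ j < N, α i = α j → i = j) {x y z : G} (hxyz : WordBetween S x y z)
    (hx : ∀ i < N, x ∈ L i) (hy : ∀ i < N, y ∈ R i)
    (hN : Nat.log 2 (wordDist S x z) + ballCard S (2 * T) + 3 ≤ N) : z ∈ R 0 := by
  by_contra hz
  have hzL : ∀ i, i + 1 < N → z ∈ L (i + 1) := by
    intro i
    induction i with
    | zero => exact fun h => (hchain 0 h z).resolve_left hz
    | succ i ih => exact fun h => (hchain (i + 1) h z).resolve_left (hdisj _ _ (ih (by omega)))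
  -- the windows around `y` in which the successive walls are crossed twice
  have hwin : ∀ i, i + 1 < N → ∃ w w', w ∈ L (i + 1) ∧ w' ∈ L (i + 1) ∧ WordBetween S w y w' ∧
      wordDist S w w' ≤ wordDist S x z / 2 ^ i + T := by
    intro i
    induction i with
    | zero => exact fun h => ⟨x, z, hx _ h, hzL 0 h, hxyz, by simp⟩
    | succ i ih =>
      intro h
      obtain ⟨w, w', hw, hw', hb, hd⟩ := ih (by omega)
      obtain ⟨v, hv1, hv2, hv3⟩ := hW (i + 1) (by omega) w hw y (hy _ (by omega))
      obtain ⟨v', hv1', hv2', hv3'⟩ := hW (i + 1) (by omega) w' hw' y (hy _ (by omega))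
      have hb1 : WordBetween S v y w' := hb.tail hS hv1
      have hb2 : WordBetween S v y v' := ((hb1.symm hS).tail hS hv1').symm hS
      refine ⟨v, v', (hchain (i + 1) h v).resolve_left hv2, (hchain (i + 1) h v').resolve_left hv2',
        hb2, ?_⟩
      have e1 := wordDist_triangle hS v (α (i + 1)) v'
      rw [wordDist_comm hS (α (i + 1)) v'] at e1
      have e2 : wordDist S w y + wordDist S y w' = wordDist S w w' := hb
      rw [wordDist_comm hS w' y] at hv3'
      have e3 : wordDist S x z / 2 ^ (i + 1) = wordDist S x z / 2 ^ i / 2 := by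
        rw [pow_succ, Nat.div_div_eq_div_mul]
      omega
  set l := Nat.log 2 (wordDist S x z) with hl
  have hnear : ∀ i, l + 2 ≤ i → i < N → wordDist S y (α i) ≤ 2 * T := by
    intro i hi hiN
    obtain ⟨w, w', hw, hw', hb, hd⟩ := hwin (i - 1) (by omega)
    rw [show i - 1 + 1 = i by omega] at hw hw'
    obtain ⟨v, hv1, hv2, hv3⟩ := hW i hiN w hw y (hy _ hiN)
    have e0 : wordDist S x z / 2 ^ (i - 1) = 0 := by
      refine Nat.div_eq_of_lt ((Nat.lt_pow_succ_log_self (b := 2) (by norm_num) _).trans_le ?_)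
      exact Nat.pow_le_pow_right (n := 2) (by norm_num) (by omega)
    have e1 : wordDist S w y + wordDist S y w' = wordDist S w w' := hb
    have e2 : wordDist S w v + wordDist S v y = wordDist S w y := hv1
    have e3 := wordDist_triangle hS y v (α i)
    rw [wordDist_comm hS y v] at e3
    omega
  have hcard : N - (l + 2) ≤ ballCard S (2 * T) := by
    classical
    have hsub : (((Finset.Ico (l + 2) N).image fun i => y⁻¹ * α i : Finset G) : Set G) ⊆
        wordBall S ((2 * T : ℕ) : ℝ) := by
      intro g hg
      simp only [Finset.coe_image, Set.mem_image, Finset.mem_coe, Finset.mem_Ico] at hg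
      obtain ⟨i, ⟨hi1, hi2⟩, rfl⟩ := hg
      exact mem_wordBall_natCast.2 (hnear i hi1 hi2)
    have := Set.ncard_le_ncard hsub (wordBall_finite hS _)
    rw [Set.ncard_coe_finset, Finset.card_image_of_injOn, Nat.card_Ico] at this
    · exact this
    · intro i hi j hj hij
      simp only [Finset.coe_Ico, Set.mem_Ico] at hi hj
      exact hinj i hi.2 j hj.2 (mul_left_cancel hij)
  omega

/-- A word geodesic through `x`, `u`, `v`, `z` that crosses a long chain of half-spaces between
`u` and `v` crosses the middle one for good. -/
theorem mem_left_and_mem_right_of_chain (hS : Subgroup.closure (S : Set G) = ⊤)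
    {L R : ℕ → Set G} {α : ℕ → G} {N T : ℕ} (hdisj : ∀ i, ∀ z ∈ L i, z ∉ R i)
    (hchain : ∀ i, i < 2 * N → ∀ z, z ∈ R i ∨ z ∈ L (i + 1))
    (hW : ∀ i ≤ 2 * N, ∀ x ∈ L i, ∀ y ∈ R i, ∃ w, WordBetween S x w y ∧ w ∉ L i ∧ w ∉ R i ∧
      4 * wordDist S w (α i) ≤ wordDist S x y + T)
    (hinj : ∀ i ≤ 2 * N, ∀ j ≤ 2 * N, α i = α j → i = j) {x u v z : G}
    (hxv : WordBetween S x u v) (huz : WordBetween S u v z)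
    (hu : ∀ i ≤ 2 * N, u ∈ L i) (hv : ∀ i ≤ 2 * N, v ∈ R i)
    (hN : Nat.log 2 (wordDist S x v) + ballCard S (2 * T) + 2 ≤ N)
    (hN' : Nat.log 2 (wordDist S u z) + ballCard S (2 * T) + 2 ≤ N) : x ∈ L N ∧ z ∈ R N := by
  constructor
  · refine mem_right_of_chain hS (L := fun i => R (N - i)) (R := fun i => L (N - i))
      (α := fun i => α (N - i)) (N := N + 1) (T := T) (fun i w hw hw' => hdisj _ _ hw' hw) ?_ ?_ ?_
      (hxv.symm hS) (fun i _ => hv _ (by omega)) (fun i _ => hu _ (by omega))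
      (by rw [wordDist_comm hS v x]; omega)
    · intro i hi w
      have := hchain (N - (i + 1)) (by omega) w
      rw [show N - (i + 1) + 1 = N - i by omega] at this
      exact this.symm
    · intro i _ y hy w hw
      obtain ⟨b, hb1, hb2, -, hb3⟩ := hW (N - i) (by omega) w hw y hy
      exact ⟨b, hb1.symm hS, hb2, by rwa [wordDist_comm hS y w]⟩
    · intro i hi j hj hij
      have := hinj _ (by omega) _ (by omega) hij
      omega
  · refine mem_right_of_chain hS (L := fun i => L (N + i)) (R := fun i => R (N + i))
      (α := fun i => α (N + i)) (N := N + 1) (T := T) (fun i => hdisj _) ?_ ?_ ?_ huz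
      (fun i _ => hu _ (by omega)) (fun i _ => hv _ (by omega)) (by omega)
    · exact fun i hi w => hchain (N + i) (by omega) w
    · intro i _ y hy w hw
      obtain ⟨b, hb1, -, hb2, hb3⟩ := hW (N + i) (by omega) y hy w hw
      exact ⟨b, hb1, hb2, hb3⟩
    · intro i hi j hj hij
      have := hinj _ (by omega) _ (by omega) hij
      omega

end Chain

/-! ### Combinatorics of records -/

section Combinatorics

/-- If more than `N ^ k` objects are determined by `k` records, then at some stage an object has more
than `N` options for its next record that extend the same previous records, and it can be
chosen to have the option of largest weight. -/
theorem exists_many_options {I T : Type*} [DecidableEq T] (t : T → ℝ) (N k : ℕ) (r : ℕ → I → T)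
    (F : Finset I) (hF : N ^ k < F.card)
    (hinj : ∀ P ∈ F, ∀ Q ∈ F, (∀ j < k, r j P = r j Q) → P = Q) :
    ∃ j < k, ∃ P ∈ F, ∃ O ⊆ F, P ∈ O ∧ N < (O.image (r j)).card ∧
      ∀ Q ∈ O, (∀ i < j, r i Q = r i P) ∧ t (r j Q) ≤ t (r j P) := by
  induction k generalizing r F with
  | zero =>
    exfalso
    rw [pow_zero, Finset.one_lt_card] at hF
    obtain ⟨P, hP, Q, hQ, hne⟩ := hF
    exact hne (hinj P hP Q hQ (by omega))
  | succ k ih =>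
    by_cases hN : N < (F.image (r 0)).card
    · have hne : F.Nonempty := by
        rw [← Finset.card_pos]
        omega
      obtain ⟨P, hP, hmax⟩ := Finset.exists_max_image F (fun P => t (r 0 P)) hne
      exact ⟨0, by omega, P, hP, F, subset_rfl, hP, hN, fun Q hQ => ⟨by omega, hmax Q hQ⟩⟩
    · obtain ⟨τ, -, hτ⟩ := Finset.exists_lt_card_fiber_of_mul_lt_card_of_maps_to
        (s := F) (t := F.image (r 0)) (f := r 0) (n := N ^ k)
        (fun P hP => Finset.mem_image_of_mem _ hP) (by
          refine lt_of_le_of_lt ?_ hF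
          rw [pow_succ, mul_comm]
          exact Nat.mul_le_mul_left _ (not_lt.1 hN))
      obtain ⟨j, hj, P, hP, O, hO, hPO, hcard, hQ⟩ := ih (fun j => r (j + 1))
        (F.filter fun P => r 0 P = τ) hτ (fun P hP Q hQ h => by
          rw [Finset.mem_filter] at hP hQ
          refine hinj P hP.1 Q hQ.1 fun j hj => ?_
          cases j with
          | zero => rw [hP.2, hQ.2]
          | succ j => exact h j (by omega))
      refine ⟨j + 1, by omega, P, (Finset.mem_filter.1 hP).1, O,
        hO.trans (Finset.filter_subset _ _), hPO, hcard, fun Q hQO => ⟨fun i hi => ?_, (hQ Q hQO).2⟩⟩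
      cases i with
      | zero => rw [(Finset.mem_filter.1 (hO hQO)).2, (Finset.mem_filter.1 hP).2]
      | succ i => exact (hQ Q hQO).1 i (by omega)

/-- A finite set with few elements in every window of length `T` contains a long sequence with
gaps larger than `T`, which starts at the maximum. -/
theorem exists_separated_seq {G : Type*} (t : G → ℝ) (T : ℝ) (N m : ℕ) (H : Finset G) (h : G)
    (hh : h ∈ H) (hmax : ∀ a ∈ H, t a ≤ t h)
    (hN : ∀ a ∈ H, ∀ W ⊆ H, (∀ b ∈ W, |t a - t b| ≤ T) → W.card ≤ N) (hcard : N * m < H.card) :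
    ∃ a : ℕ → G, a 0 = h ∧ (∀ i ≤ m, a i ∈ H) ∧ ∀ i < m, t (a (i + 1)) + T < t (a i) := by
  classical
  induction m generalizing H h with
  | zero => exact ⟨fun _ => h, rfl, fun _ _ => hh, by omega⟩
  | succ m ih =>
    obtain ⟨H', hH'⟩ : ∃ H', H' = H.filter fun a => t a + T < t h := ⟨_, rfl⟩
    have h1 : (H.filter fun a => ¬ t a + T < t h).card ≤ N := by
      refine hN h hh _ (Finset.filter_subset _ _) fun b hb => ?_
      rw [Finset.mem_filter, not_lt] at hb
      have := hmax b hb.1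
      rw [abs_le]
      constructor <;> linarith
    have h2 := Finset.card_filter_add_card_filter_not (s := H) (fun a => t a + T < t h)
    have h3 : N * m < H'.card := by
      rw [Nat.mul_succ] at hcard
      rw [hH']
      omega
    have hne : H'.Nonempty := by
      rw [← Finset.card_pos]
      omega
    obtain ⟨h', hh', hmax'⟩ := Finset.exists_max_image H' t hne
    obtain ⟨a, ha0, haH, hat⟩ := ih H' h' hh' hmax'
      (fun a ha W hW hb => hN a (Finset.mem_filter.1 (hH' ▸ ha)).1 W
        (hW.trans (hH' ▸ Finset.filter_subset _ _)) hb) h3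
    refine ⟨fun i => if i = 0 then h else a (i - 1), by simp, ?_, ?_⟩
    · intro i hi
      simp only
      split_ifs with h0
      · exact hh
      · exact (Finset.mem_filter.1 (hH' ▸ haH (i - 1) (by omega))).1
    · intro i hi
      rcases Nat.eq_zero_or_pos i with rfl | h0
      · simp only [zero_add, one_ne_zero, if_false, if_true, Nat.sub_self, ha0]
        rw [hH', Finset.mem_filter] at hh'
        exact hh'.2
      · simp only [show i + 1 ≠ 0 by omega, show i ≠ 0 by omega, if_false, Nat.add_sub_cancel]
        have := hat (i - 1) (by omega)
        rwa [Nat.sub_add_cancel h0] at this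

end Combinatorics

/-! ### Insertion of axis segments -/

section Insertion

variable {G : Type*} [Group G]

/-- The element by which the tail of the sequence `X` from `X j` on is translated after `j`
insertions of `p`: between consecutive pieces `a = (X (j - 1))⁻¹ X j` and `b = (X j)⁻¹ X (j + 1)`,
the word `(s a)⁻¹ p (s' b)` is inserted. -/
def insertTail (s s' : G → G) (p : G) (X : ℕ → G) : ℕ → G
  | 0 => 1
  | j + 1 => insertTail s s' p X j * X (j + 1) * (s ((X j)⁻¹ * X (j + 1)))⁻¹ * p *
      s' ((X (j + 1))⁻¹ * X (j + 2)) * (X (j + 1))⁻¹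

/-- The point at which the `j`-th copy of `p` is inserted into the sequence `X`. -/
def insertHead (s s' : G → G) (p : G) (X : ℕ → G) (j : ℕ) : G :=
  insertTail s s' p X j * X (j + 1) * (s ((X j)⁻¹ * X (j + 1)))⁻¹

variable {s s' : G → G} {p : G} {X Y : ℕ → G} {j : ℕ}

theorem insertTail_succ_mul :
    insertTail s s' p X (j + 1) * X (j + 1) =
      insertHead s s' p X j * p * s' ((X (j + 1))⁻¹ * X (j + 2)) := by
  simp [insertTail, insertHead]

theorem insertTail_mul_succ :
    insertTail s s' p X j * X (j + 1) =
      insertHead s s' p X j * s ((X j)⁻¹ * X (j + 1)) := by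
  simp [insertHead]

theorem insertHead_succ :
    insertHead s s' p X (j + 1) = insertHead s s' p X j * p *
      (s' ((X (j + 1))⁻¹ * X (j + 2)) * ((X (j + 1))⁻¹ * X (j + 2)) *
        (s ((X (j + 1))⁻¹ * X (j + 2)))⁻¹) := by
  rw [insertHead, insertTail]
  simp [insertHead, mul_assoc]

/-- What has to be remembered of the `j`-th insertion in order to undo it. -/
def insertRecord (s s' : G → G) (p : G) (X : ℕ → G) (j : ℕ) : G × G × G :=
  (insertHead s s' p X j, s ((X j)⁻¹ * X (j + 1)), s' ((X (j + 1))⁻¹ * X (j + 2)))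

/-- The records of the first `j` insertions determine the first `j` pieces of the sequence. -/
theorem insertTail_eq_of_insertRecord_eq (h0 : X 0 = Y 0) :
    ∀ j, (∀ i < j, insertRecord s s' p X i = insertRecord s s' p Y i) →
      insertTail s s' p X j = insertTail s s' p Y j ∧ X j = Y j := by
  intro j
  induction j with
  | zero => exact fun _ => ⟨rfl, h0⟩
  | succ j ih =>
    intro h
    obtain ⟨h1, h2⟩ := ih fun i hi => h i (by omega)
    have h3 := h j (by omega)
    simp only [insertRecord, Prod.mk.injEq] at h3
    obtain ⟨h4, h5, h6⟩ := h3
    have e1 := insertTail_mul_succ (s := s) (s' := s') (p := p) (X := X) (j := j)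
    have e2 := insertTail_mul_succ (s := s) (s' := s') (p := p) (X := Y) (j := j)
    have e3 : X (j + 1) = Y (j + 1) := by
      rw [h4, h5, ← e2, h1] at e1
      exact mul_left_cancel e1
    refine ⟨?_, e3⟩
    have e4 := insertTail_succ_mul (s := s) (s' := s') (p := p) (X := X) (j := j)
    have e5 := insertTail_succ_mul (s := s) (s' := s') (p := p) (X := Y) (j := j)
    rw [h4, h6, ← e5, e3] at e4
    exact mul_right_cancel e4

theorem wordNorm_insertTail_mul_le {S : Finset G} (hS : Subgroup.closure (S : Set G) = ⊤) {ρ : ℕ}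
    (hρ : ∀ a b, wordNorm S ((s a)⁻¹ * p * s' b) ≤ ρ) {t : ℕ → ℕ} {K : ℕ} (h0 : X 0 = 1)
    (ht : ∀ i < K, wordDist S (X i) (X (i + 1)) + t i ≤ t (i + 1)) :
    ∀ j ≤ K, wordNorm S (insertTail s s' p X j * X j) ≤ t j + j * ρ := by
  intro j
  induction j with
  | zero => simp [insertTail, h0, wordNorm_one]
  | succ j ih =>
    intro hj
    have h1 := ih (by omega)
    have h2 := ht j (by omega)
    rw [insertTail_succ_mul, insertHead, show insertTail s s' p X j * X (j + 1) *
      (s ((X j)⁻¹ * X (j + 1)))⁻¹ * p * s' ((X (j + 1))⁻¹ * X (j + 2)) =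
      insertTail s s' p X j * X j * (((X j)⁻¹ * X (j + 1)) * ((s ((X j)⁻¹ * X (j + 1)))⁻¹ * p *
        s' ((X (j + 1))⁻¹ * X (j + 2)))) by group]
    have h3 := wordNorm_mul_le hS (insertTail s s' p X j * X j)
      (((X j)⁻¹ * X (j + 1)) * ((s ((X j)⁻¹ * X (j + 1)))⁻¹ * p *
        s' ((X (j + 1))⁻¹ * X (j + 2))))
    have h4 := wordNorm_mul_le hS ((X j)⁻¹ * X (j + 1)) ((s ((X j)⁻¹ * X (j + 1)))⁻¹ * p *
        s' ((X (j + 1))⁻¹ * X (j + 2)))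
    have h5 := hρ ((X j)⁻¹ * X (j + 1)) ((X (j + 1))⁻¹ * X (j + 2))
    rw [wordDist] at h2
    rw [Nat.succ_mul]
    omega

end Insertion

section InsertionHalfSpace

variable {G X : Type*} [Group G] [MetricSpace X] [MulAction G X] [IsIsometricSMul G X]
  {φ : G} {o : X} {f : X → ℤ} {C c r : ℝ} {s s' : G → G}

/-- For each `a`, the element `(s' a) a (s a)⁻¹` joins the ends of two axis segments as
`ContractingAxis.precedes_mul` requires, and `s a`, `s' a` displace `o` by at most `r`. -/
structure IsConnecting (o : X) (f : X → ℤ) (C c r : ℝ) (s s' : G → G) : Prop where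
  nonneg : 0 ≤ c
  left : ∀ a, |(f ((s' a * a * (s a)⁻¹) • o) : ℝ)| ≤ c
  right : ∀ a, |(f ((s' a * a * (s a)⁻¹)⁻¹ • o) : ℝ)| ≤ c
  far : ∀ a, 2 * C + 2 * (C * (c + C + C + 1) + C) < dist o ((s' a * a * (s a)⁻¹) • o)
  dist_left : ∀ a, dist o (s' a • o) ≤ r
  dist_right : ∀ a, dist o (s a • o) ≤ r

theorem IsConnecting.precedes (hX : IsGeodesicSpace X) (hax : ContractingAxis φ o f C)
    (hs : IsConnecting o f C c r s s') (M : ℕ) (Y : ℕ → G) {m : ℝ} (hm : c + 3 * C + 1 ≤ m)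
    (j : ℕ) : Precedes f M m (insertHead s s' (φ ^ M) Y j) (insertHead s s' (φ ^ M) Y (j + 1)) := by
  rw [insertHead_succ]
  exact (hax.precedes_mul hX hs.nonneg (hs.left _) (hs.right _) (hs.far _) M _).mono hm

/-- The part of the sequence before the `j`-th insertion is to the left of the inserted segment. -/
theorem IsConnecting.inLeft (hax : ContractingAxis φ o f C) (hs : IsConnecting o f C c r s s')
    (p : G) (Y : ℕ → G) {m : ℝ} (hm : c + C * r + 2 * C ≤ m) (j : ℕ) :
    InLeft f m (insertHead s s' p Y j) ((insertTail s s' p Y j * Y j) • o) := by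
  have hC := hax.one_le
  set a := (Y j)⁻¹ * Y (j + 1) with ha
  rw [InLeft]
  have e : (insertHead s s' p Y j)⁻¹ • (insertTail s s' p Y j * Y j) • o =
      (s' a * a * (s a)⁻¹)⁻¹ • s' a • o := by
    rw [smul_smul, smul_smul, insertHead, ← ha]
    congr 1
    rw [ha]
    group
  rw [e]
  have h1 := hax.lip ((s' a * a * (s a)⁻¹)⁻¹ • o) ((s' a * a * (s a)⁻¹)⁻¹ • s' a • o)
  rw [dist_smul] at h1
  have h2 : C * dist o (s' a • o) ≤ C * r := by
    have := hs.dist_left a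
    gcongr
  linarith [(abs_le.1 h1).1, (abs_le.1 (hs.right a)).2]

/-- The piece that follows the `j`-th insertion ends to the right of the inserted segment. -/
theorem IsConnecting.inRight (hax : ContractingAxis φ o f C) (hs : IsConnecting o f C c r s s')
    (M : ℕ) (Y : ℕ → G) {m : ℝ} (hm : c + C * r + 2 * C ≤ m) (j : ℕ) :
    InRight f M m (insertHead s s' (φ ^ M) Y j)
      ((insertTail s s' (φ ^ M) Y (j + 1) * Y (j + 2)) • o) := by
  have hC := hax.one_le
  set a := (Y (j + 1))⁻¹ * Y (j + 2) with ha
  rw [InRight]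
  have e : (insertHead s s' (φ ^ M) Y j)⁻¹ • (insertTail s s' (φ ^ M) Y (j + 1) * Y (j + 2)) • o =
      φ ^ (M : ℤ) • (s' a * a * (s a)⁻¹) • s a • o := by
    rw [smul_smul, smul_smul, smul_smul, zpow_natCast]
    congr 1
    rw [show insertTail s s' (φ ^ M) Y (j + 1) * Y (j + 2) =
      insertTail s s' (φ ^ M) Y (j + 1) * Y (j + 1) * a by rw [ha]; group, insertTail_succ_mul, ← ha]
    group
  rw [e]
  have h0 := hax.shift M ((s' a * a * (s a)⁻¹) • s a • o)
  have h1 := hax.lip ((s' a * a * (s a)⁻¹) • o) ((s' a * a * (s a)⁻¹) • s a • o)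
  rw [dist_smul] at h1
  have h2 : C * dist o (s a • o) ≤ C * r := by
    have := hs.dist_right a
    gcongr
  push_cast at h0
  linarith [(abs_le.1 h1).2, (abs_le.1 (hs.left a)).1, (abs_le.1 h0).1]

/-- After the insertions, the element crosses each of the inserted segments. -/
theorem IsConnecting.inLeft_one_and_inRight (hX : IsGeodesicSpace X)
    (hax : ContractingAxis φ o f C) (hs : IsConnecting o f C c r s s') {M : ℕ} {Y : ℕ → G} {m : ℝ}
    (hm : c + 3 * C + 1 ≤ m) (hm' : c + C * r + 2 * C ≤ m) (hM : 2 * m < M) (h0 : Y 0 = 1) {k : ℕ} :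
    ∀ j ≤ k, InLeft f m (insertHead s s' (φ ^ M) Y j) o ∧
      InRight f M m (insertHead s s' (φ ^ M) Y j)
        ((insertTail s s' (φ ^ M) Y (k + 1) * Y (k + 2)) • o) := by
  intro j hj
  constructor
  · clear hj
    induction j with
    | zero =>
      have := hs.inLeft hax (φ ^ M) Y hm' 0
      rwa [insertTail, h0, one_mul, one_smul] at this
    | succ j ih => exact (hs.precedes hX hax M Y hm j).inLeft hM ih
  · induction hj using Nat.decreasingInduction with
    | self => exact hs.inRight hax M Y hm' k
    | of_succ j _ ih => exact (hs.precedes hX hax M Y hm j).inRight hM ih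

theorem ContractingAxis.exists_isConnecting (hax : ContractingAxis φ o f C) {u : G} (hc : 0 ≤ c)
    (hu : ∀ y : X, |(f y : ℝ)| ≤ c ∨ |(f (u • y) : ℝ)| ≤ c) :
    ∃ (E : Finset G) (r : ℝ) (s s' : G → G), IsConnecting o f C c r s s' ∧
      (∀ a, s a ∈ E) ∧ ∀ a, s' a ∈ E := by
  obtain ⟨E, hE⟩ := hax.exists_connectors hu (2 * C + 2 * (C * (c + C + C + 1) + C))
  choose s' hs' s hs h1 h2 h3 using hE
  have hr : ∀ e ∈ E, dist o (e • o) ≤ ∑ e ∈ E, dist o (e • o) := fun e he =>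
    Finset.single_le_sum (f := fun e => dist o (e • o)) (fun _ _ => dist_nonneg) he
  exact ⟨E, ∑ e ∈ E, dist o (e • o), s, s', ⟨hc, h1, h2, h3, fun a => hr _ (hs' a),
    fun a => hr _ (hs a)⟩, hs, hs'⟩

end InsertionHalfSpace

/-! ### Barriers -/

section Barrier

variable {G X : Type*} [Group G] [MetricSpace X] [MulAction G X]

/-- A barrier of `g` in the window `[lo, hi]`: a segment at `α` crossed by `g`, and a point `b` on
a word geodesic from `1` to `g`, at a time in the window, that is close to `α`. -/
def HasBarrier (o : X) (f : X → ℤ) (M : ℕ) (m : ℝ) (S : Finset G) (Λ T lo hi : ℕ) (g : G) : Prop :=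
  ∃ α b : G, InLeft f m α o ∧ InRight f M m α (g • o) ∧ WordBetween S 1 b g ∧
    lo ≤ wordNorm S b ∧ wordNorm S b ≤ hi ∧ Λ * wordDist S b α ≤ wordNorm S g + T

/-- The ordering of the segments crossed by a pair of points that
`ContractingAxis.exists_precedes_of_crossing` provides. -/
def CrossingOrder (G : Type*) {X : Type*} [Group G] [MetricSpace X] [MulAction G X] (o : X)
    (f : X → ℤ) (M : ℕ) (m m₁ r T B : ℝ) : Prop :=
  ∀ (x y : X) (h h' : G),
    InLeft f m h x → InRight f M m h y → InLeft f m h' x → InRight f M m h' y →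
    (dist x (h • o) + T < dist x (h' • o) → Precedes f M m₁ h h' ∧
      ∀ s : G, dist o (s • o) ≤ r → InRight f M m₁ h ((h' * s) • o)) ∧
    (|dist x (h • o) - dist x (h' • o)| ≤ T → dist (h • o) (h' • o) ≤ B)

variable {o : X} {f : X → ℤ} {M : ℕ} {m m₁ r T B κ : ℝ} {S : Finset G}

/-- Only boundedly many segments crossed by a pair of points are at about the same distance from the
first point. -/
theorem CrossingOrder.card_le (hcr : CrossingOrder G o f M m m₁ r T B) (hqi : OrbitQI S o κ)
    (hS : Subgroup.closure (S : Set G) = ⊤) {x y : X} {W : Finset G} {a : G}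
    (ha : InLeft f m a x ∧ InRight f M m a y) (hW : ∀ b ∈ W, InLeft f m b x ∧ InRight f M m b y)
    (hd : ∀ b ∈ W, |dist x (a • o) - dist x (b • o)| ≤ T) :
    W.card ≤ ballCard S ⌈κ * B + κ⌉₊ := by
  classical
  have hκ := hqi.one_le
  have hsub : ((W.image fun b => a⁻¹ * b : Finset G) : Set G) ⊆
      wordBall S ((⌈κ * B + κ⌉₊ : ℕ) : ℝ) := by
    intro g hg
    simp only [Finset.coe_image, Set.mem_image, Finset.mem_coe] at hg
    obtain ⟨b, hb, rfl⟩ := hg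
    have h1 := (hcr x y a b ha.1 ha.2 (hW b hb).1 (hW b hb).2).2 (hd b hb)
    have h2 := hqi.wordDist_le a b
    refine mem_wordBall_natCast.2 ?_
    have h3 : (wordDist S a b : ℝ) ≤ κ * B + κ := h2.trans (by gcongr)
    exact_mod_cast h3.trans (Nat.le_ceil _)
  have := Set.ncard_le_ncard hsub (wordBall_finite hS _)
  rwa [Set.ncard_coe_finset, Finset.card_image_of_injective _ (mul_right_injective _)] at this

/-- Let `P` be the farthest of many segments crossed by a pair of points, all of which have
`τ u` on their left, and let `τ v` be close to `P`. Then there is a barrier between `u` and `v`: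
many of the segments form a chain between `τ u` and `τ v`, and the middle one of them is crossed
by every word geodesic that passes through `u` and `v`. -/
theorem CrossingOrder.hasBarrier (hcr : CrossingOrder G o f M m m₁ r T B) (hqi : OrbitQI S o κ)
    (hS : Subgroup.closure (S : Set G) = ⊤) (hT : 0 < T) (hm : m ≤ m₁) (hM : 2 * m₁ < M)
    {Λ T₀ : ℕ} (hΛ : 4 ≤ Λ)
    (hpr : ∀ h x y : G, InLeft f m₁ h (x • o) → InRight f M m₁ h (y • o) →
      ∃ w, WordBetween S x w y ∧ ¬ InLeft f m₁ h (w • o) ∧ ¬ InRight f M m₁ h (w • o) ∧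
        Λ * wordDist S w h ≤ wordDist S x y + T₀)
    {y : X} {H : Finset G} (hH : ∀ h ∈ H, InLeft f m h o ∧ InRight f M m h y) {P : G}
    (hP : P ∈ H) (hmax : ∀ h ∈ H, dist o (h • o) ≤ dist o (P • o)) {τ u v g s : G}
    (hu : ∀ h ∈ H, InLeft f m h ((τ * u) • o)) (hv : τ * v = P * s) (hs : dist o (s • o) ≤ r)
    (huv : WordBetween S 1 u v) (hvg : WordBetween S 1 v g) {N : ℕ}
    (hN : Nat.log 2 (wordNorm S g) + ballCard S (2 * T₀) + 2 ≤ N)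
    (hcard : ballCard S ⌈κ * B + κ⌉₊ * (2 * N + 1) < H.card) :
    HasBarrier o f M m₁ S Λ T₀ (wordNorm S u) (wordNorm S v) g := by
  obtain ⟨a, ha0, haH, hat⟩ := exists_separated_seq (fun h : G => dist o (h • o)) T
    (ballCard S ⌈κ * B + κ⌉₊) (2 * N + 1) H P hP hmax
    (fun a ha W hW hd => hcr.card_le hqi hS (hH a ha) (fun b hb => hH b (hW hb)) hd) hcard
  have hanti : ∀ i j, i < j → j ≤ 2 * N + 1 → dist o (a j • o) + T < dist o (a i • o) := by
    intro i j hij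
    induction hij with
    | refl => exact fun h => hat i (by omega)
    | @step j _ ih =>
      intro h
      have h1 := ih (by omega)
      have h2 := hat j (by omega)
      linarith
  -- the chain, in the order of increasing distance and without `P` itself
  obtain ⟨α, hα⟩ : ∃ α : ℕ → G, ∀ i, τ * α i = a (2 * N + 1 - i) :=
    ⟨fun i => τ⁻¹ * a (2 * N + 1 - i), fun i => by simp⟩
  have hL : ∀ i x, InLeft f m₁ (α i) (x • o) ↔ InLeft f m₁ (a (2 * N + 1 - i)) ((τ * x) • o) := by
    intro i x
    rw [← hα, mul_smul, inLeft_mul]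
  have hR : ∀ i x, InRight f M m₁ (α i) (x • o) ↔
      InRight f M m₁ (a (2 * N + 1 - i)) ((τ * x) • o) := by
    intro i x
    rw [← hα, mul_smul, inRight_mul]
  have hvg' : WordBetween S u v g := hvg.tail hS huv
  have e1 : wordDist S 1 u + wordDist S u v = wordDist S 1 v := huv
  have e2 : wordDist S u v + wordDist S v g = wordDist S u g := hvg'
  have e3 : wordDist S 1 v + wordDist S v g = wordDist S 1 g := hvg
  rw [wordDist_one_left] at e1 e3
  rw [wordDist_one_left] at e1 e3
  have hlog : ∀ d, d ≤ wordNorm S g → Nat.log 2 d + ballCard S (2 * T₀) + 2 ≤ N := by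
    intro d hd
    have := Nat.log_mono_right (b := 2) hd
    omega
  have hu' : ∀ i ≤ 2 * N, InLeft f m₁ (α i) (u • o) := fun i _ =>
    (hL i u).2 ((hu _ (haH _ (by omega))).mono hm)
  have hv' : ∀ i ≤ 2 * N, InRight f M m₁ (α i) (v • o) := by
    intro i hi
    rw [hR, hv]
    have h1 := hanti 0 (2 * N + 1 - i) (by omega) (by omega)
    rw [ha0] at h1
    obtain ⟨h2, h3⟩ := hH _ (haH (2 * N + 1 - i) (by omega))
    exact ((hcr o y _ P h2 h3 (hH P hP).1 (hH P hP).2).1 h1).2 s hs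
  obtain ⟨h1, h2⟩ := mem_left_and_mem_right_of_chain hS
    (L := fun i => {x | InLeft f m₁ (α i) (x • o)}) (R := fun i => {x | InRight f M m₁ (α i) (x • o)})
    (α := α) (N := N) (T := T₀) (x := 1) (u := u) (v := v) (z := g)
    (fun i z hz => hz.not_inRight hM)
    (by
      intro i hi z
      simp only [Set.mem_ofPred_eq]
      rw [hL, hR]
      obtain ⟨h2, h3⟩ := hH _ (haH (2 * N + 1 - i) (by omega))
      obtain ⟨h4, h5⟩ := hH _ (haH (2 * N + 1 - (i + 1)) (by omega))
      exact ((hcr o y _ _ h2 h3 h4 h5).1 (hanti _ _ (by omega) (by omega))).1 _)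
    (by
      intro i _ x hx y hy
      obtain ⟨w, hw1, hw2, hw3, hw4⟩ := hpr (α i) x y hx hy
      refine ⟨w, hw1, hw2, hw3, le_trans ?_ hw4⟩
      exact Nat.mul_le_mul_right _ hΛ)
    (by
      intro i hi j hj hij
      have h3 : a (2 * N + 1 - i) = a (2 * N + 1 - j) := by rw [← hα, ← hα, hij]
      by_contra hne
      rcases Nat.lt_or_gt_of_ne hne with h | h
      · have := hanti (2 * N + 1 - j) (2 * N + 1 - i) (by omega) (by omega)
        rw [h3] at this
        linarith
      · have := hanti (2 * N + 1 - i) (2 * N + 1 - j) (by omega) (by omega)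
        rw [h3] at this
        linarith)
    huv hvg' hu' hv' (hlog _ (by rw [wordDist_one_left]; omega)) (hlog _ (by omega))
  obtain ⟨b, hb1, -, -, hb2⟩ := hpr (α N) u v (hu' N (by omega)) (hv' N (by omega))
  have hbv : WordBetween S 1 b v := ((huv.symm hS).trans_left hS (hb1.symm hS)).symm hS
  have hub : WordBetween S 1 u b := ((huv.symm hS).tail hS (hb1.symm hS)).symm hS
  have e4 : wordDist S 1 b + wordDist S b v = wordDist S 1 v := hbv
  have e5 : wordDist S 1 u + wordDist S u b = wordDist S 1 b := hub
  rw [wordDist_one_left, wordDist_one_left] at e4 e5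
  refine ⟨α N, b, ?_, h2, hvg.trans_left hS hbv, by omega, by omega, by omega⟩
  simpa using h1

end Barrier

/-! ### Counting elements without barriers -/

section Counting

variable {G : Type*} [Group G]

/-- Up to a bounded factor, the number of records is the number of positions of the insertion. -/
theorem card_image_insertRecord_le {I : Type*} [DecidableEq G] {s s' : G → G} {E : Finset G}
    (hs : ∀ a, s a ∈ E) (hs' : ∀ a, s' a ∈ E) (p : G) (Y : I → ℕ → G) (j : ℕ) (O : Finset I) :
    (O.image fun P => insertRecord s s' p (Y P) j).card ≤
      (O.image fun P => insertHead s s' p (Y P) j).card * (E.card * E.card) := by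
  rw [← Finset.card_product E E, ← Finset.card_product]
  refine Finset.card_le_card fun x hx => ?_
  obtain ⟨P, hP, rfl⟩ := Finset.mem_image.1 hx
  simp only [insertRecord, Finset.mem_product]
  exact ⟨Finset.mem_image_of_mem (fun P => insertHead s s' p (Y P) j) hP, hs _, hs' _⟩

variable {X : Type*} [MetricSpace X] [MulAction G X] [IsIsometricSMul G X]
  {φ : G} {o : X} {f : X → ℤ} {M : ℕ} {C c m m₁ r T B κ : ℝ} {S : Finset G} {s s' : G → G}

/-- Few sequences without barriers have the same element as the result of their insertions. If
there were many, then at some stage there would be many options for the next insertion after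
the same previous ones, hence a barrier by `CrossingOrder.hasBarrier`. -/
theorem CrossingOrder.card_le_of_not_hasBarrier (hcr : CrossingOrder G o f M m m₁ r T B)
    (hqi : OrbitQI S o κ) (hS : Subgroup.closure (S : Set G) = ⊤) (hX : IsGeodesicSpace X)
    (hax : ContractingAxis φ o f C) (hs : IsConnecting o f C c r s s') {E : Finset G}
    (hsE : ∀ a, s a ∈ E) (hsE' : ∀ a, s' a ∈ E) (hT : 0 < T) (hm : c + 3 * C + 1 ≤ m)
    (hm' : c + C * r + 2 * C ≤ m) (hm₁ : m ≤ m₁) (hM : 2 * m₁ < M) {Λ T₀ : ℕ} (hΛ : 4 ≤ Λ)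
    (hpr : ∀ h x y : G, InLeft f m₁ h (x • o) → InRight f M m₁ h (y • o) →
      ∃ w, WordBetween S x w y ∧ ¬ InLeft f m₁ h (w • o) ∧ ¬ InRight f M m₁ h (w • o) ∧
        Λ * wordDist S w h ≤ wordDist S x y + T₀)
    {I : Type*} {F : Finset I} {Y : I → ℕ → G} {k n l N : ℕ} {y : G}
    (h0 : ∀ P, Y P 0 = 1)
    (hy : ∀ P ∈ F, insertTail s s' (φ ^ M) (Y P) (k + 1) * Y P (k + 2) = y)
    (hgeo : ∀ P ∈ F, ∀ j ≤ k, WordBetween S 1 (Y P j) (Y P (j + 1)) ∧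
      WordBetween S 1 (Y P (j + 1)) (Y P (k + 2)))
    (hn : ∀ P ∈ F, wordNorm S (Y P (k + 2)) = n)
    (hdet : ∀ P ∈ F, ∀ Q ∈ F, (∀ j ≤ k + 2, Y P j = Y Q j) → P = Q)
    (hnb : ∀ P ∈ F, ∀ j < k, ¬ HasBarrier o f M m₁ S Λ T₀ (wordNorm S (Y P (j + 1)))
      (wordNorm S (Y P (j + 2))) (Y P (k + 2)))
    (hl : ∀ P ∈ F, dist o (insertHead s s' (φ ^ M) (Y P) 0 • o) < l * T)
    (hN : Nat.log 2 n + ballCard S (2 * T₀) + 2 ≤ N) :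
    F.card ≤ (ballCard S ⌈κ * B + κ⌉₊ * l * (E.card * E.card)) *
      (ballCard S ⌈κ * B + κ⌉₊ * (2 * N + 1) * (E.card * E.card)) ^ k := by
  classical
  obtain ⟨N₁, hN₁⟩ : ∃ N₁, N₁ = ballCard S ⌈κ * B + κ⌉₊ := ⟨_, rfl⟩
  rw [← hN₁]
  have hcross : ∀ P ∈ F, ∀ j ≤ k, InLeft f m (insertHead s s' (φ ^ M) (Y P) j) o ∧
      InRight f M m (insertHead s s' (φ ^ M) (Y P) j) (y • o) := by
    intro P hP
    rw [← hy P hP]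
    exact hs.inLeft_one_and_inRight hX hax hm hm' (by linarith) (h0 P)
  by_contra hcon
  push Not at hcon
  have himg : ∀ O ⊆ F, ∀ j, ∀ q, N₁ * q * (E.card * E.card) <
      (O.image fun P => insertRecord s s' (φ ^ M) (Y P) j).card →
        N₁ * q < (O.image fun P => insertHead s s' (φ ^ M) (Y P) j).card := by
    intro O _ j q hq
    exact Nat.lt_of_mul_lt_mul_right (hq.trans_le
      (card_image_insertRecord_le hsE hsE' (φ ^ M) Y j O))
  -- there are not many options for the first insertion, which takes place at bounded distance
  have hfirst : (F.image fun P => insertRecord s s' (φ ^ M) (Y P) 0).card ≤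
      N₁ * l * (E.card * E.card) := by
    by_contra hlt
    have hlt' := himg F subset_rfl 0 l (not_le.1 hlt)
    have hH : ∀ h ∈ F.image fun P => insertHead s s' (φ ^ M) (Y P) 0,
        (InLeft f m h o ∧ InRight f M m h (y • o)) ∧ dist o (h • o) < l * T := by
      intro h hh
      obtain ⟨P, hP, rfl⟩ := Finset.mem_image.1 hh
      exact ⟨hcross P hP 0 (Nat.zero_le _), hl P hP⟩
    obtain ⟨h, hh, hmax⟩ := Finset.exists_max_image _ (fun h : G => dist o (h • o))
      (Finset.card_pos.1 (Nat.zero_lt_of_lt hlt'))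
    obtain ⟨a, ha0, haH, hat⟩ := exists_separated_seq (fun h : G => dist o (h • o)) T N₁ l _ h hh
      hmax (fun a ha W hW hd => hN₁ ▸ hcr.card_le hqi hS (hH a ha).1 (fun b hb => (hH b (hW hb)).1)
        hd) hlt'
    have hdec : ∀ i ≤ l, dist o (a i • o) + i * T ≤ dist o (a 0 • o) := by
      intro i
      induction i with
      | zero => simp
      | succ i ih =>
        intro hi
        have h1 := ih (by omega)
        have h2 := hat i (by omega)
        push_cast
        linarith
    have h1 := hdec l le_rfl
    have h2 := (hH h hh).2
    rw [ha0] at h1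
    linarith [dist_nonneg (x := o) (y := a l • o)]
  obtain ⟨ρ, -, hρ⟩ := Finset.exists_lt_card_fiber_of_mul_lt_card_of_maps_to
    (s := F) (t := F.image fun P => insertRecord s s' (φ ^ M) (Y P) 0)
    (f := fun P => insertRecord s s' (φ ^ M) (Y P) 0)
    (n := (N₁ * (2 * N + 1) * (E.card * E.card)) ^ k)
    (fun P hP => Finset.mem_image_of_mem (fun P => insertRecord s s' (φ ^ M) (Y P) 0) hP)
    (lt_of_le_of_lt (Nat.mul_le_mul_right _ hfirst) hcon)
  obtain ⟨j, hj, P, hP, O, hO, hPO, hcard, hQ⟩ := exists_many_options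
    (fun R : G × G × G => dist o (R.1 • o)) (N₁ * (2 * N + 1) * (E.card * E.card)) k
    (fun j P => insertRecord s s' (φ ^ M) (Y P) (j + 1)) _ hρ (by
      intro P hP Q hQ hPQ
      rw [Finset.mem_filter] at hP hQ
      have hrec : ∀ i < k + 1, insertRecord s s' (φ ^ M) (Y P) i =
          insertRecord s s' (φ ^ M) (Y Q) i := by
        intro i hi
        cases i with
        | zero => rw [hP.2, hQ.2]
        | succ i => exact hPQ i (by omega)
      refine hdet P hP.1 Q hQ.1 fun i hi => ?_
      have key := fun i (hi : i ≤ k + 1) => insertTail_eq_of_insertRecord_eq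
        (s := s) (s' := s') (p := φ ^ M) (X := Y P) (Y := Y Q) (by rw [h0, h0]) i
        (fun i' hi' => hrec i' (by omega))
      rcases Nat.lt_or_ge i (k + 2) with h | h
      · exact (key i (by omega)).2
      · obtain rfl : i = k + 2 := by omega
        have h1 := hy P hP.1
        rw [← hy Q hQ.1, (key (k + 1) le_rfl).1] at h1
        exact mul_left_cancel h1)
  have hOF : O ⊆ F := hO.trans (Finset.filter_subset _ _)
  have hPF := hOF hPO
  have hmany := himg O hOF (j + 1) (2 * N + 1) hcard
  have hsame : ∀ Q ∈ O, insertTail s s' (φ ^ M) (Y Q) (j + 1) = insertTail s s' (φ ^ M) (Y P) (j + 1) ∧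
      Y Q (j + 1) = Y P (j + 1) := by
    intro Q hQO
    refine insertTail_eq_of_insertRecord_eq (by rw [h0, h0]) (j + 1) fun i hi => ?_
    cases i with
    | zero => rw [(Finset.mem_filter.1 (hO hQO)).2, (Finset.mem_filter.1 (hO hPO)).2]
    | succ i => exact (hQ Q hQO).1 i (by omega)
  refine hnb P hPF j hj ?_
  have hM' : 2 * m₁ < M := hM
  refine hcr.hasBarrier hqi hS hT hm₁ hM hΛ hpr (y := y • o)
    (H := O.image fun P => insertHead s s' (φ ^ M) (Y P) (j + 1))
    (P := insertHead s s' (φ ^ M) (Y P) (j + 1)) (τ := insertTail s s' (φ ^ M) (Y P) (j + 1))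
    (u := Y P (j + 1)) (v := Y P (j + 2)) (N := N) ?_
    (Finset.mem_image_of_mem (fun P => insertHead s s' (φ ^ M) (Y P) (j + 1)) hPO) ?_ ?_
    insertTail_mul_succ (hs.dist_right _) (hgeo P hPF (j + 1) (by omega)).1
    (hgeo P hPF (j + 1) (by omega)).2 (by rwa [hn P hPF]) (hN₁ ▸ hmany)
  · intro h hh
    obtain ⟨Q, hQO, rfl⟩ := Finset.mem_image.1 hh
    exact hcross Q (hOF hQO) (j + 1) (by omega)
  · intro h hh
    obtain ⟨Q, hQO, rfl⟩ := Finset.mem_image.1 hh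
    exact (hQ Q hQO).2
  · intro h hh
    obtain ⟨Q, hQO, rfl⟩ := Finset.mem_image.1 hh
    have := hs.inLeft hax (φ ^ M) (Y Q) hm' (j + 1)
    rwa [(hsame Q hQO).1, (hsame Q hQO).2] at this

/-- Cutting times: one in each of `k + 1` consecutive windows of length `w` that start at `lo`. -/
theorem exists_times {k n lo w : ℕ} (h : lo + (k + 1) * w ≤ n) :
    ∃ t : (Fin (k + 1) → Fin w) → ℕ → ℕ, (∀ θ, t θ 0 = 0) ∧ (∀ θ, t θ (k + 2) = n) ∧
      (∀ θ, ∀ j ≤ k + 1, t θ j ≤ t θ (j + 1) ∧ t θ (j + 1) ≤ n) ∧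
      (∀ θ, ∀ j < k + 1, lo ≤ t θ (j + 1) ∧ t θ (j + 1) ≤ lo + (k + 1) * w) ∧
      ∀ θ θ', (∀ j < k + 1, t θ (j + 1) = t θ' (j + 1)) → θ = θ' := by
  have key : ∀ (θ : Fin (k + 1) → Fin w) (j : ℕ) (hj : j < k + 1),
      lo + j * w + θ ⟨j, hj⟩ < lo + (j + 1) * w ∧ lo + (j + 1) * w ≤ lo + (k + 1) * w := by
    intro θ j hj
    have h1 := (θ ⟨j, hj⟩).2
    have h2 : (j + 1) * w ≤ (k + 1) * w := Nat.mul_le_mul_right _ hj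
    rw [Nat.succ_mul] at h2 ⊢
    omega
  refine ⟨fun θ j => if j = 0 then 0 else
    if h : j - 1 < k + 1 then lo + (j - 1) * w + θ ⟨j - 1, h⟩ else n, ?_, ?_, ?_, ?_, ?_⟩
  · simp
  · simp
  · intro θ j hj
    simp only [Nat.add_eq_zero_iff, one_ne_zero, and_false, if_false, Nat.add_sub_cancel]
    rcases Nat.lt_or_ge j (k + 1) with h1 | h1
    · have h2 := key θ j h1
      rw [dif_pos h1]
      refine ⟨?_, by omega⟩
      rcases Nat.eq_zero_or_pos j with rfl | h0
      · simp
      · have h3 := key θ (j - 1) (by omega)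
        have hj0 : j ≠ 0 := by omega
        have hj1 : j - 1 < k + 1 := by omega
        rw [if_neg hj0, dif_pos hj1]
        rw [Nat.sub_add_cancel h0] at h3
        omega
    · have hj0 : j ≠ 0 := by omega
      have hj1 : j - 1 < k + 1 := by omega
      rw [dif_neg (not_lt.2 h1), if_neg hj0, dif_pos hj1]
      have h3 := key θ (j - 1) (by omega)
      omega
  · intro θ j hj
    simp only [Nat.add_eq_zero_iff, one_ne_zero, and_false, if_false, Nat.add_sub_cancel]
    have h2 := key θ j hj
    rw [dif_pos hj]
    omega
  · intro θ θ' hθ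
    funext i
    have h1 := hθ i i.2
    simp only [Nat.add_eq_zero_iff, one_ne_zero, and_false, if_false, Nat.add_sub_cancel] at h1
    rw [dif_pos i.2, dif_pos i.2] at h1
    exact Fin.ext (Nat.add_left_cancel h1)

end Counting

section BarrierCount

variable {G : Type*} [Group G] {X : Type*} [MulAction G X]
  {φ : G} {o : X} {f : X → ℤ} {M : ℕ} {C c m m₁ r T B κ : ℝ} {S : Finset G} {s s' : G → G}

theorem HasBarrier.mono {Λ T₀ lo hi lo' hi' : ℕ} {g : G}
    (h : HasBarrier o f M m S Λ T₀ lo hi g) (hlo : lo' ≤ lo) (hhi : hi ≤ hi') :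
    HasBarrier o f M m S Λ T₀ lo' hi' g := by
  obtain ⟨α, b, h1, h2, h3, h4, h5, h6⟩ := h
  exact ⟨α, b, h1, h2, h3, hlo.trans h4, h5.trans hhi, h6⟩

variable [MetricSpace X] [IsIsometricSMul G X]

/-- Inserting `k + 1` segments in all possible ways into the elements of length `n` without barriers
produces elements of length at most `n + O(1)`, each of them only a few times. -/
theorem CrossingOrder.exists_card_mul_pow_le (hcr : CrossingOrder G o f M m m₁ r T B)
    (hqi : OrbitQI S o κ) (hS : Subgroup.closure (S : Set G) = ⊤) (hX : IsGeodesicSpace X)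
    (hax : ContractingAxis φ o f C) (hs : IsConnecting o f C c r s s') {E : Finset G}
    (hsE : ∀ a, s a ∈ E) (hsE' : ∀ a, s' a ∈ E) (hT : 0 < T) (hm : c + 3 * C + 1 ≤ m)
    (hm' : c + C * r + 2 * C ≤ m) (hm₁ : m ≤ m₁) (hM : 2 * m₁ < M) {Λ T₀ : ℕ} (hΛ : 4 ≤ Λ)
    (hpr : ∀ h x y : G, InLeft f m₁ h (x • o) → InRight f M m₁ h (y • o) →
      ∃ w, WordBetween S x w y ∧ ¬ InLeft f m₁ h (w • o) ∧ ¬ InRight f M m₁ h (w • o) ∧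
        Λ * wordDist S w h ≤ wordDist S x y + T₀) (k : ℕ) :
    ∃ A : ℕ, ∀ n lo w : ℕ, lo + (k + 1) * w ≤ n →
      {g | wordNorm S g = n ∧ ¬ HasBarrier o f M m₁ S Λ T₀ lo (lo + (k + 1) * w) g}.ncard *
        w ^ (k + 1) ≤ A * (n + 1) * (Nat.log 2 n + 1) ^ k * ballCard S n := by
  classical
  have hκ := hqi.one_le
  obtain ⟨ρ, hρ⟩ : ∃ ρ, ∀ a b, wordNorm S ((s a)⁻¹ * φ ^ M * s' b) ≤ ρ :=
    ⟨(E ×ˢ E).sup fun x => wordNorm S (x.1⁻¹ * φ ^ M * x.2), fun a b =>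
      Finset.le_sup (f := fun x : G × G => wordNorm S (x.1⁻¹ * φ ^ M * x.2))
        (Finset.mem_product.2 ⟨hsE a, hsE' b⟩ : (s a, s' b) ∈ E ×ˢ E)⟩
  have hr0 : 0 ≤ r := dist_nonneg.trans (hs.dist_left 1)
  obtain ⟨l, hl⟩ := exists_nat_gt ((κ + r) / T)
  rw [div_lt_iff₀ hT] at hl
  obtain ⟨N₁, hN₁⟩ : ∃ N₁, N₁ = ballCard S ⌈κ * B + κ⌉₊ := ⟨_, rfl⟩
  set b₀ := ballCard S (2 * T₀) + 2 with hb₀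
  refine ⟨(N₁ * l * (E.card * E.card)) * (N₁ * (2 * b₀ + 2) * (E.card * E.card)) ^ k *
    ballCard S ((k + 1) * ρ), fun n lo w hw => ?_⟩
  obtain ⟨t, ht0, htn, htm, htw, htinj⟩ := exists_times hw
  have hfin : {g | wordNorm S g = n ∧
      ¬ HasBarrier o f M m₁ S Λ T₀ lo (lo + (k + 1) * w) g}.Finite := by
    refine (wordBall_finite hS (n : ℝ)).subset fun g hg => ?_
    exact mem_wordBall_natCast.2 hg.1.le
  choose z hz0 hzn hz using fun g : G => exists_wordGeodesic hS 1 g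
  simp only [wordDist_one_left] at hzn hz
  obtain ⟨Y, hY⟩ : ∃ Y : G × (Fin (k + 1) → Fin w) → ℕ → G, ∀ P j, Y P j = z P.1 (t P.2 j) :=
    ⟨fun P j => z P.1 (t P.2 j), fun _ _ => rfl⟩
  set J := hfin.toFinset ×ˢ (Finset.univ : Finset (Fin (k + 1) → Fin w)) with hJ
  have hJ' : ∀ P ∈ J, wordNorm S P.1 = n ∧
      ¬ HasBarrier o f M m₁ S Λ T₀ lo (lo + (k + 1) * w) P.1 := by
    intro P hP
    rw [hJ, Finset.mem_product, Set.Finite.mem_toFinset] at hP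
    exact hP.1
  have hY0 : ∀ P, Y P 0 = 1 := fun P => by rw [hY, ht0, hz0]
  have hYn : ∀ P ∈ J, Y P (k + 2) = P.1 := fun P hP => by rw [hY, htn, ← (hJ' P hP).1, hzn]
  have htle : ∀ θ, ∀ j ≤ k + 2, t θ j ≤ n := by
    intro θ j hj
    cases j with
    | zero => rw [ht0]; omega
    | succ j => exact (htm θ j (by omega)).2
  have hYnorm : ∀ P ∈ J, ∀ j ≤ k + 2, wordNorm S (Y P j) = t P.2 j := by
    intro P hP j hj
    have h1 := hz P.1 0 (t P.2 j) (by omega) (by rw [(hJ' P hP).1]; exact htle _ j hj)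
    rw [hz0, wordDist_one_left] at h1
    rw [hY, h1, Nat.sub_zero]
  have hYd : ∀ P ∈ J, ∀ i j, t P.2 i ≤ t P.2 j → j ≤ k + 2 →
      wordDist S (Y P i) (Y P j) = t P.2 j - t P.2 i := by
    intro P hP i j hij hj
    rw [hY, hY, hz P.1 _ _ hij (by rw [(hJ' P hP).1]; exact htle _ j hj)]
  set Φ : G × (Fin (k + 1) → Fin w) → G := fun P =>
    insertTail s s' (φ ^ M) (Y P) (k + 1) * Y P (k + 2) with hΦ
  have hfib : ∀ y ∈ J.image Φ, (J.filter fun P => Φ P = y).card ≤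
      (N₁ * (l * (n + 1)) * (E.card * E.card)) *
        (N₁ * (2 * (Nat.log 2 n + b₀) + 1) * (E.card * E.card)) ^ k := by
    intro y _
    rw [hN₁]
    have hmem : ∀ P ∈ J.filter (fun P => Φ P = y), P ∈ J := fun P hP => (Finset.mem_filter.1 hP).1
    refine hcr.card_le_of_not_hasBarrier hqi hS hX hax hs hsE hsE' hT hm hm' hm₁ hM hΛ hpr
      (Y := Y) (n := n) (y := y) hY0 (fun P hP => (Finset.mem_filter.1 hP).2) ?_ ?_ ?_ ?_ ?_ ?_
    · intro P hP j hj
      have hPJ := hmem P hP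
      have h1 := (htm P.2 j (by omega)).1
      have h2 := htle P.2 (j + 1) (by omega)
      have h3 := htn P.2
      constructor
      · rw [WordBetween, wordDist_one_left, wordDist_one_left, hYnorm P hPJ j (by omega),
          hYnorm P hPJ (j + 1) (by omega), hYd P hPJ _ _ h1 (by omega)]
        omega
      · rw [WordBetween, wordDist_one_left, wordDist_one_left, hYnorm P hPJ (j + 1) (by omega),
          hYnorm P hPJ (k + 2) le_rfl, hYd P hPJ _ _ (by omega) le_rfl]
        omega
    · intro P hP
      rw [hYn P (hmem P hP), (hJ' P (hmem P hP)).1]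
    · intro P hP Q hQ hPQ
      refine Prod.ext ?_ (htinj _ _ fun j hj => ?_)
      · rw [← hYn P (hmem P hP), ← hYn Q (hmem Q hQ), hPQ _ le_rfl]
      · rw [← hYnorm P (hmem P hP) _ (by omega), ← hYnorm Q (hmem Q hQ) _ (by omega),
          hPQ _ (by omega)]
    · intro P hP j hj hbar
      have hPJ := hmem P hP
      rw [hYn P hPJ, hYnorm P hPJ _ (by omega), hYnorm P hPJ _ (by omega)] at hbar
      exact (hJ' P hPJ).2 (hbar.mono (htw P.2 j (by omega)).1 (htw P.2 (j + 1) (by omega)).2)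
    · intro P hP
      have hPJ := hmem P hP
      rw [insertHead, insertTail, one_mul, mul_smul]
      have h1 := hqi.dist_le 1 (Y P (0 + 1))
      rw [wordDist_one_left, one_smul, hYnorm P hPJ _ (by omega)] at h1
      have h2 : (t P.2 (0 + 1) : ℝ) ≤ n := by exact_mod_cast htle P.2 _ (by omega)
      have h3 := dist_triangle o (Y P (0 + 1) • o)
        (Y P (0 + 1) • (s ((Y P 0)⁻¹ * Y P (0 + 1)))⁻¹ • o)
      rw [dist_smul] at h3
      have h4 := hs.dist_right ((Y P 0)⁻¹ * Y P (0 + 1))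
      rw [← dist_smul (s ((Y P 0)⁻¹ * Y P (0 + 1)))⁻¹, inv_smul_smul, dist_comm] at h4
      have h5 : κ * (t P.2 (0 + 1) : ℝ) ≤ κ * n := by gcongr
      have h6 : 0 ≤ r * n := by positivity
      push_cast
      nlinarith
    · omega
  have himg : (J.image Φ).card ≤ ballCard S n * ballCard S ((k + 1) * ρ) := by
    refine le_trans ?_ (ballCard_add_le hS _ _)
    have hsub : ((J.image Φ : Finset G) : Set G) ⊆ wordBall S ((n + (k + 1) * ρ : ℕ) : ℝ) := by
      intro g hg
      obtain ⟨P, hP, rfl⟩ := Finset.mem_image.1 (Finset.mem_coe.1 hg)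
      refine mem_wordBall_natCast.2 ?_
      have h1 := wordNorm_insertTail_mul_le hS (s := s) (s' := s') (p := φ ^ M) (X := Y P) hρ
        (t := t P.2) (K := k + 1) (hY0 P) (fun i hi => by
          have h2 := (htm P.2 i (by omega)).1
          rw [hYd P hP _ _ h2 (by omega)]
          omega) (k + 1) le_rfl
      have h2 : t P.2 (k + 1) ≤ t P.2 (k + 2) := (htm P.2 (k + 1) le_rfl).1
      have h3 := hYd P hP (k + 1) (k + 2) h2 le_rfl
      have h4 := htn P.2
      rw [wordDist] at h3
      simp only [hΦ]
      have h5 := wordNorm_mul_le hS (insertTail s s' (φ ^ M) (Y P) (k + 1) * Y P (k + 1))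
        ((Y P (k + 1))⁻¹ * Y P (k + 2))
      rw [mul_assoc, mul_inv_cancel_left] at h5
      omega
    have := Set.ncard_le_ncard hsub (wordBall_finite hS _)
    rwa [Set.ncard_coe_finset] at this
  have hcard : J.card = {g | wordNorm S g = n ∧
      ¬ HasBarrier o f M m₁ S Λ T₀ lo (lo + (k + 1) * w) g}.ncard * w ^ (k + 1) := by
    rw [hJ, Finset.card_product, Set.ncard_eq_toFinset_card _ hfin, Finset.card_univ]
    simp
  rw [← hcard]
  refine (Finset.card_le_mul_card_image J _ hfib).trans ((Nat.mul_le_mul_left _ himg).trans ?_)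
  have hpow : (N₁ * (2 * (Nat.log 2 n + b₀) + 1) * (E.card * E.card)) ^ k ≤
      (N₁ * (2 * b₀ + 2) * (E.card * E.card)) ^ k * (Nat.log 2 n + 1) ^ k := by
    rw [← mul_pow]
    refine Nat.pow_le_pow_left ?_ _
    have h1 : 2 * (Nat.log 2 n + b₀) + 1 ≤ (2 * b₀ + 2) * (Nat.log 2 n + 1) := by nlinarith
    calc N₁ * (2 * (Nat.log 2 n + b₀) + 1) * (E.card * E.card)
        ≤ N₁ * ((2 * b₀ + 2) * (Nat.log 2 n + 1)) * (E.card * E.card) := by gcongr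
      _ = _ := by ring
  calc N₁ * (l * (n + 1)) * (E.card * E.card) *
        (N₁ * (2 * (Nat.log 2 n + b₀) + 1) * (E.card * E.card)) ^ k *
        (ballCard S n * ballCard S ((k + 1) * ρ))
      ≤ N₁ * (l * (n + 1)) * (E.card * E.card) *
        ((N₁ * (2 * b₀ + 2) * (E.card * E.card)) ^ k * (Nat.log 2 n + 1) ^ k) *
        (ballCard S n * ballCard S ((k + 1) * ρ)) := by gcongr
    _ = _ := by ring

/-- Most elements have barriers. The margin `m₁` of the barriers does not depend on how close to them
the geodesics are required to pass. -/
theorem ContractingAxis.exists_card_not_hasBarrier_le (hX : IsGeodesicSpace X)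
    (hax : ContractingAxis φ o f C) (hqi : OrbitQI S o κ)
    (hS : Subgroup.closure (S : Set G) = ⊤) {u : G} (hc : 0 ≤ c)
    (hu : ∀ y : X, |(f y : ℝ)| ≤ c ∨ |(f (u • y) : ℝ)| ≤ c) :
    ∃ m₁ : ℝ, 0 ≤ m₁ ∧ ∀ Λ : ℕ, 4 ≤ Λ → ∃ M₁ : ℝ, ∀ M : ℕ, M₁ ≤ M → ∃ T₀ : ℕ, ∀ k : ℕ, ∃ A : ℕ,
      ∀ n lo w : ℕ, lo + (k + 1) * w ≤ n →
        {g | wordNorm S g = n ∧ ¬ HasBarrier o f M m₁ S Λ T₀ lo (lo + (k + 1) * w) g}.ncard *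
          w ^ (k + 1) ≤ A * (n + 1) * (Nat.log 2 n + 1) ^ k * ballCard S n := by
  have hC := hax.one_le
  obtain ⟨E, r, s, s', hs, hsE, hsE'⟩ := hax.exists_isConnecting hc hu
  have hr0 : 0 ≤ r := dist_nonneg.trans (hs.dist_left 1)
  set m := (c + 3 * C + 1) + (c + C * r + 2 * C) with hmdef
  have hm1 : 0 ≤ c + 3 * C + 1 := by positivity
  have hm2 : 0 ≤ c + C * r + 2 * C := by positivity
  obtain ⟨m₁, hm₁, hcr⟩ := hax.exists_precedes_of_crossing hX (by positivity : 0 ≤ m) r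
  have hm0 : 0 ≤ m₁ := le_trans (by positivity) hm₁
  refine ⟨m₁, hm0, fun Λ hΛ => ?_⟩
  obtain ⟨M₀, hM₀, hpr⟩ := hax.exists_progress hqi Λ
  refine ⟨2 * m₁ + M₀, fun M hM => ?_⟩
  obtain ⟨T₀, hT₀⟩ := hpr (M + m₁)
  obtain ⟨T, B, hT, hcr⟩ := hcr M (by linarith)
  refine ⟨T₀, fun k => ?_⟩
  have hcr' : CrossingOrder G o f M m m₁ r T B := hcr
  refine hcr'.exists_card_mul_pow_le hqi hS hX hax hs hsE hsE' hT (by linarith) (by linarith) hm₁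
    (by linarith) hΛ (fun h x y hx hy => ?_) k
  have hM0 : (0 : ℝ) ≤ M := Nat.cast_nonneg M
  obtain ⟨w, hw1, hw2, hw3, hw4⟩ := hT₀ m₁ (M - m₁) (by linarith) (by linarith) (by linarith) h x y
    hx hy hS
  exact ⟨w, hw1, not_le.2 hw2, not_le.2 hw3, hw4⟩

end BarrierCount

/-! ### Lengths of words that cross a chain of half-spaces -/

section ChainLength

variable {G : Type*} [Group G] {S : Finset G}

/-- A word geodesic that crosses a chain of half-spaces has a sequence of points in the successive
gaps, each of which is as close to its wall as the position of its two neighbours implies: take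
the sequence whose points are closest to the walls in total. -/
theorem exists_tight_chain (hS : Subgroup.closure (S : Set G) = ⊤) {L R : ℕ → Set G} {η : ℕ → G}
    {N Λ T : ℕ} (hchain : ∀ i, ∀ z, z ∈ R i ∨ z ∈ L (i + 1))
    (hW : ∀ i, ∀ x ∈ L i, ∀ y ∈ R i, ∃ w, WordBetween S x w y ∧ w ∉ L i ∧ w ∉ R i ∧
      Λ * wordDist S w (η i) ≤ wordDist S x y + T) {x y : G} (hx : x ∈ L 0)
    (hy : ∀ i < N, y ∈ R i) :
    ∃ z : ℕ → G, z 0 = x ∧ z (N + 1) = y ∧ (∀ i ≤ N, WordBetween S x (z i) (z (i + 1))) ∧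
      ∀ i < N, Λ * wordDist S (z (i + 1)) (η i) ≤ wordDist S (z i) (z (i + 2)) + T := by
  classical
  obtain ⟨V, hV⟩ : ∃ V : (ℕ → G) → Prop, ∀ z, V z ↔ (z 0 = x ∧ z (N + 1) = y ∧
      (∀ i ≤ N, WordBetween S x (z i) (z (i + 1))) ∧
      ∀ i < N, z (i + 1) ∉ L i ∧ z (i + 1) ∉ R i) := ⟨_, fun _ => Iff.rfl⟩
  have hex : ∃ z, V z := by
    have key : ∀ j ≤ N, ∃ z : ℕ → G, z 0 = x ∧ (∀ i < j, WordBetween S x (z i) (z (i + 1))) ∧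
        WordBetween S x (z j) y ∧ z j ∈ L j ∧ ∀ i < j, z (i + 1) ∉ L i ∧ z (i + 1) ∉ R i := by
      intro j
      induction j with
      | zero => exact fun _ => ⟨fun _ => x, rfl, by simp, wordBetween_left _ _, hx, by simp⟩
      | succ j ih =>
        intro hj
        obtain ⟨z, hz0, hz1, hz2, hz3, hz4⟩ := ih (by omega)
        obtain ⟨w, hw1, hw2, hw3, -⟩ := hW j (z j) hz3 y (hy j (by omega))
        have hw4 : WordBetween S x w y := ((hz2.symm hS).trans_left hS (hw1.symm hS)).symm hS
        have hw5 : WordBetween S x (z j) w := ((hz2.symm hS).tail hS (hw1.symm hS)).symm hS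
        refine ⟨Function.update z (j + 1) w, ?_, ?_, ?_, ?_, ?_⟩
        · rwa [Function.update_of_ne (by omega)]
        · intro i hi
          rw [Function.update_of_ne (by omega)]
          rcases Nat.lt_or_ge i j with h | h
          · rw [Function.update_of_ne (by omega)]
            exact hz1 i h
          · obtain rfl : i = j := by omega
            rwa [Function.update_self]
        · rwa [Function.update_self]
        · rw [Function.update_self]
          exact (hchain j w).resolve_left hw3
        · intro i hi
          rcases Nat.lt_or_ge i j with h | h
          · rw [Function.update_of_ne (by omega)]
            exact hz4 i h
          · obtain rfl : i = j := by omega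
            rw [Function.update_self]
            exact ⟨hw2, hw3⟩
    obtain ⟨z, hz0, hz1, hz2, -, hz4⟩ := key N le_rfl
    refine ⟨Function.update z (N + 1) y, (hV _).2 ⟨?_, ?_, ?_, ?_⟩⟩
    · rwa [Function.update_of_ne (by omega)]
    · rw [Function.update_self]
    · intro i hi
      rw [Function.update_of_ne (by omega)]
      rcases Nat.lt_or_ge i N with h | h
      · rw [Function.update_of_ne (by omega)]
        exact hz1 i h
      · obtain rfl : i = N := by omega
        rwa [Function.update_self]
    · intro i hi
      rw [Function.update_of_ne (by omega)]
      exact hz4 i hi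
  obtain ⟨W, hW'⟩ : ∃ W : (ℕ → G) → ℕ, ∀ z, W z =
    ∑ i ∈ Finset.range N, wordDist S (z (i + 1)) (η i) := ⟨_, fun _ => rfl⟩
  obtain ⟨z, hz, hmin⟩ : ∃ z, V z ∧ ∀ z', V z' → W z ≤ W z' := by
    have hne : ∃ v, ∃ z, V z ∧ W z = v := by
      obtain ⟨z, hz⟩ := hex
      exact ⟨_, z, hz, rfl⟩
    obtain ⟨z, hz, hzv⟩ := Nat.find_spec hne
    exact ⟨z, hz, fun z' hz' => hzv ▸ Nat.find_min' hne ⟨z', hz', rfl⟩⟩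
  obtain ⟨hz0, hzN, hz1, hz2⟩ := (hV z).1 hz
  refine ⟨z, hz0, hzN, hz1, fun i hi => ?_⟩
  by_contra hlt
  push Not at hlt
  have hL : z i ∈ L i := by
    cases i with
    | zero => rwa [hz0]
    | succ i => exact (hchain i _).resolve_left (hz2 i (by omega)).2
  have hR : z (i + 2) ∈ R i := by
    rcases Nat.lt_or_ge (i + 1) N with h | h
    · exact (hchain i _).resolve_right (hz2 (i + 1) h).1
    · obtain rfl : N = i + 1 := by omega
      rw [hzN]
      exact hy i hi
  obtain ⟨w, hw1, hw2, hw3, hw4⟩ := hW i _ hL _ hR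
  have hb : WordBetween S x (z i) (z (i + 2)) :=
    (hz1 (i + 1) (by omega)).trans_left hS (hz1 i (by omega))
  have hw5 : WordBetween S x w (z (i + 2)) := ((hb.symm hS).trans_left hS (hw1.symm hS)).symm hS
  have hw6 : WordBetween S x (z i) w := ((hb.symm hS).tail hS (hw1.symm hS)).symm hS
  refine absurd (hmin (Function.update z (i + 1) w) ((hV _).2 ⟨?_, ?_, ?_, ?_⟩)) (not_le.2 ?_)
  · rwa [Function.update_of_ne (by omega)]
  · rwa [Function.update_of_ne (by omega)]
  · intro j hj
    rcases eq_or_ne j (i + 1) with rfl | h1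
    · rw [Function.update_self, Function.update_of_ne (by omega)]
      exact hw5
    · rw [Function.update_of_ne h1]
      rcases eq_or_ne j i with rfl | h2
      · rwa [Function.update_self]
      · rw [Function.update_of_ne (by omega)]
        exact hz1 j hj
  · intro j hj
    rcases eq_or_ne j i with rfl | h2
    · rw [Function.update_self]
      exact ⟨hw2, hw3⟩
    · rw [Function.update_of_ne (by omega)]
      exact hz2 j hj
  · have hlt' : wordDist S w (η i) < wordDist S (z (i + 1)) (η i) :=
      Nat.lt_of_mul_lt_mul_left (hw4.trans_lt hlt)
    rw [hW', hW']
    refine Finset.sum_lt_sum (fun j _ => ?_) ⟨i, Finset.mem_range.2 hi, ?_⟩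
    · rcases eq_or_ne j i with rfl | h2
      · rw [Function.update_self]
        exact hlt'.le
      · rw [Function.update_of_ne (by omega)]
    · rwa [Function.update_self]

/-- A word that crosses `N + 1` walls at distances at least `E` from each other has length at least
`N E`, up to an error that is small if geodesics pass close to the walls. -/
theorem mul_le_wordDist_of_chain (hS : Subgroup.closure (S : Set G) = ⊤) {L R : ℕ → Set G}
    {η : ℕ → G} {N Λ T E E' n : ℕ} (hchain : ∀ i, ∀ z, z ∈ R i ∨ z ∈ L (i + 1))
    (hW : ∀ i, ∀ x ∈ L i, ∀ y ∈ R i, ∃ w, WordBetween S x w y ∧ w ∉ L i ∧ w ∉ R i ∧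
      Λ * wordDist S w (η i) ≤ wordDist S x y + T) {x y : G} (hx : x ∈ L 0)
    (hy : ∀ i < N + 1, y ∈ R i) (hxη : wordDist S x (η 0) ≤ n) (hηy : wordDist S (η N) y ≤ n)
    (hη : ∀ i, E' ≤ wordDist S (η i) (η (i + 1)) ∧ wordDist S (η i) (η (i + 1)) ≤ n)
    (hE : ∀ t, Λ * t ≤ 2 * t + (2 * n + T) → E + 2 * t ≤ E') : N * E ≤ wordDist S x y := by
  obtain ⟨z, hz0, hzN, hz1, hz2⟩ := exists_tight_chain hS hchain hW hx hy
  obtain ⟨i₀, hi₀, hmax⟩ := Finset.exists_max_image (Finset.range (N + 1))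
    (fun i => wordDist S (z (i + 1)) (η i)) ⟨0, by simp⟩
  rw [Finset.mem_range] at hi₀
  set t := wordDist S (z (i₀ + 1)) (η i₀) with ht
  have hmax' : ∀ i < N + 1, wordDist S (z (i + 1)) (η i) ≤ t := fun i hi =>
    hmax i (Finset.mem_range.2 hi)
  have h1 : wordDist S (z i₀) (η i₀) ≤ t + n := by
    rcases Nat.eq_zero_or_pos i₀ with h | h
    · rw [h, hz0]
      omega
    · obtain ⟨j, rfl⟩ : ∃ j, i₀ = j + 1 := ⟨i₀ - 1, by omega⟩
      have e1 := wordDist_triangle hS (z (j + 1)) (η j) (η (j + 1))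
      have e2 := hmax' j (by omega)
      have e3 := (hη j).2
      omega
  have h2 : wordDist S (η i₀) (z (i₀ + 2)) ≤ t + n := by
    rcases Nat.lt_or_ge i₀ N with h | h
    · have e1 := wordDist_triangle hS (η i₀) (η (i₀ + 1)) (z (i₀ + 2))
      have e2 : wordDist S (z (i₀ + 2)) (η (i₀ + 1)) ≤ t := hmax' (i₀ + 1) (by omega)
      have e3 := (hη i₀).2
      rw [wordDist_comm hS] at e2
      omega
    · obtain rfl : N = i₀ := by omega
      rw [hzN]
      omega
  have h3 := wordDist_triangle hS (z i₀) (η i₀) (z (i₀ + 2))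
  have h4 := hE t (by
    have e1 := hz2 i₀ hi₀
    rw [← ht] at e1
    omega)
  have key : ∀ j ≤ N, j * E ≤ wordDist S x (z (j + 1)) := by
    intro j
    induction j with
    | zero => simp
    | succ j ih =>
      intro hj
      have e1 := ih (by omega)
      have e2 : wordDist S x (z (j + 1)) + wordDist S (z (j + 1)) (z (j + 2)) =
        wordDist S x (z (j + 2)) := hz1 (j + 1) (by omega)
      have e3 := hmax' j (by omega)
      have e4 : wordDist S (z (j + 2)) (η (j + 1)) ≤ t := hmax' (j + 1) (by omega)
      have e5 := wordDist_triangle hS (η j) (z (j + 1)) (η (j + 1))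
      have e6 := wordDist_triangle hS (z (j + 1)) (z (j + 2)) (η (j + 1))
      have e7 := (hη j).1
      rw [wordDist_comm hS (η j) (z (j + 1))] at e5
      rw [Nat.succ_mul]
      change _ ≤ wordDist S x (z (j + 2))
      omega
  have h5 := key N le_rfl
  have h6 : wordDist S x (z (N + 1)) + wordDist S (z (N + 1)) (z (N + 2)) =
    wordDist S x (z (N + 2)) := hz1 (N + 1) le_rfl
  rw [hzN] at h6
  omega

end ChainLength

/-! ### Contraction from a chain of half-spaces -/

section Contraction

variable {X : Type*} [MetricSpace X]

/-- A point `y` closer to `x` than the sequence `a` does not project much further along `a` than `x`: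
otherwise the geodesic from `x` to `y` would pass close to a point `a l` in between, and `y` would
be close to it. -/
theorem le_add_of_isNearest {L R : ℤ → Set X} {a : ℤ → X} {ρ : ℝ} {J : ℤ}
    (hsep : ∀ l, ∀ x ∈ L l, ∀ y ∈ R l, dist x (a l) + dist (a l) y ≤ dist x y + ρ)
    (hcover : ∀ l x, x ∈ R l ∨ x ∈ L (l + 1)) (hL : ∀ i l, i < l → a i ∈ L l)
    (hR : ∀ i l, l < i → a i ∈ R l) (hJ : ∀ i j, dist (a i) (a j) ≤ 2 * ρ → j - i ≤ J)
    (hρ : 0 ≤ ρ) {x y : X} {i j : ℤ} (hx : ∀ l, dist x (a i) ≤ dist x (a l))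
    (hy : ∀ l, dist y (a j) ≤ dist y (a l)) (hxy : dist x y < dist x (a i)) :
    j ≤ i + 2 * J + 3 := by
  have hJ0 : 0 ≤ J := by simpa using hJ i i (by rw [dist_self]; positivity)
  by_contra hlt
  push Not at hlt
  have hxL : x ∈ L (i + J + 2) := by
    rw [show i + J + 2 = (i + J + 1) + 1 by ring]
    refine (hcover _ x).resolve_left fun h => ?_
    have h1 := hsep _ _ (hL i (i + J + 1) (by omega)) _ h
    have h2 := hx (i + J + 1)
    rw [dist_comm (a (i + J + 1)) x, dist_comm (a i) x] at h1
    have := hJ i (i + J + 1) (by linarith)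
    omega
  have hyR : y ∈ R (i + J + 2) := by
    refine (hcover _ y).resolve_right fun h => ?_
    have h1 := hsep _ _ h _ (hR j (i + J + 2 + 1) (by omega))
    have h2 := hy (i + J + 2 + 1)
    have := hJ (i + J + 2 + 1) j (by linarith)
    omega
  have h1 := hsep _ _ hxL _ hyR
  have h2 := hx (i + J + 2)
  have h3 := hy (i + J + 2)
  rw [dist_comm (a (i + J + 2)) y] at h1
  have h4 := dist_triangle_left (a (i + J + 2)) (a j) y
  have := hJ (i + J + 2) j (by linarith)
  omega

/-- A quasi-geodesic each point of which separates a half-space that contains the preceding points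
from one that contains the following points, so that geodesics between them pass close to the
point, is strongly contracting. -/
theorem exists_isStronglyContractingSet {L R : ℤ → Set X} {a : ℤ → X} {ρ K : ℝ}
    (hsep : ∀ l, ∀ x ∈ L l, ∀ y ∈ R l, dist x (a l) + dist (a l) y ≤ dist x y + ρ)
    (hcover : ∀ l x, x ∈ R l ∨ x ∈ L (l + 1)) (hL : ∀ i l, i < l → a i ∈ L l)
    (hR : ∀ i l, l < i → a i ∈ R l) (hρ : 0 ≤ ρ) (hK : 0 < K) (ha : IsQuasiGeodesic K a) :
    ∃ K', 0 < K' ∧ IsQuasiGeodesic K' a ∧ IsStronglyContractingSet K' (Set.range a) := by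
  obtain ⟨J, hJ⟩ := exists_nat_gt (K * (2 * ρ + K))
  have hJ' : ∀ i j, dist (a i) (a j) ≤ 2 * ρ → |i - j| ≤ (J : ℤ) := by
    intro i j hij
    have h1 := ha.abs_sub_le hK i j
    have h2 : K * (dist (a i) (a j) + K) ≤ K * (2 * ρ + K) := by gcongr
    have h3 : |(i : ℝ) - j| ≤ (J : ℝ) := by linarith
    exact_mod_cast h3
  have hnear : ∀ x i, a i ∈ nearestPointProj (Set.range a) x →
      dist x (a i) = Metric.infDist x (Set.range a) ∧ ∀ l, dist x (a i) ≤ dist x (a l) := by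
    intro x i hi
    exact ⟨hi.2, fun l => hi.2.le.trans (Metric.infDist_le_dist_of_mem ⟨l, rfl⟩)⟩
  have key : ∀ x y i j, a i ∈ nearestPointProj (Set.range a) x →
      a j ∈ nearestPointProj (Set.range a) y → dist x y < dist x (a i) → |i - j| ≤ 2 * J + 3 := by
    intro x y i j hi hj hxy
    have h1 := le_add_of_isNearest (J := J) hsep hcover hL hR
      (fun i j h => by have := abs_le.1 (hJ' i j h); omega) hρ (hnear x i hi).2 (hnear y j hj).2 hxy
    have h2 := le_add_of_isNearest (L := fun l => R (-l)) (R := fun l => L (-l))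
      (a := fun l => a (-l)) (ρ := ρ) (J := J) (x := x) (y := y) (i := -i) (j := -j)
      (fun l x hx y hy => by
        have := hsep (-l) y hy x hx
        rw [dist_comm x, dist_comm (a (-l)) y, dist_comm x y]
        rw [dist_comm y (a (-l))] at this
        rw [dist_comm y (a (-l))]
        linarith)
      (fun l x => by
        have := hcover (-(l + 1)) x
        rw [show -(l + 1) + 1 = -l by ring] at this
        exact this.symm)
      (fun i l h => hR _ _ (by omega)) (fun i l h => hL _ _ (by omega))
      (fun i j h => by have := abs_le.1 (hJ' _ _ h); omega) hρ
      (by simpa using fun l => (hnear x i hi).2 (-l)) (by simpa using fun l => (hnear y j hj).2 (-l))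
      (by simpa using hxy)
    rw [abs_le]
    omega
  set K' := max K (K * (4 * J + 6) + K) with hK'
  refine ⟨K', lt_max_of_lt_left hK, ha.mono hK (le_max_left _ _), ?_⟩
  intro x _ y hy z hz p hp q hq
  obtain ⟨i, hi⟩ := ha.exists_mem_nearestPointProj hK x
  obtain ⟨j, rfl⟩ := hp.1
  obtain ⟨l, rfl⟩ := hq.1
  rw [Metric.mem_ball, dist_comm, ← (hnear x i hi).1] at hy hz
  have h1 := key x y i j hi hp hy
  have h2 := key x z i l hi hq hz
  have h3 : |(j : ℝ) - l| ≤ 4 * J + 6 := by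
    have : |j - l| ≤ 4 * J + 6 := by
      rw [abs_le] at h1 h2 ⊢
      omega
    exact_mod_cast this
  have h4 : K * |(j : ℝ) - l| ≤ K * (4 * J + 6) := by gcongr
  exact ((ha j l).2.trans (by linarith)).trans (le_max_right _ _)

end Contraction

/-! ### Elements that translate a segment past itself -/

section Translate

variable {G X : Type*} [Group G] [MulAction G X] {f : X → ℤ} {M : ℕ} {m : ℝ} {o : X} {g α : G}

theorem Precedes.zpow (hp : Precedes f M m α (g * α)) (i : ℤ) :
    Precedes f M m (g ^ i * α) (g ^ (i + 1) * α) := by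
  have := hp.mul_left (g ^ i)
  rwa [← mul_assoc, ← zpow_add_one] at this

theorem Precedes.inLeft_zpow (hp : Precedes f M m α (g * α)) (hM : 2 * m < M)
    (hL : InLeft f m α o) {i l : ℤ} (h : i ≤ l) : InLeft f m (g ^ l * α) (g ^ i • o) := by
  induction l, h using Int.leInduction with
  | base => exact (inLeft_mul _).2 hL
  | succ l _ ih => exact (hp.zpow l).inLeft hM ih

theorem Precedes.inRight_zpow (hp : Precedes f M m α (g * α)) (hM : 2 * m < M)
    (hR : InRight f M m α (g • o)) {i l : ℤ} (h : i < l) :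
    InRight f M m (g ^ i * α) (g ^ l • o) := by
  have key : ∀ n : ℕ, InRight f M m (g ^ (l - 1 - n) * α) (g ^ l • o) := by
    intro n
    induction n with
    | zero =>
      rw [show g ^ l • o = g ^ (l - 1 - (0 : ℕ)) • g • o by
        rw [smul_smul, ← zpow_add_one]
        congr 2
        push_cast
        ring]
      exact (inRight_mul _).2 hR
    | succ n ih =>
      have h1 := hp.zpow (l - 1 - (n + 1 : ℕ))
      rw [show l - 1 - ((n + 1 : ℕ) : ℤ) + 1 = l - 1 - n by push_cast; ring] at h1
      exact h1.inRight hM ih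
  have := key (l - 1 - i).toNat
  rwa [Int.toNat_of_nonneg (by omega), show l - 1 - (l - 1 - i) = i by ring] at this

end Translate

section Powers

variable {G : Type*} [Group G] {S : Finset G}

theorem wordNorm_pow_le (hS : Subgroup.closure (S : Set G) = ⊤) (g : G) (n : ℕ) :
    wordNorm S (g ^ n) ≤ n * wordNorm S g := by
  induction n with
  | zero => simp [wordNorm_one]
  | succ n ih =>
    rw [pow_succ, Nat.succ_mul]
    exact (wordNorm_mul_le hS _ _).trans (by omega)

theorem wordNorm_zpow (hS : Subgroup.closure (S : Set G) = ⊤) (g : G) (i : ℤ) :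
    wordNorm S (g ^ i) = wordNorm S (g ^ i.natAbs) := by
  rcases Int.natAbs_eq i with h | h
  · conv_lhs => rw [h, zpow_natCast]
  · conv_lhs => rw [h, zpow_neg, zpow_natCast, wordNorm_inv hS]

/-- The strict inequality absorbs the difference between `N` and `N + 1`. -/
theorem le_translationLength (hS : Subgroup.closure (S : Set G) = ⊤) {g : G} {E : ℕ} {c : ℝ}
    (hE : ∀ N : ℕ, N * E ≤ wordNorm S (g ^ (N + 1))) (hc : c < E) : c ≤ translationLength S g := by
  rw [translationLength]
  refine Filter.le_liminf_of_le (Filter.IsBoundedUnder.isCoboundedUnder_ge ?_) ?_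
  · refine ⟨wordNorm S g, Filter.eventually_map.2 (Filter.Eventually.of_forall fun n => ?_)⟩
    rcases Nat.eq_zero_or_pos n with rfl | hn
    · simp
    · rw [div_le_iff₀ (by exact_mod_cast hn)]
      have := wordNorm_pow_le hS g n
      rw [mul_comm]
      exact_mod_cast this
  · obtain ⟨n₀, hn₀⟩ := exists_nat_gt (E / (E - c))
    have hc' : 0 < E - c := by linarith
    rw [div_lt_iff₀ hc'] at hn₀
    filter_upwards [Filter.eventually_ge_atTop (n₀ + 1)] with n hn
    obtain ⟨N, rfl⟩ : ∃ N, n = N + 1 := ⟨n - 1, by omega⟩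
    have h1 : (N : ℝ) * E ≤ wordNorm S (g ^ (N + 1)) := by exact_mod_cast hE N
    have h2 : (n₀ : ℝ) ≤ N + 1 := by exact_mod_cast (by omega : n₀ ≤ N + 1)
    rw [le_div_iff₀ (by positivity)]
    push_cast
    nlinarith

end Powers

section PowerGrowth

variable {G X : Type*} [Group G] [MulAction G X] {f : X → ℤ} {M : ℕ} {m : ℝ} {o : X} {g α : G}
  {S : Finset G}

/-- If `g` translates a segment past itself by a distance much larger than the precision `n / Λ`
with which words pass close to it, then the lengths of the powers of `g` grow at least linearly. -/
theorem Precedes.mul_le_wordNorm_pow (hp : Precedes f M m α (g * α)) (hM : 2 * m < M)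
    (hS : Subgroup.closure (S : Set G) = ⊤) (hL : InLeft f m α o) (hR : InRight f M m α (g • o))
    {Λ T E n : ℕ}
    (hW : ∀ h x y : G, InLeft f m h (x • o) → InRight f M m h (y • o) →
      ∃ w, WordBetween S x w y ∧ ¬ InLeft f m h (w • o) ∧ ¬ InRight f M m h (w • o) ∧
        Λ * wordDist S w h ≤ wordDist S x y + T)
    (h1 : wordNorm S α ≤ n) (h2 : wordDist S α g ≤ n) (h3 : wordDist S α (g * α) ≤ n)
    (hE : ∀ t, Λ * t ≤ 2 * t + (2 * n + T) → E + 2 * t ≤ wordDist S α (g * α)) (N : ℕ) :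
    N * E ≤ wordNorm S (g ^ (N + 1)) := by
  rw [← wordDist_one_left]
  refine mul_le_wordDist_of_chain hS (L := fun i => {x | InLeft f m (g ^ i * α) (x • o)})
    (R := fun i => {x | InRight f M m (g ^ i * α) (x • o)}) (η := fun i => g ^ i * α)
    (Λ := Λ) (T := T) (E' := wordDist S α (g * α)) (n := n) ?_ ?_ ?_ ?_ ?_ ?_ ?_ hE
  · intro i z
    have := hp.zpow i (z • o)
    rwa [zpow_natCast, ← Nat.cast_succ, zpow_natCast] at this
  · exact fun i x hx y hy => hW _ x y hx hy
  · simpa using hL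
  · intro i hi
    have := hp.inRight_zpow hM hR (i := i) (l := (N + 1 : ℕ)) (by omega)
    rwa [zpow_natCast, zpow_natCast] at this
  · simpa [wordDist_one_left] using h1
  · rwa [pow_succ, wordDist_mul_left]
  · intro i
    rw [pow_succ, mul_assoc, wordDist_mul_left]
    exact ⟨le_rfl, h3⟩

end PowerGrowth

section Good

variable {G X : Type*} [Group G] [MetricSpace X] [MulAction G X] [IsIsometricSMul G X]
  {φ : G} {o : X} {f : X → ℤ} {M : ℕ} {C m κ : ℝ} {S : Finset G} {g α : G}

/-- An element that translates a segment past itself is strongly contracting, since its orbit follows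
the chain of the translates of the segment. -/
theorem Precedes.isStronglyContracting (hp : Precedes f M m α (g * α))
    (hX : IsGeodesicSpace X) (hax : ContractingAxis φ o f C) (hqi : OrbitQI S o κ)
    (hM : 2 * m < M) (hM' : 2 * m + 2 * C + 1 ≤ M) (hS : Subgroup.closure (S : Set G) = ⊤)
    (hL : InLeft f m α o) (hR : InRight f M m α (g • o)) {E : ℕ} (hE : 0 < E)
    (hpow : ∀ N : ℕ, N * E ≤ wordNorm S (g ^ (N + 1))) : IsStronglyContracting X g := by
  have hC := hax.one_le
  have hκ := hqi.one_le
  obtain ⟨K, hK⟩ : ∃ K, K = κ * (wordNorm S g + 1) + 2 := ⟨_, rfl⟩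
  have hκK : κ + 2 ≤ K := by
    have : 0 ≤ κ * wordNorm S g := by positivity
    rw [hK, mul_add]
    linarith
  have hdist : ∀ i j : ℤ, |(i : ℝ) - j| ≤ wordDist S (g ^ i) (g ^ j) + 1 ∧
      (wordDist S (g ^ i) (g ^ j) : ℝ) ≤ |(i : ℝ) - j| * wordNorm S g := by
    intro i j
    have e1 : wordDist S (g ^ i) (g ^ j) = wordNorm S (g ^ (i - j).natAbs) := by
      rw [wordDist, ← zpow_neg, ← zpow_add, wordNorm_zpow hS]
      congr 2
      omega
    have e2 : |(i : ℝ) - j| = ((i - j).natAbs : ℝ) := by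
      rw [Nat.cast_natAbs]
      push_cast
      rfl
    rw [e1, e2]
    constructor
    · rcases Nat.eq_zero_or_pos (i - j).natAbs with h | h
      · rw [h, Nat.cast_zero]
        positivity
      · obtain ⟨N, hN⟩ : ∃ N, (i - j).natAbs = N + 1 := ⟨(i - j).natAbs - 1, by omega⟩
        rw [hN]
        have h1 := hpow N
        have h2 : N ≤ N * E := Nat.le_mul_of_pos_right N hE
        exact_mod_cast (by omega : N + 1 ≤ wordNorm S (g ^ (N + 1)) + 1)
    · exact_mod_cast wordNorm_pow_le hS g _
  have hq : IsQuasiGeodesic K fun i : ℤ => g ^ i • o := by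
    intro i j
    obtain ⟨h1, h2⟩ := hdist i j
    constructor
    · have h3 := hqi.wordDist_le (g ^ i) (g ^ j)
      have h4 : |(i : ℝ) - j| / K ≤ |(i : ℝ) - j| / κ := by
        gcongr
        linarith
      have h5 : |(i : ℝ) - j| / κ ≤ dist (g ^ i • o) (g ^ j • o) + 2 := by
        rw [div_le_iff₀ (by linarith)]
        nlinarith
      linarith
    · have h3 := hqi.dist_le (g ^ i) (g ^ j)
      have h4 : κ * wordDist S (g ^ i) (g ^ j) ≤ κ * (|(i : ℝ) - j| * wordNorm S g) := by gcongr
      have h5 : 0 ≤ |(i : ℝ) - j| * (κ + 2) := by positivity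
      rw [hK] at hκK ⊢
      nlinarith
  obtain ⟨ρ, hρ⟩ : ∃ ρ, ρ = dist o (α • φ ^ ⌈m + C⌉ • o) := ⟨_, rfl⟩
  have hρ0 : 0 ≤ ρ := hρ ▸ dist_nonneg
  have hc1 := Int.le_ceil (m + C)
  have hc2 := Int.ceil_lt_add_one (m + C)
  have hsep : ∀ (l : ℤ) (x y : X), InLeft f m (g ^ l * α) x → InRight f M m (g ^ l * α) y →
      dist x (g ^ l • o) + dist (g ^ l • o) y ≤ dist x y + (2 * C + 2 * ρ) := by
    intro l x y hx hy
    rw [InLeft] at hx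
    rw [InRight] at hy
    have h1 := hax.dist_add_dist_le hX (g ^ l * α) (x := x) (y := y) (i := ⌈m + C⌉)
      (by linarith) (by linarith)
    have h2 : dist (g ^ l • o) ((g ^ l * α) • φ ^ ⌈m + C⌉ • o) = ρ := by
      rw [mul_smul, dist_smul, hρ]
    have h3 := dist_triangle_right x (g ^ l • o) ((g ^ l * α) • φ ^ ⌈m + C⌉ • o)
    have h4 := dist_triangle (g ^ l • o) ((g ^ l * α) • φ ^ ⌈m + C⌉ • o) y
    linarith
  obtain ⟨K', hK', h1, h2⟩ := exists_isStronglyContractingSet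
    (L := fun l : ℤ => {x | InLeft f m (g ^ l * α) x})
    (R := fun l : ℤ => {x | InRight f M m (g ^ l * α) x}) (ρ := 2 * C + 2 * ρ)
    (fun l x hx y hy => hsep l x y hx hy) (fun l => hp.zpow l)
    (fun i l h => hp.inLeft_zpow hM hL h.le)
    (fun i l h => hp.inRight_zpow hM hR h) (by positivity) (by linarith : 0 < K) hq
  exact ⟨o, K', hK', h1, h2⟩

end Good

/-! ### Elements with a barrier -/

section Returning

variable {G : Type*} [Group G]

/-- The element `g` almost returns: the translate by `g` of an initial piece `b` of a word geodesic
from `1` to `g` ends close to a point `y` between `b` and `g`. Such an element is a product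
`y w b⁻¹` with `w` short, so that a conjugate of it is much shorter than `g`. -/
def HasReturn (S : Finset G) (g : G) : Prop :=
  ∃ b y : G, WordBetween S 1 b g ∧ WordBetween S b y g ∧ wordNorm S g ≤ 5 * wordNorm S b ∧
    250 * wordDist S (g * b) y ≤ wordNorm S g

end Returning

section Good

variable {G X : Type*} [Group G] [MetricSpace X] [MulAction G X] [IsIsometricSMul G X]
  {φ : G} {o : X} {f : X → ℤ} {M : ℕ} {C m₁ M₀ κ : ℝ} {S : Finset G}

/-- The segment of a barrier `α` in the first third of `g` precedes its translate by `g`: the path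
from `g` to `g α` is too short to return to `α`, and if the path from `α` to `g` came close to
`g α`, then `g` would return. -/
theorem ContractingAxis.precedes_mul_of_barrier (hX : IsGeodesicSpace X)
    (hax : ContractingAxis φ o f C) (hqi : OrbitQI S o κ)
    (hS : Subgroup.closure (S : Set G) = ⊤) (hm₁ : 0 ≤ m₁) (hM₀ : 0 < M₀) {T T₀ : ℕ}
    (hpr : ∀ a b : ℝ, -(M + (m₁ + 2 * M₀)) ≤ a → b ≤ M + (m₁ + 2 * M₀) → a + M₀ ≤ b →
      ∀ h x y : G, (f (h⁻¹ • x • o) : ℝ) ≤ a → b ≤ f (h⁻¹ • y • o) →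
        ∃ w, WordBetween S x w y ∧ 1000 * wordDist S w h ≤ wordDist S x y + T₀) :
    ∃ n₀ : ℕ, ∀ g α b : G, n₀ ≤ wordNorm S g → InLeft f m₁ α o → InRight f M m₁ α (g • o) →
      WordBetween S 1 b g → 1000 * wordDist S b α ≤ wordNorm S g + T →
      wordNorm S g ≤ 5 * wordNorm S b → 10 * wordNorm S b ≤ 3 * wordNorm S g → ¬ HasReturn S g →
      Precedes f M (m₁ + 2 * M₀ + 2 * C + 1) α (g * α) := by
  have hC := hax.one_le
  have hκ := hqi.one_le
  obtain ⟨n₁, hn₁⟩ := exists_nat_gt (10 * (κ * (2 * C + 2 * (C * (m₁ + 2 * M₀ + C + 1) + C)) + κ))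
  refine ⟨n₁ + T + T₀ + 1000 * wordNorm S (φ ^ M) + 1, fun g α b hn hL hR hbg hbα hb5 hb3 hret => ?_⟩
  obtain ⟨n, hn'⟩ : ∃ n, n = wordNorm S g := ⟨_, rfl⟩
  obtain ⟨ℓ, hℓ⟩ : ∃ ℓ, ℓ = wordNorm S b := ⟨_, rfl⟩
  have e1 : wordDist S 1 b + wordDist S b g = wordDist S 1 g := hbg
  rw [wordDist_one_left, wordDist_one_left] at e1
  have e2 : wordDist S g (g * b) = ℓ := by rw [wordDist_mul_right, hℓ]
  have e3 : wordDist S (g * b) (g * α) = wordDist S b α := wordDist_mul_left _ _ _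
  have e4 : wordDist S α (α * φ ^ M) = wordNorm S (φ ^ M) := wordDist_mul_right _ _
  have e5 := wordDist_triangle hS b α (α * φ ^ M)
  have e6 := wordDist_triangle hS 1 b (g * b)
  have e7 := wordDist_triangle hS 1 (g * b) g
  rw [wordDist_one_left] at e6 e7
  rw [wordDist_one_left] at e6 e7
  rw [wordDist_comm hS (g * b) g] at e7
  rw [← hn'] at hn hbα hb5 hb3 e1 e7
  rw [← hℓ] at hb5 hb3 e1 e6
  obtain ⟨m₂, hm₂⟩ : ∃ m₂, m₂ = m₁ + 2 * M₀ := ⟨_, rfl⟩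
  rw [← hm₂] at hpr hn₁ ⊢
  rw [InLeft] at hL
  rw [InRight] at hR
  have hM0 : (0 : ℝ) ≤ M := Nat.cast_nonneg M
  have ha : (M : ℝ) - m₂ ≤ f (α⁻¹ • (g * α) • o) := by
    by_contra hcon
    push Not at hcon
    obtain ⟨w, hw1, hw2⟩ : ∃ w, 1000 * wordDist S w α ≤ 2 * n ∧
        wordDist S g w ≤ ℓ + wordDist S b α := by
      rcases le_total (f (α⁻¹ • (g * b) • o) : ℝ) (M - m₁ - M₀) with h | h
      · obtain ⟨w, hw1, hw2⟩ := hpr (M - m₁ - M₀) (M - m₁) (by linarith) (by linarith)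
          (by linarith) α (g * b) g h hR
        have h1 : wordDist S (g * b) w + wordDist S w g = wordDist S (g * b) g := hw1
        rw [wordDist_comm hS (g * b) g, e2, wordDist_comm hS w g] at h1
        rw [wordDist_comm hS (g * b) g, e2] at hw2
        exact ⟨w, by omega, by omega⟩
      · obtain ⟨w, hw1, hw2⟩ := hpr (M - m₂) (M - m₁ - M₀) (by linarith) (by linarith)
          (by linarith) α (g * α) (g * b) hcon.le h
        have h1 : wordDist S (g * α) w + wordDist S w (g * b) = wordDist S (g * α) (g * b) := hw1
        rw [wordDist_comm hS (g * α) (g * b), e3, wordDist_comm hS w (g * b)] at h1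
        rw [wordDist_comm hS (g * α) (g * b), e3] at hw2
        have h2 := wordDist_triangle hS g (g * b) w
        exact ⟨w, by omega, by omega⟩
    have h1 := wordDist_triangle hS b α w
    have h2 := wordDist_triangle hS b w g
    rw [wordDist_comm hS α w] at h1
    rw [wordDist_comm hS w g] at h2
    omega
  have hb : (f ((g * α)⁻¹ • (α * φ ^ M) • o) : ℝ) ≤ m₂ := by
    by_contra hcon
    push Not at hcon
    have hg : (f ((g * α)⁻¹ • g • o) : ℝ) ≤ m₁ := by simpa [mul_smul] using hL
    rcases le_total (m₁ + M₀) (f ((g * α)⁻¹ • b • o) : ℝ) with h | h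
    · obtain ⟨w, hw1, hw2⟩ := hpr m₁ (m₁ + M₀) (by linarith) (by linarith)
        le_rfl (g * α) g b hg h
      refine hret ⟨b, w, hbg, hw1.symm hS, by omega, ?_⟩
      have h1 := wordDist_triangle hS (g * b) (g * α) w
      rw [wordDist_comm hS (g * α) w] at h1
      rw [wordDist_comm hS g b] at hw2
      omega
    · obtain ⟨w, hw1, hw2⟩ := hpr (m₁ + M₀) m₂ (by linarith) (by linarith)
        (by linarith) (g * α) b (α * φ ^ M) h hcon.le
      have h1 : wordDist S b w + wordDist S w (α * φ ^ M) = wordDist S b (α * φ ^ M) := hw1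
      have h2 := wordDist_triangle hS b w (g * b)
      have h3 := wordDist_triangle hS w (g * α) (g * b)
      rw [wordDist_comm hS (g * α) (g * b)] at h3
      omega
  have hfar : 2 * C + 2 * (C * (m₂ + C + 1) + C) <
      dist (α • φ ^ (M : ℤ) • o) ((g * α) • φ ^ (0 : ℤ) • o) := by
    have h1 := wordDist_triangle hS b (α * φ ^ M) (g * b)
    have h2 := wordDist_triangle hS (α * φ ^ M) (g * α) (g * b)
    rw [wordDist_comm hS (g * α) (g * b)] at h2
    have h3 : n ≤ 10 * wordDist S (α * φ ^ M) (g * α) := by omega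
    have h4 := hqi.wordDist_le (α * φ ^ M) (g * α)
    rw [zpow_zero, one_smul, zpow_natCast, smul_smul]
    by_contra hcon
    push Not at hcon
    have h5 : κ * dist ((α * φ ^ M) • o) ((g * α) • o) ≤
        κ * (2 * C + 2 * (C * (m₂ + C + 1) + C)) := by gcongr
    have h6 : (n : ℝ) ≤ 10 * wordDist S (α * φ ^ M) (g * α) := by exact_mod_cast h3
    have h7 : (n₁ : ℝ) ≤ n := by exact_mod_cast (by omega : n₁ ≤ n)
    linarith
  intro z
  have key := hax.le_or_le_of_far hX (h := α) (h' := g * α) (i := M) (j := 0) (c := m₂)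
    (by linarith) (by
      rw [zpow_zero, one_smul]
      push_cast
      exact ha) (by
      rw [zpow_natCast, smul_smul α]
      push_cast
      linarith) hfar z
  rw [InRight, InLeft]
  push_cast at key
  refine key.imp (fun h => ?_) fun h => ?_ <;> linarith

/-- An element with a barrier at a time between one fifth and three tenths of its length is strongly
contracting and has large translation length, unless it returns. -/
theorem ContractingAxis.isStronglyContracting_of_hasBarrier (hX : IsGeodesicSpace X)
    (hax : ContractingAxis φ o f C) (hqi : OrbitQI S o κ)
    (hS : Subgroup.closure (S : Set G) = ⊤) (hm₁ : 0 ≤ m₁) :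
    ∃ M₂ : ℝ, ∀ M : ℕ, M₂ ≤ M → ∀ T : ℕ, ∃ n₀ : ℕ, ∀ (g : G) (lo hi : ℕ), n₀ ≤ wordNorm S g →
      HasBarrier o f M m₁ S 1000 T lo hi g → wordNorm S g ≤ 5 * lo → 10 * hi ≤ 3 * wordNorm S g →
      ¬ HasReturn S g → IsStronglyContracting X g ∧
        35 / 100 * (wordNorm S g : ℝ) ≤ translationLength S g := by
  have hC := hax.one_le
  obtain ⟨M₀, hM₀, hpr⟩ := hax.exists_progress hqi 1000
  obtain ⟨m₃, hm₃⟩ : ∃ m₃, m₃ = m₁ + 2 * M₀ + 2 * C + 1 := ⟨_, rfl⟩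
  refine ⟨2 * m₃ + M₀ + 2 * C + 1, fun M hM T => ?_⟩
  have hM0 : (0 : ℝ) ≤ M := Nat.cast_nonneg M
  obtain ⟨T₀, hT₀⟩ := hpr (M + m₃)
  obtain ⟨n₁, hn₁⟩ := hax.precedes_mul_of_barrier hX hqi hS (M := M) (T := T) (T₀ := T₀) hm₁ hM₀
    (fun a b ha hb hab h x y hx hy => by
      obtain ⟨w, hw1, -, -, hw2⟩ := hT₀ a b (by linarith) (by linarith) hab h x y hx hy hS
      exact ⟨w, hw1, hw2⟩)
  refine ⟨n₁ + T + T₀ + 200, fun g lo hi hn hbar hlo hhi hret => ?_⟩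
  obtain ⟨α, b, hL, hR, hbg, hb1, hb2, hbα⟩ := hbar
  have hp := hn₁ g α b (by omega) hL hR hbg hbα (by omega) (by omega) hret
  rw [← hm₃] at hp
  have hL' : InLeft f m₃ α o := hL.mono (by linarith)
  have hR' : InRight f M m₃ α (g • o) := hR.mono (by linarith)
  have e1 : wordDist S 1 b + wordDist S b g = wordDist S 1 g := hbg
  rw [wordDist_one_left, wordDist_one_left] at e1
  have e2 : wordDist S g (g * b) = wordNorm S b := wordDist_mul_right _ _
  have e3 : wordDist S (g * b) (g * α) = wordDist S b α := wordDist_mul_left _ _ _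
  have e6 := wordDist_triangle hS 1 b (g * b)
  have e7 := wordDist_triangle hS 1 (g * b) g
  have e8 := wordDist_triangle hS 1 b α
  have e9 := wordDist_triangle hS α b g
  have e10 := wordDist_triangle hS α g (g * α)
  have e11 := wordDist_triangle hS g (g * b) (g * α)
  have e12 := wordDist_triangle hS b α (g * b)
  have e13 := wordDist_triangle hS α (g * α) (g * b)
  rw [wordDist_one_left] at e6 e7 e8
  rw [wordDist_one_left] at e6 e7 e8
  rw [wordDist_comm hS (g * b) g] at e7
  rw [wordDist_comm hS α b] at e9
  rw [wordDist_comm hS (g * α) (g * b)] at e13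
  obtain ⟨n, hn'⟩ : ∃ n, n = wordNorm S g := ⟨_, rfl⟩
  have hpow : ∀ N : ℕ, N * (36 * n / 100) ≤ wordNorm S (g ^ (N + 1)) :=
    hp.mul_le_wordNorm_pow (by linarith) hS hL' hR' (Λ := 1000) (T := T₀) (n := 2 * n)
      (fun h x y hx hy => by
        obtain ⟨w, hw1, hw2, hw3, hw4⟩ := hT₀ m₃ (M - m₃) (by linarith) (by linarith)
          (by linarith) h x y hx hy hS
        exact ⟨w, hw1, not_le.2 hw2, not_le.2 hw3, hw4⟩)
      (by omega) (by omega) (by omega) (fun t ht => by omega)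
  refine ⟨hp.isStronglyContracting hX hax hqi (by linarith) (by linarith) hS hL' hR' (by omega) hpow,
    le_translationLength hS hpow ?_⟩
  have h1 : 36 * n < 100 * (36 * n / 100) + 100 := by omega
  have h2 : (36 : ℝ) * n < 100 * ((36 * n / 100 : ℕ) : ℝ) + 100 := by exact_mod_cast h1
  have h3 : (200 : ℝ) ≤ n := by exact_mod_cast (by omega : 200 ≤ n)
  rw [← hn']
  linarith

end Good

/-! ### Counting returning elements -/

section ReturnCount

variable {G : Type*} [Group G] {S : Finset G}

theorem ncard_biUnion_range_le {α : Type*} (s : ℕ → Set α) (N : ℕ) :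
    (⋃ i ∈ Finset.range N, s i).ncard ≤ ∑ i ∈ Finset.range N, (s i).ncard := by
  classical
  induction N with
  | zero => simp
  | succ N ih =>
    rw [Finset.range_add_one, Finset.set_biUnion_insert, Finset.sum_insert (by simp)]
    exact (Set.ncard_union_le _ _).trans (by omega)

/-- Returning elements are exponentially rare: such an element is determined by the parts `b`,
`b⁻¹ y` and `w`, whose lengths add up to less than nine tenths of its length. -/
theorem card_hasReturn_le (hS : Subgroup.closure (S : Set G) = ⊤) {A β : ℝ} (hA : 0 ≤ A)
    (hβ : 0 ≤ β) (hgrowth : ∀ n : ℕ, (ballCard S n : ℝ) ≤ A * Real.exp (β * n)) (n : ℕ) :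
    ({g | wordNorm S g = n ∧ HasReturn S g}.ncard : ℝ) ≤
      (n + 1) * (A ^ 3 * Real.exp (β * (202 / 250 * n))) := by
  obtain ⟨N, hN⟩ : ∃ N, N = 201 * n / 250 := ⟨_, rfl⟩
  obtain ⟨P, hP⟩ : ∃ P : ℕ → Set (G × G × G), ∀ ℓ, P ℓ = wordBall S (ℓ : ℝ) ×ˢ
      wordBall S ((N - ℓ : ℕ) : ℝ) ×ˢ wordBall S ((n / 250 : ℕ) : ℝ) := ⟨_, fun _ => rfl⟩
  have hPfin : ∀ ℓ, (P ℓ).Finite := by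
    intro ℓ
    rw [hP]
    exact (wordBall_finite hS _).prod ((wordBall_finite hS _).prod (wordBall_finite hS _))
  have hPcard : ∀ ℓ, (P ℓ).ncard = ballCard S ℓ * (ballCard S (N - ℓ) * ballCard S (n / 250)) := by
    intro ℓ
    rw [hP, Set.ncard_prod, Set.ncard_prod, ballCard, ballCard, ballCard]
  set F : G × G × G → G := fun x => x.1 * x.2.1 * x.2.2 * x.1⁻¹ with hF
  have hsub : {g | wordNorm S g = n ∧ HasReturn S g} ⊆
      ⋃ ℓ ∈ Finset.range (N + 1), F '' P ℓ := by
    rintro g ⟨hg, b, y, hb, hy, h5, hd⟩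
    have e1 : wordDist S 1 b + wordDist S b g = wordDist S 1 g := hb
    have e2 : wordDist S b y + wordDist S y g = wordDist S b g := hy
    have e3 : wordDist S g (g * b) = wordNorm S b := wordDist_mul_right _ _
    have e4 := wordDist_triangle hS g y (g * b)
    rw [wordDist_one_left, wordDist_one_left] at e1
    rw [wordDist_comm hS g y, wordDist_comm hS y (g * b)] at e4
    simp only [Set.mem_iUnion, Finset.mem_range]
    refine ⟨wordNorm S b, by omega, (b, b⁻¹ * y, y⁻¹ * (g * b)), ?_, ?_⟩
    · rw [hP]
      refine ⟨mem_wordBall_natCast.2 le_rfl, mem_wordBall_natCast.2 ?_, mem_wordBall_natCast.2 ?_⟩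
      · change wordDist S b y ≤ _
        omega
      · change wordDist S y (g * b) ≤ _
        rw [wordDist_comm hS y (g * b)]
        omega
    · simp [hF, mul_assoc]
  have hfin : (⋃ ℓ ∈ Finset.range (N + 1), F '' P ℓ).Finite :=
    Set.Finite.biUnion (Finset.finite_toSet _) fun ℓ _ => (hPfin ℓ).image F
  have h1 : {g | wordNorm S g = n ∧ HasReturn S g}.ncard ≤
      ∑ ℓ ∈ Finset.range (N + 1),
        ballCard S ℓ * (ballCard S (N - ℓ) * ballCard S (n / 250)) := by
    refine (Set.ncard_le_ncard hsub hfin).trans ((ncard_biUnion_range_le _ _).trans ?_)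
    exact Finset.sum_le_sum fun ℓ _ => (Set.ncard_image_le (hPfin ℓ)).trans (hPcard ℓ).le
  have h2 : ∀ ℓ ∈ Finset.range (N + 1),
      ((ballCard S ℓ * (ballCard S (N - ℓ) * ballCard S (n / 250)) : ℕ) : ℝ) ≤
        A ^ 3 * Real.exp (β * (202 / 250 * n)) := by
    intro ℓ hℓ
    rw [Finset.mem_range] at hℓ
    have e1 : ((N - ℓ : ℕ) : ℝ) = N - ℓ := Nat.cast_sub (by omega)
    have e2 : (N : ℝ) ≤ 201 / 250 * n := by
      have : 250 * N ≤ 201 * n := by omega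
      have : (250 : ℝ) * N ≤ 201 * n := by exact_mod_cast this
      linarith
    have e3 : ((n / 250 : ℕ) : ℝ) ≤ n / 250 := Nat.cast_div_le
    push_cast
    calc (ballCard S ℓ : ℝ) * (ballCard S (N - ℓ) * ballCard S (n / 250))
        ≤ (A * Real.exp (β * ℓ)) * ((A * Real.exp (β * (N - ℓ : ℕ))) *
          (A * Real.exp (β * (n / 250 : ℕ)))) := by
          gcongr <;> exact hgrowth _
      _ = A ^ 3 * Real.exp (β * ℓ + (β * (N - ℓ : ℕ) + β * (n / 250 : ℕ))) := by
          rw [Real.exp_add, Real.exp_add]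
          ring
      _ ≤ A ^ 3 * Real.exp (β * (202 / 250 * n)) := by
          gcongr
          rw [e1, ← mul_add, ← mul_add]
          gcongr
          linarith
  calc ({g | wordNorm S g = n ∧ HasReturn S g}.ncard : ℝ)
      ≤ ((∑ ℓ ∈ Finset.range (N + 1),
        ballCard S ℓ * (ballCard S (N - ℓ) * ballCard S (n / 250)) : ℕ) : ℝ) := by
        exact_mod_cast h1
    _ ≤ ∑ _ℓ ∈ Finset.range (N + 1), A ^ 3 * Real.exp (β * (202 / 250 * n)) := by
        rw [Nat.cast_sum]
        exact Finset.sum_le_sum h2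
    _ = (N + 1) * (A ^ 3 * Real.exp (β * (202 / 250 * n))) := by
        rw [Finset.sum_const, Finset.card_range, nsmul_eq_mul]
        push_cast
        ring
    _ ≤ (n + 1) * (A ^ 3 * Real.exp (β * (202 / 250 * n))) := by
        have : (N : ℝ) ≤ n := by exact_mod_cast (by omega : N ≤ n)
        gcongr

theorem log_add_one_sq_le (n : ℕ) (hn : 1 ≤ n) : (Nat.log 2 n + 1) ^ 2 ≤ 4 * n := by
  have h1 : 2 ^ Nat.log 2 n ≤ n := Nat.pow_log_le_self 2 (by omega)
  have h2 : ∀ l : ℕ, (l + 1) ^ 2 ≤ 4 * 2 ^ l := by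
    intro l
    induction l using Nat.strong_induction_on with
    | _ l ih =>
      rcases Nat.lt_or_ge l 3 with h | h
      · interval_cases l <;> norm_num
      · obtain ⟨j, rfl⟩ : ∃ j, l = j + 1 := ⟨l - 1, by omega⟩
        have h3 := ih j (by omega)
        rw [pow_succ 2]
        nlinarith
  exact (h2 _).trans (by omega)

end ReturnCount

/-! ### Genericity -/

section Final

variable {G : Type*} [Group G] {S : Finset G}

theorem wordBall_eq_natFloor {R : ℝ} (hR : 0 ≤ R) : wordBall S R = wordBall S (⌊R⌋₊ : ℝ) := by
  ext g
  rw [mem_wordBall_natCast, Nat.le_floor_iff hR]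
  rfl

/-- Exponential bounds for the number of returning elements and of elements of length at most
`9 N / 10`: both rates are below `99 / 100` of the growth rate. -/
theorem exists_exp_negligible {h A : ℝ} (hh : 0 < h) (hA : 0 < A) (s : ℕ) :
    ∃ N₀ : ℕ, ∀ N : ℕ, N₀ ≤ N →
      (N : ℝ) ^ s * ((N + 1) ^ 2 * (A ^ 3 * Real.exp (11 / 10 * h * (202 / 250 * N))) +
        A * Real.exp (11 / 10 * h * (9 / 10 * N))) ≤ Real.exp (h * N) := by
  have h1 := (tendsto_rpow_mul_exp_neg_mul_atTop_nhds_zero ((s + 2 : ℕ) : ℝ) (h / 100)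
    (by positivity)).comp tendsto_natCast_atTop_atTop
  have h2 := h1.eventually (ge_mem_nhds (by positivity : (0 : ℝ) < 1 / (4 * A ^ 3 + A)))
  obtain ⟨N₀, hN₀⟩ := Filter.eventually_atTop.1 h2
  refine ⟨N₀ + 1, fun N hN => ?_⟩
  have h3 := hN₀ N (by omega)
  simp only [Function.comp_apply, Real.rpow_natCast] at h3
  have hN1 : (1 : ℝ) ≤ N := by exact_mod_cast (by omega : 1 ≤ N)
  have hN0 : (0 : ℝ) < h * N := by positivity
  have e1 : Real.exp (11 / 10 * h * (202 / 250 * N)) ≤ Real.exp (99 / 100 * (h * N)) := by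
    rw [Real.exp_le_exp]
    linarith
  have e2 : Real.exp (11 / 10 * h * (9 / 10 * N)) = Real.exp (99 / 100 * (h * N)) := by
    congr 1
    ring
  have e3 : Real.exp (h * N) * Real.exp (-(h / 100) * N) = Real.exp (99 / 100 * (h * N)) := by
    rw [← Real.exp_add]
    congr 1
    ring
  calc (N : ℝ) ^ s * ((N + 1) ^ 2 * (A ^ 3 * Real.exp (11 / 10 * h * (202 / 250 * N))) +
        A * Real.exp (11 / 10 * h * (9 / 10 * N)))
      ≤ (N : ℝ) ^ s * ((2 * N) ^ 2 * (A ^ 3 * Real.exp (99 / 100 * (h * N))) +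
        N ^ 2 * (A * Real.exp (99 / 100 * (h * N)))) := by
        rw [e2]
        have e4 : A * Real.exp (99 / 100 * (h * N)) ≤
            (N : ℝ) ^ 2 * (A * Real.exp (99 / 100 * (h * N))) :=
          le_mul_of_one_le_left (by positivity) (one_le_pow₀ hN1)
        have e5 : (N : ℝ) + 1 ≤ 2 * N := by linarith
        gcongr
    _ = Real.exp (h * N) * ((4 * A ^ 3 + A) *
        ((N : ℝ) ^ (s + 2) * Real.exp (-(h / 100) * N))) := by
        rw [← e3]
        ring
    _ ≤ Real.exp (h * N) * ((4 * A ^ 3 + A) * (1 / (4 * A ^ 3 + A))) := by gcongr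
    _ = Real.exp (h * N) := by
        rw [mul_one_div_cancel (by positivity), mul_one]

variable {X : Type*} [MetricSpace X] [MulAction G X] [IsIsometricSMul G X]
  {φ : G} {o : X} {f : X → ℤ} {C c κ : ℝ}

/-- Apart from superpolynomially few elements and from the returning ones, all elements are
strongly contracting with large translation length. -/
theorem ContractingAxis.exists_card_bad_sphere_le (hX : IsGeodesicSpace X)
    (hax : ContractingAxis φ o f C) (hqi : OrbitQI S o κ)
    (hS : Subgroup.closure (S : Set G) = ⊤) {u : G} (hc : 0 ≤ c)
    (hu : ∀ y : X, |(f y : ℝ)| ≤ c ∨ |(f (u • y) : ℝ)| ≤ c) (p : ℕ) :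
    ∃ A n₀ : ℕ, ∀ n, n₀ ≤ n →
      {g | wordNorm S g = n ∧ ¬ HasReturn S g ∧ ¬ (IsStronglyContracting X g ∧
        35 / 100 * (n : ℝ) ≤ translationLength S g)}.ncard * n ^ p ≤ A * ballCard S n := by
  obtain ⟨m₁, hm₁, hcount⟩ := hax.exists_card_not_hasBarrier_le hX hqi hS hc hu
  obtain ⟨M₁, hcount⟩ := hcount 1000 (by norm_num)
  obtain ⟨M₂, hgood⟩ := hax.isStronglyContracting_of_hasBarrier hX hqi hS hm₁
  obtain ⟨M, hM⟩ := exists_nat_gt (max M₁ M₂)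
  obtain ⟨T, hcount⟩ := hcount M ((le_max_left _ _).trans hM.le)
  obtain ⟨n₁, hgood⟩ := hgood M ((le_max_right _ _).trans hM.le) T
  -- with `2 p + 1` windows, the `2 p`-th power of the logarithm costs only `n ^ p`
  obtain ⟨A, hcount⟩ := hcount (2 * p)
  obtain ⟨d, hd⟩ : ∃ d, d = 40 * (2 * p + 1) := ⟨_, rfl⟩
  refine ⟨d ^ (2 * p + 1) * (2 * 4 ^ p * A), n₁ + d, fun n hn => ?_⟩
  obtain ⟨w, hw⟩ : ∃ w, w = n / (20 * (2 * p + 1)) := ⟨_, rfl⟩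
  have hw1 : (2 * p + 1) * w ≤ n / 20 := by
    rw [Nat.le_div_iff_mul_le (by norm_num)]
    have := Nat.div_mul_le_self n (20 * (2 * p + 1))
    rw [← hw] at this
    linarith
  have hw2 : n ≤ d * w := by
    have h1 := Nat.lt_div_mul_add (a := n) (b := 20 * (2 * p + 1)) (by omega)
    rw [← hw] at h1
    have h2 : 1 ≤ w := by
      rw [hw]
      exact Nat.div_pos (by omega) (by omega)
    have h3 : 20 * (2 * p + 1) ≤ w * (20 * (2 * p + 1)) := Nat.le_mul_of_pos_left _ h2
    rw [hd, show 40 * (2 * p + 1) * w = w * (20 * (2 * p + 1)) + w * (20 * (2 * p + 1)) by ring]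
    omega
  have h1 := hcount n (n / 5 + 1) w (by omega)
  set U := {g | wordNorm S g = n ∧ ¬ HasBarrier o f M m₁ S 1000 T (n / 5 + 1)
    (n / 5 + 1 + (2 * p + 1) * w) g} with hU
  have hUfin : U.Finite := (wordBall_finite hS (n : ℝ)).subset fun g hg =>
    mem_wordBall_natCast.2 hg.1.le
  have hsub : {g | wordNorm S g = n ∧ ¬ HasReturn S g ∧ ¬ (IsStronglyContracting X g ∧
      35 / 100 * (n : ℝ) ≤ translationLength S g)} ⊆ U := by
    rintro g ⟨hg, hret, hbad⟩
    refine ⟨hg, fun hbar => hbad ?_⟩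
    rw [← hg]
    exact hgood g _ _ (by omega) hbar (by omega) (by omega) hret
  refine (Nat.mul_le_mul_right _ (Set.ncard_le_ncard hsub hUfin)).trans ?_
  have hn0 : 0 < n := by omega
  refine Nat.le_of_mul_le_mul_right ?_ (pow_pos hn0 (p + 1))
  calc U.ncard * n ^ p * n ^ (p + 1) = U.ncard * n ^ (2 * p + 1) := by ring
    _ ≤ U.ncard * (d * w) ^ (2 * p + 1) := by gcongr
    _ = d ^ (2 * p + 1) * (U.ncard * w ^ (2 * p + 1)) := by ring
    _ ≤ d ^ (2 * p + 1) * (A * (n + 1) * (Nat.log 2 n + 1) ^ (2 * p) * ballCard S n) := by gcongr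
    _ = d ^ (2 * p + 1) * (A * (n + 1) * ((Nat.log 2 n + 1) ^ 2) ^ p * ballCard S n) := by
        rw [pow_mul]
    _ ≤ d ^ (2 * p + 1) * (A * (2 * n) * (4 * n) ^ p * ballCard S n) := by
        have h2 : n + 1 ≤ 2 * n := by omega
        have h3 := log_add_one_sq_le n hn0
        gcongr
    _ = d ^ (2 * p + 1) * (2 * 4 ^ p * A) * ballCard S n * n ^ (p + 1) := by
        rw [mul_pow 4 n p]
        ring

/-- The proportion in large balls of elements that are not strongly contracting or have small
translation length is smaller than any power of the radius. -/
theorem ContractingAxis.exists_card_bad_ball_le (hX : IsGeodesicSpace X)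
    (hax : ContractingAxis φ o f C) (hqi : OrbitQI S o κ)
    (hS : Subgroup.closure (S : Set G) = ⊤) {u : G} (hc : 0 ≤ c)
    (hu : ∀ y : X, |(f y : ℝ)| ≤ c ∨ |(f (u • y) : ℝ)| ≤ c) (s : ℕ) :
    ∃ (A : ℝ) (N₀ : ℕ), 0 < A ∧ ∀ N, N₀ ≤ N →
      ({g | wordNorm S g ≤ N ∧ ¬ (IsStronglyContracting X g ∧
        3 / 10 * ((N : ℝ) + 1) < translationLength S g)}.ncard : ℝ) * N ^ s ≤ A * ballCard S N := by
  obtain ⟨r, hr, hpow⟩ := hax.exists_two_pow_le_ballCard hu hS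
  obtain ⟨h, hh, hlow, A, hA, hup⟩ := exists_growth_rate hS hr hpow
  obtain ⟨A', n₀, hbad⟩ := hax.exists_card_bad_sphere_le hX hqi hS hc hu (s + 1)
  obtain ⟨N₁, hN₁⟩ := exists_exp_negligible hh hA s
  refine ⟨2 * 2 ^ (s + 1) * A' + 1, N₁ + 2 * n₀ + 100, by positivity, fun N hN => ?_⟩
  have hN0 : 0 < N := by omega
  obtain ⟨V, hV⟩ : ∃ V : ℕ → Set G, ∀ n, V n = {g | wordNorm S g = n ∧ ¬ HasReturn S g ∧
      ¬ (IsStronglyContracting X g ∧ 35 / 100 * (n : ℝ) ≤ translationLength S g)} :=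
    ⟨_, fun _ => rfl⟩
  obtain ⟨W, hW⟩ : ∃ W : ℕ → Set G, ∀ n, W n = {g | wordNorm S g = n ∧ HasReturn S g} :=
    ⟨_, fun _ => rfl⟩
  obtain ⟨U, hU⟩ : ∃ U : ℕ → Set G, ∀ n, U n = if 9 * N < 10 * n then V n ∪ W n else ∅ :=
    ⟨_, fun _ => rfl⟩
  have hsub : {g | wordNorm S g ≤ N ∧ ¬ (IsStronglyContracting X g ∧
      3 / 10 * ((N : ℝ) + 1) < translationLength S g)} ⊆
      wordBall S ((9 * N / 10 : ℕ) : ℝ) ∪ ⋃ n ∈ Finset.range (N + 1), U n := by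
    rintro g ⟨hg, hbad⟩
    rcases Nat.lt_or_ge (9 * N) (10 * wordNorm S g) with hlt | hle
    · right
      simp only [Set.mem_iUnion, Finset.mem_range]
      refine ⟨wordNorm S g, by omega, ?_⟩
      rw [hU, if_pos hlt, hV, hW]
      by_cases hret : HasReturn S g
      · exact Or.inr ⟨rfl, hret⟩
      · refine Or.inl ⟨rfl, hret, fun hgood => hbad ⟨hgood.1, lt_of_lt_of_le ?_ hgood.2⟩⟩
        have h1 : (9 : ℝ) * N < 10 * wordNorm S g := by exact_mod_cast hlt
        have h2 : (100 : ℝ) ≤ N := by exact_mod_cast (by omega : 100 ≤ N)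
        linarith
    · exact Or.inl (mem_wordBall_natCast.2 (by omega))
  have hUball : ∀ n, U n ⊆ wordBall S (n : ℝ) := by
    intro n g hg
    rw [hU] at hg
    split_ifs at hg
    · rw [hV, hW] at hg
      exact mem_wordBall_natCast.2 (hg.elim (fun h => h.1.le) fun h => h.1.le)
    · exact hg.elim
  have hUfin : ∀ n, (U n).Finite := fun n => (wordBall_finite hS _).subset (hUball n)
  have hfin : (⋃ n ∈ Finset.range (N + 1), U n).Finite :=
    Set.Finite.biUnion (Finset.finite_toSet _) fun n _ => hUfin n
  have hUcard : ∀ n ∈ Finset.range (N + 1), ((U n).ncard : ℝ) * N ^ (s + 1) ≤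
      2 ^ (s + 1) * A' * ballCard S N + N ^ (s + 1) * ((N + 1) *
        (A ^ 3 * Real.exp (11 / 10 * h * (202 / 250 * N)))) := by
    intro n hn
    rw [Finset.mem_range] at hn
    rw [hU]
    split_ifs with hlt
    · have hnN : (n : ℝ) ≤ N := by exact_mod_cast (by omega : n ≤ N)
      have hNn : (N : ℝ) ≤ 2 * n := by exact_mod_cast (by omega : N ≤ 2 * n)
      have h1 : ((V n).ncard : ℝ) * n ^ (s + 1) ≤ A' * ballCard S n := by
        rw [hV]
        exact_mod_cast hbad n (by omega)
      have h2 : ((W n).ncard : ℝ) ≤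
          (n + 1) * (A ^ 3 * Real.exp (11 / 10 * h * (202 / 250 * n))) := by
        rw [hW]
        exact card_hasReturn_le hS hA.le (by positivity) hup n
      have h3 : ((V n ∪ W n).ncard : ℝ) ≤ (V n).ncard + (W n).ncard := by
        exact_mod_cast Set.ncard_union_le _ _
      have h4 : (ballCard S n : ℝ) ≤ ballCard S N := by
        exact_mod_cast ballCard_mono hS (by omega)
      calc ((V n ∪ W n).ncard : ℝ) * N ^ (s + 1)
          ≤ ((V n).ncard + (W n).ncard) * N ^ (s + 1) := by gcongr
        _ = (V n).ncard * N ^ (s + 1) + N ^ (s + 1) * (W n).ncard := by ring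
        _ ≤ (V n).ncard * (2 * n) ^ (s + 1) + N ^ (s + 1) *
            ((n + 1) * (A ^ 3 * Real.exp (11 / 10 * h * (202 / 250 * n)))) := by gcongr
        _ = 2 ^ (s + 1) * ((V n).ncard * n ^ (s + 1)) + N ^ (s + 1) *
            ((n + 1) * (A ^ 3 * Real.exp (11 / 10 * h * (202 / 250 * n)))) := by
            rw [mul_pow]
            ring
        _ ≤ 2 ^ (s + 1) * (A' * ballCard S N) + N ^ (s + 1) *
            ((N + 1) * (A ^ 3 * Real.exp (11 / 10 * h * (202 / 250 * N)))) := by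
            have h5 := h1.trans (mul_le_mul_of_nonneg_left h4 (Nat.cast_nonneg A'))
            gcongr
        _ = _ := by ring
    · rw [Set.ncard_empty, Nat.cast_zero, zero_mul]
      positivity
  have hsum : (({g | wordNorm S g ≤ N ∧ ¬ (IsStronglyContracting X g ∧
      3 / 10 * ((N : ℝ) + 1) < translationLength S g)}.ncard : ℕ) : ℝ) ≤
      A * Real.exp (11 / 10 * h * (9 / 10 * N)) +
        ∑ n ∈ Finset.range (N + 1), ((U n).ncard : ℝ) := by
    have h1 := (Set.ncard_le_ncard hsub ((wordBall_finite hS _).union hfin)).trans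
      (Set.ncard_union_le _ _)
    have h2 := h1.trans (Nat.add_le_add_left (ncard_biUnion_range_le U (N + 1)) _)
    have h3 : (ballCard S (9 * N / 10) : ℝ) ≤ A * Real.exp (11 / 10 * h * (9 / 10 * N)) := by
      refine (hup _).trans ?_
      have h4 : 10 * (9 * N / 10) ≤ 9 * N := by omega
      have h5 : (10 : ℝ) * ((9 * N / 10 : ℕ) : ℝ) ≤ 9 * N := by exact_mod_cast h4
      gcongr
      linarith
    refine le_trans ?_ (add_le_add_left h3 _)
    exact_mod_cast h2
  have hNR : (0 : ℝ) < N := by exact_mod_cast hN0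
  have hN1 : (N : ℝ) + 1 ≤ 2 * N := by
    have : (1 : ℝ) ≤ N := by exact_mod_cast hN0
    linarith
  have hneg := (hN₁ N (by omega)).trans (hlow N)
  refine le_of_mul_le_mul_right ?_ hNR
  have hmul := Finset.sum_le_sum hUcard
  rw [← Finset.sum_mul, Finset.sum_const, Finset.card_range, nsmul_eq_mul] at hmul
  push_cast at hmul
  calc _ = (({g | wordNorm S g ≤ N ∧ ¬ (IsStronglyContracting X g ∧
      3 / 10 * ((N : ℝ) + 1) < translationLength S g)}.ncard : ℕ) : ℝ) * N ^ (s + 1) := by ring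
    _ ≤ (A * Real.exp (11 / 10 * h * (9 / 10 * N)) +
        ∑ n ∈ Finset.range (N + 1), ((U n).ncard : ℝ)) * N ^ (s + 1) := by gcongr
    _ = A * Real.exp (11 / 10 * h * (9 / 10 * N)) * N ^ (s + 1) +
        (∑ n ∈ Finset.range (N + 1), ((U n).ncard : ℝ)) * N ^ (s + 1) := by ring
    _ ≤ A * Real.exp (11 / 10 * h * (9 / 10 * N)) * N ^ (s + 1) +
        ((N : ℝ) + 1) * (2 ^ (s + 1) * A' * ballCard S N + N ^ (s + 1) * ((N + 1) *
        (A ^ 3 * Real.exp (11 / 10 * h * (202 / 250 * N))))) := by gcongr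
    _ = N * (N ^ s * ((N + 1) ^ 2 * (A ^ 3 * Real.exp (11 / 10 * h * (202 / 250 * N))) +
        A * Real.exp (11 / 10 * h * (9 / 10 * N)))) +
        ((N : ℝ) + 1) * (2 ^ (s + 1) * A' * ballCard S N) := by ring
    _ ≤ N * ballCard S N + (2 * N) * (2 ^ (s + 1) * A' * ballCard S N) := by gcongr
    _ = _ := by ring

end Final

theorem mainTheorem3 {G : Type*} [Group G] {X : Type*} [MetricSpace X] [MulAction G X]
    (hX : IsGeodesicSpace X) (hact : IsGeometricAction G X) (hG : ¬ IsVirtuallyCyclic G)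
    (hsc : ∃ φ : G, IsStronglyContracting X φ)
    (S : Finset G) (hS : Subgroup.closure (S : Set G) = ⊤) (k : ℝ) (hk : 0 < k) :
    ∃ C : ℝ, 0 < C ∧ ∀ R : ℝ, 0 < R →
      ({g : G | g ∈ wordBall S R ∧
          (¬ IsStronglyContracting X g ∨ translationLength S g ≤ 0.3 * R)}.ncard : ℝ) /
        ((wordBall S R).ncard : ℝ) ≤ C / R ^ (k / 2) := by
  classical
  obtain ⟨φ, hφ⟩ := hsc
  have := hact.isometric
  obtain ⟨o, f, C, hax⟩ := exists_contractingAxis hX hφ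
  obtain ⟨κ, hqi⟩ := exists_orbitQI hX hact hS o
  obtain ⟨u, c, hc, hu⟩ := hax.exists_independent hX (hqi.finite_dist_le hS) hG
  obtain ⟨A, N₀, hA, hbad⟩ := hax.exists_card_bad_ball_le hX hqi hS hc hu ⌈k / 2⌉₊
  obtain ⟨s, hs⟩ : ∃ s, s = ⌈k / 2⌉₊ := ⟨_, rfl⟩
  rw [← hs] at hbad
  have hks : k / 2 ≤ s := hs ▸ Nat.le_ceil _
  refine ⟨max (2 ^ s * A) (((N₀ : ℝ) + 1) ^ (k / 2)), lt_max_of_lt_left (by positivity),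
    fun R hR => ?_⟩
  have hball : (0 : ℝ) < ballCard S ⌊R⌋₊ := by exact_mod_cast ballCard_pos hS _
  have hRk : 0 < R ^ (k / 2) := Real.rpow_pos_of_pos hR _
  rw [wordBall_eq_natFloor hR.le, ← ballCard]
  rcases lt_or_ge R (N₀ + 1) with hlt | hge
  · have h1 : {g : G | g ∈ wordBall S (⌊R⌋₊ : ℝ) ∧
        (¬ IsStronglyContracting X g ∨ translationLength S g ≤ 0.3 * R)}.ncard ≤
        ballCard S ⌊R⌋₊ := Set.ncard_le_ncard (fun g hg => hg.1) (wordBall_finite hS _)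
    have h2 : R ^ (k / 2) ≤ ((N₀ : ℝ) + 1) ^ (k / 2) :=
      Real.rpow_le_rpow hR.le hlt.le (by positivity)
    calc _ ≤ (1 : ℝ) := by
          rw [div_le_one hball]
          exact_mod_cast h1
      _ ≤ _ := by
          rw [le_div_iff₀ hRk, one_mul]
          exact h2.trans (le_max_right _ _)
  · have hR1 : 1 ≤ R := le_trans (by simp) hge
    have hfloor := Nat.lt_floor_add_one R
    have h1 := hbad ⌊R⌋₊ (Nat.le_floor (by linarith))
    have hsub : {g : G | g ∈ wordBall S (⌊R⌋₊ : ℝ) ∧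
        (¬ IsStronglyContracting X g ∨ translationLength S g ≤ 0.3 * R)} ⊆
        {g | wordNorm S g ≤ ⌊R⌋₊ ∧ ¬ (IsStronglyContracting X g ∧
          3 / 10 * ((⌊R⌋₊ : ℝ) + 1) < translationLength S g)} := by
      rintro g ⟨hg, hbad⟩
      refine ⟨mem_wordBall_natCast.1 hg, fun hgood => ?_⟩
      rcases hbad with h | h
      · exact h hgood.1
      · have h2 := hgood.2
        linarith
    have h2 := Set.ncard_le_ncard hsub ((wordBall_finite hS (⌊R⌋₊ : ℝ)).subset fun g hg =>
      mem_wordBall_natCast.2 hg.1)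
    have h3 : R ≤ 2 * ⌊R⌋₊ := by
      have : (1 : ℝ) ≤ ⌊R⌋₊ := by exact_mod_cast Nat.one_le_floor_iff R |>.2 hR1
      linarith
    have h4 : R ^ (k / 2) ≤ (2 * (⌊R⌋₊ : ℝ)) ^ s := by
      calc R ^ (k / 2) ≤ R ^ (s : ℝ) := Real.rpow_le_rpow_of_exponent_le hR1 hks
        _ = R ^ s := Real.rpow_natCast R s
        _ ≤ _ := by gcongr
    rw [div_le_div_iff₀ hball hRk]
    calc _ ≤ ({g | wordNorm S g ≤ ⌊R⌋₊ ∧ ¬ (IsStronglyContracting X g ∧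
          3 / 10 * ((⌊R⌋₊ : ℝ) + 1) < translationLength S g)}.ncard : ℝ) *
          (2 * (⌊R⌋₊ : ℝ)) ^ s := by gcongr
      _ = 2 ^ s * (({g | wordNorm S g ≤ ⌊R⌋₊ ∧ ¬ (IsStronglyContracting X g ∧
          3 / 10 * ((⌊R⌋₊ : ℝ) + 1) < translationLength S g)}.ncard : ℝ) * (⌊R⌋₊ : ℝ) ^ s) := by
          rw [mul_pow]
          ring
      _ ≤ 2 ^ s * (A * ballCard S ⌊R⌋₊) := by gcongr
      _ = 2 ^ s * A * ballCard S ⌊R⌋₊ := by ring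
      _ ≤ _ := by gcongr; exact le_max_left _ _
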